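/- Let $p\in\mathbb N$ and $g>0$. There is $\delta_0=\delta_0(p,g)>0$ with the following property. **Setting.** Let $\mathcal H$ be a separable complex Hilbert space with a fixed orthonormal basis, let $e_1,\dots,e_p$ be $p$ distinct vectors of this basis, and let $C$ be the complex conjugation with respect to the basis, $C(\sum_i v_ie_i)=\sum_i\overline{v_i}e_i$; for $A\in\mathcal L(\mathcal H)$ put $\overline A=CAC$, and $\overline v=Cv$ for $v\in\mathcal H$. For $v\in\mathcal H$ write $v_j=\langle e_j|v\rangle$ and $[v]=(|v_1|^2,\dots,|v_p|^2)$. Let $\mathcal T,\mathcal X\subset\mathbb R$ be open sets containing $[0,1]$ and let $(t,x)\mapsto H(t,x)\in\mathcal L(\mathcal H)$ be $C^\infty$ in operator norm on $\mathcal T\times\mathcal X^p$, such that for all $(t,x)\in\mathcal T\times\mathcal X^p$: * $H(t,x)=H(t,x)^*$ and $\overline{H(t,x)}=H(t,x)$; * $\|\partial_{x_j}H(t,x)\|\le\delta$ for $1\le j\le p$, where $0<\delta<\delta_0$; * the spectrum of $H(t,x)$ consists of $N$ eigenvalues $\lambda_1(t,x)<\dots<\lambda_N(t,x)$, of finite or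 infinite multiplicity, with $\lambda_{j+1}(t,x)-\lambda_j(t,x)\ge g$; * for a fixed index $j_0$ the eigenvalue $\lambda:=\lambda_{j_0}$ is simple. Let $\mathcal T_1\subset\mathcal T$ be an open interval containing $0$ and let $\omega\in C^\infty(\mathcal T_1,\mathcal H)$ be an instantaneous nonlinear eigenvector: for all $t\in\mathcal T_1$, $$\|\omega(t)\|=1,\qquad H(t,[\omega(t)])\,\omega(t)=\lambda(t,[\omega(t)])\,\omega(t),\qquad \langle\omega(t)|\partial_t\omega(t)\rangle=0 .$$ Put $K(t,x)=H(t,x)-\lambda(t,x)$, $\;v_j(t)=\partial_{x_j}K(t,[\omega(t)])\,\omega(t)$ and, on $\mathcal H\times\mathcal H$, $F(t)=F_0(t)+G(t)$ with $$F_0(t)=\begin{pmatrix}K(t,[\omega(t)])&0\\0&-\overline K(t,[\omega(t)])\end{pmatrix},\qquad G(t)=\sum_{j=1}^p\left|\begin{pmatrix}v_j(t)\\-\overline{v_j}(t)\end{pmatrix}\right\rangle\left\langle\begin{pmatrix}\omega_j(t)e_j\\\overline{\omega_j}(t)e_j\end{pmatrix}\right| .$$ Assume that $F(t)$ is semisimple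 with real eigenvalues of constant multiplicity for $t\in\mathcal T_1$, that is, $F(t)=\sum_{i=1}^M\ell_i(t)\,\mathbb P_i(t)$ with $M$ independent of $t$, real $\ell_1(t)<\dots<\ell_M(t)$, and nonzero bounded projections with $\mathbb P_i\mathbb P_k=0$ for $i\ne k$ and $\sum_i\mathbb P_i=\mathrm{Id}$, whose (possibly infinite) ranks do not depend on $t$. **Conclusion.** There are an open interval $\mathcal T_0\subset\mathcal T_1$ containing $0$ and a constant $c$, both independent of $\varepsilon$, such that for all $\varepsilon>0$ every solution on $\mathcal T_0$ of $$i\varepsilon\,\partial_tv^\varepsilon(t)=H(t,[v^\varepsilon(t)])\,v^\varepsilon(t),\qquad v^\varepsilon(0)=\omega(0),$$ satisfies $$\Bigl\|v^\varepsilon(t)-e^{-\frac i\varepsilon\int_0^t\lambda(s,[\omega(s)])\,ds}\,\omega(t)\Bigr\|\le c\,\varepsilon\qquad\text{for all }t\in\mathcal T_0 .$$ -/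

import Mathlib

noncomputable section

namespace NonlinearAdiabatic

universe u w

variable {𝓗 : Type u} [NormedAddCommGroup 𝓗] [InnerProductSpace ℂ 𝓗] [CompleteSpace 𝓗]
variable {ι : Type w} {p : ℕ}

/-- The vector `[v] = (|v₁|², …, |vₚ|²)` of squared moduli of the `p` selected coordinates
`vⱼ = ⟨eⱼ, v⟩` of `v`; here `eⱼ = b (idx j)`. -/
def occ (b : HilbertBasis ι ℂ 𝓗) (idx : Fin p ↪ ι) (v : 𝓗) : Fin p → ℝ :=
  fun j => ‖inner ℂ (b (idx j)) v‖ ^ 2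

/-- The anti-unitary complex conjugation `C (∑ vᵢ eᵢ) = ∑ conj vᵢ eᵢ` attached to the basis. -/
def conjugation (b : HilbertBasis ι ℂ 𝓗) : 𝓗 →L⋆[ℂ] 𝓗 :=
  (b.repr.symm.toContinuousLinearEquiv : lp (fun _ : ι => ℂ) 2 →L[ℂ] 𝓗).comp
    (((starₗᵢ ℂ : lp (fun _ : ι => ℂ) 2 ≃ₗᵢ⋆[ℂ] lp (fun _ : ι => ℂ) 2) : lp (fun _ : ι => ℂ) 2 →L⋆[ℂ] lp (fun _ : ι => ℂ) 2).comp
      (b.repr.toContinuousLinearEquiv : 𝓗 →L[ℂ] lp (fun _ : ι => ℂ) 2))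

/-- The conjugate operator `Ā = C A C`. -/
def conjOp (b : HilbertBasis ι ℂ 𝓗) (A : 𝓗 →L[ℂ] 𝓗) : 𝓗 →L[ℂ] 𝓗 :=
  (conjugation b).comp (A.comp (conjugation b))

/-- The cube `𝒳ᵖ`. -/
def cube (p : ℕ) (X : Set ℝ) : Set (Fin p → ℝ) := Set.univ.pi fun _ => X

/-- The standing assumptions on the Hamiltonian `H(t,x)`, `(t,x) ∈ 𝒯 × 𝒳ᵖ`, with spectral gap at
least `g`, first `x`-derivatives bounded by `δ`, and eigenvalues `lam 0 < lam 1 < ⋯ < lam (N-1)`,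
among which `lam j₀` is simple. -/
structure IsAdmissible (b : HilbertBasis ι ℂ 𝓗) (T X : Set ℝ) (g δ : ℝ) {N : ℕ}
    (lam : Fin N → ℝ → (Fin p → ℝ) → ℝ) (j₀ : Fin N)
    (H : ℝ → (Fin p → ℝ) → 𝓗 →L[ℂ] 𝓗) : Prop where
  isOpen_T : IsOpen T
  unit_subset_T : Set.Icc 0 1 ⊆ T
  isOpen_X : IsOpen X
  unit_subset_X : Set.Icc 0 1 ⊆ X
  /-- `H` is smooth for the operator norm. -/
  smooth : ContDiffOn ℝ (⊤ : ℕ∞) (fun q : ℝ × (Fin p → ℝ) => H q.1 q.2) (T ×ˢ cube p X)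
  selfAdjoint : ∀ t ∈ T, ∀ x ∈ cube p X, IsSelfAdjoint (H t x)
  /-- `‖∂H/∂xⱼ‖ ≤ δ`. -/
  partial_le : ∀ t ∈ T, ∀ x ∈ cube p X, ∀ j : Fin p,
    ‖fderiv ℝ (fun y => H t y) x (Pi.single j 1)‖ ≤ δ
  /-- The spectrum consists of the `N` numbers `lam j t x`, -/
  spectrum_eq : ∀ t ∈ T, ∀ x ∈ cube p X,
    spectrum ℂ (H t x) = Set.range fun j => (lam j t x : ℂ)
  /-- which are listed increasingly and separated by gaps of size at least `g`. -/
  gap : ∀ t ∈ T, ∀ x ∈ cube p X, ∀ i j : Fin N, i < j → lam i t x + g ≤ lam j t x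
  /-- The eigenvalue `lam j₀` is simple. -/
  simple : ∀ t ∈ T, ∀ x ∈ cube p X,
    Module.finrank ℂ
      (Module.End.eigenspace (H t x : 𝓗 →ₗ[ℂ] 𝓗) (lam j₀ t x : ℂ)) = 1
  /-- `H(t,x)` is a real operator. -/
  real : ∀ t ∈ T, ∀ x ∈ cube p X, conjOp b (H t x) = H t x

/-- `ω` is an instantaneous nonlinear eigenvector on the set of times `S` for the eigenvalue
`mu(t,x)` of `H(t,x)`: a smooth family of unit vectors with `H(t,[ω])ω = mu(t,[ω])ω` and
`⟨ω, ∂ₜω⟩ = 0`. -/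
structure IsNonlinearEigenvector (b : HilbertBasis ι ℂ 𝓗) (idx : Fin p ↪ ι)
    (H : ℝ → (Fin p → ℝ) → 𝓗 →L[ℂ] 𝓗) (mu : ℝ → (Fin p → ℝ) → ℝ)
    (S : Set ℝ) (ω : ℝ → 𝓗) : Prop where
  smooth : ContDiffOn ℝ (⊤ : ℕ∞) ω S
  norm_eq : ∀ t ∈ S, ‖ω t‖ = 1
  eigen : ∀ t ∈ S, H t (occ b idx (ω t)) (ω t) = (mu t (occ b idx (ω t)) : ℂ) • ω t
  parallel : ∀ t ∈ S, inner ℂ (ω t) (deriv ω t) = 0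

/-- The shifted Hamiltonian `H(t,x) - mu(t,x)`. -/
def shifted (H : ℝ → (Fin p → ℝ) → 𝓗 →L[ℂ] 𝓗) (mu : ℝ → (Fin p → ℝ) → ℝ)
    (t : ℝ) (x : Fin p → ℝ) : 𝓗 →L[ℂ] 𝓗 :=
  H t x - (mu t x : ℂ) • ContinuousLinearMap.id ℂ 𝓗

/-- `F₀ = diag(A, -Ā)` on `𝓗 × 𝓗`. -/
def blockF₀ (b : HilbertBasis ι ℂ 𝓗) (A : 𝓗 →L[ℂ] 𝓗) : (𝓗 × 𝓗) →L[ℂ] (𝓗 × 𝓗) :=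
  A.prodMap (-(conjOp b A))

/-- For a family `K(x)` of operators and a vector `ψ`, the vector `(∂K/∂xⱼ)([ψ]) ψ`. -/
def derivVec (b : HilbertBasis ι ℂ 𝓗) (idx : Fin p ↪ ι)
    (K : (Fin p → ℝ) → 𝓗 →L[ℂ] 𝓗) (ψ : 𝓗) (j : Fin p) : 𝓗 :=
  fderiv ℝ K (occ b idx ψ) (Pi.single j 1) ψ

/-- The functional `(a, c) ↦ conj ψⱼ ⟨eⱼ, a⟩ + ψⱼ ⟨eⱼ, c⟩`, that is `⟨(ψⱼ eⱼ, conj ψⱼ eⱼ)|`. -/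
def nuBra (b : HilbertBasis ι ℂ 𝓗) (idx : Fin p ↪ ι) (ψ : 𝓗) (j : Fin p) :
    (𝓗 × 𝓗) →L[ℂ] ℂ :=
  (starRingEnd ℂ (inner ℂ (b (idx j)) ψ)) •
      (innerSL ℂ (b (idx j))).comp (ContinuousLinearMap.fst ℂ 𝓗 𝓗) +
    (inner ℂ (b (idx j)) ψ : ℂ) •
      (innerSL ℂ (b (idx j))).comp (ContinuousLinearMap.snd ℂ 𝓗 𝓗)

/-- The finite rank operator `G = ∑ⱼ |(vⱼ, -C vⱼ)⟩⟨(ψⱼ eⱼ, conj ψⱼ eⱼ)|` on `𝓗 × 𝓗`, where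
`vⱼ = (∂K/∂xⱼ)([ψ]) ψ`. -/
def blockG (b : HilbertBasis ι ℂ 𝓗) (idx : Fin p ↪ ι)
    (K : (Fin p → ℝ) → 𝓗 →L[ℂ] 𝓗) (ψ : 𝓗) : (𝓗 × 𝓗) →L[ℂ] (𝓗 × 𝓗) :=
  ∑ j : Fin p, (nuBra b idx ψ j).smulRight
    (derivVec b idx K ψ j, -(conjugation b (derivVec b idx K ψ j)))

/-- The operator `F(t) = F₀(t) + G(t)` that linearises, around `ω(t)`, the evolution equation
driven by the shifted Hamiltonian `H(t,x) - mu(t,x)`. -/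
def linF (b : HilbertBasis ι ℂ 𝓗) (idx : Fin p ↪ ι)
    (H : ℝ → (Fin p → ℝ) → 𝓗 →L[ℂ] 𝓗) (mu : ℝ → (Fin p → ℝ) → ℝ)
    (ω : ℝ → 𝓗) (t : ℝ) : (𝓗 × 𝓗) →L[ℂ] (𝓗 × 𝓗) :=
  blockF₀ b (shifted H mu t (occ b idx (ω t))) + blockG b idx (shifted H mu t) (ω t)

/-- `A = ∑ⱼ ℓⱼ Qⱼ` with real numbers `ℓ₀ < ℓ₁ < ⋯` and nonzero (not necessarily orthogonal)
projections `Qⱼ`, pairwise disjoint and summing to the identity. -/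
structure IsRealSpectralDecomposition {E : Type u} [NormedAddCommGroup E] [NormedSpace ℂ E]
    (A : E →L[ℂ] E) {M : ℕ} (ℓ : Fin M → ℝ) (Q : Fin M → E →L[ℂ] E) : Prop where
  strictMono : StrictMono ℓ
  ne_zero : ∀ i, Q i ≠ 0
  idem : ∀ i, (Q i).comp (Q i) = Q i
  disjoint : ∀ i j, i ≠ j → (Q i).comp (Q j) = 0
  sum_eq : ∑ i, Q i = ContinuousLinearMap.id ℂ E
  eq_sum : A = ∑ i, (ℓ i : ℂ) • Q i

/-- `F(t)` is semisimple for all `t ∈ S`, with finitely many real eigenvalues, whose number and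
(possibly infinite) multiplicities do not depend on `t ∈ S`. -/
def IsRealSemisimpleOn {E : Type u} [NormedAddCommGroup E] [NormedSpace ℂ E]
    (F : ℝ → E →L[ℂ] E) (S : Set ℝ) : Prop :=
  ∃ (M : ℕ) (ℓ : Fin M → ℝ → ℝ) (Q : Fin M → ℝ → E →L[ℂ] E),
    (∀ t ∈ S, IsRealSpectralDecomposition (F t) (fun i => ℓ i t) (fun i => Q i t)) ∧
    ∀ i, ∀ s ∈ S, ∀ t ∈ S,
      Module.rank ℂ (LinearMap.range (Q i s : E →ₗ[ℂ] E)) =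
        Module.rank ℂ (LinearMap.range (Q i t : E →ₗ[ℂ] E))

/-- `v` solves `i ε ∂ₜ v = H(t,[v]) v` on `S`, with `v(0) = v₀`. -/
structure IsSolution (b : HilbertBasis ι ℂ 𝓗) (idx : Fin p ↪ ι)
    (H : ℝ → (Fin p → ℝ) → 𝓗 →L[ℂ] 𝓗) (S : Set ℝ) (ε : ℝ) (v₀ : 𝓗) (v : ℝ → 𝓗) : Prop where
  init : v 0 = v₀
  differentiable : ∀ t ∈ S, DifferentiableAt ℝ v t
  equation : ∀ t ∈ S,
    (Complex.I * (ε : ℂ)) • deriv v t = H t (occ b idx (v t)) (v t)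

end NonlinearAdiabatic

end

noncomputable section

namespace NonlinearAdiabatic

open Filter Topology

universe u w

section

/-! ### Matching of increasing finite sequences -/

/-! The argument has two halves: an amplitude estimate up to a time-dependent phase, and a sharper
estimate of that phase.

Amplitude. Remove from the solution the phase built from its own occupations, `φ' = λ(t,[v])`
(`IsSolution.exists_gauge`). The gauged solution `u` satisfies `iε u' = K(t,[u]) u`, and a second
order Taylor expansion at `ω` (`exists_linearization_bound`) shows that `u - ω` obeys a real-linear
equation up to a quadratic error. The source `-iε ω'` of that equation is cancelled by the corrector
`iεβ` with `Kβ = ω'`; since `β` has the same phase as `ω` with respect to the conjugation, `iεβ`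
does not change the occupations to first order. Writing `z = u - ω - iεβ` and passing to `(z, Cz)`
makes the equation complex-linear with generator `F(t)`. As `F` is semisimple with real eigenvalues,
its frozen flow preserves `∑ ‖Qᵢ Y‖`, however small `ε` is. The projections `Qᵢ` are Lipschitz in
time (`exists_norm_proj_sub_le`), so this quantity grows at a bounded rate
(`sum_norm_proj_le_of_hasDerivAt`). The quadratic error divided by `ε` is again `O(ε)`, and a
bootstrap on a short time interval gives `u - ω = O(ε)` (`exists_error_bound`).

Phase. The phases `φ` and `θ = ∫ λ(s,[ω])` enter divided by `ε`, so `φ - θ` must be `O(ε²)`, while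
`φ' - θ'` is a priori only `O(ε)`. Its leading term, however, depends only on the real part `a` of
`u - ω`. The real part of the equation reads `A a = (iε Im)' + O(ε²)`, where `Im` stands for
`imagPart (u - ω)` and `A` is `K` plus a rank one term and the coupling; the rank one term is
harmless because normalisation makes the real component along `ω` quadratic. For small `δ` the
operator `A` is invertible by a Neumann series, so the leading term is a form in `(iε Im)'`. An
integration by parts in time gains the missing factor `ε` (`exists_phase_bound`).

Nothing is assumed about the smoothness of `λ`: a Temple-type inequality
(`abs_eigenvalue_sub_mean_le`) yields its first order expansion with a uniform quadratic error. -/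

theorem abs_sub_le_of_forall_exists {N : ℕ} {a b : Fin N → ℝ} {γ r : ℝ}
    (ha : ∀ i j, i < j → a i + γ ≤ a j) (hb : StrictMono b) (hr : 2 * r < γ)
    (h : ∀ i, ∃ k, |a i - b k| ≤ r) (i : Fin N) : |a i - b i| ≤ r := by
  choose k hk using h
  -- Two entries of `a` more than `2r` apart cannot choose indices in the wrong order; a strictly
  -- increasing self-map of `Fin N` is the identity.
  have hmono : StrictMono k := by
    intro i j hij
    by_contra hle
    have h1 := hb.monotone (not_lt.1 hle)
    have h2 := abs_le.1 (hk i)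
    have h3 := abs_le.1 (hk j)
    have h4 := ha i j hij
    linarith
  have := hk i
  rwa [hmono.eq_id] at this

/-! ### Families of semisimple operators -/

section Semisimple

variable {E : Type*} [NormedAddCommGroup E] [NormedSpace ℂ E]

namespace IsRealSpectralDecomposition

variable {A : E →L[ℂ] E} {M : ℕ} {ℓ : Fin M → ℝ} {Q : Fin M → E →L[ℂ] E}

theorem sum_proj_apply (h : IsRealSpectralDecomposition A ℓ Q) (v : E) : ∑ i, Q i v = v := by
  have := congrArg (fun B : E →L[ℂ] E => B v) h.sum_eq
  simpa [sum_apply] using this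

theorem apply_apply (h : IsRealSpectralDecomposition A ℓ Q) (i j : Fin M) (v : E) :
    Q i (Q j v) = if i = j then Q i v else 0 := by
  split_ifs with hij
  · subst hij
    exact congrArg (fun B : E →L[ℂ] E => B v) (h.idem i)
  · exact congrArg (fun B : E →L[ℂ] E => B v) (h.disjoint i j hij)

theorem apply_eq (h : IsRealSpectralDecomposition A ℓ Q) (v : E) :
    A v = ∑ i, (ℓ i : ℂ) • Q i v := by
  have := congrArg (fun B : E →L[ℂ] E => B v) h.eq_sum
  simpa [sum_apply] using this

theorem proj_apply (h : IsRealSpectralDecomposition A ℓ Q) (i : Fin M) (v : E) :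
    Q i (A v) = (ℓ i : ℂ) • Q i v := by
  rw [h.apply_eq, map_sum]
  simp [h.apply_apply]

theorem apply_proj (h : IsRealSpectralDecomposition A ℓ Q) (i : Fin M) (v : E) :
    A (Q i v) = (ℓ i : ℂ) • Q i v := by
  rw [h.apply_eq]
  simp [h.apply_apply]

theorem abs_le_norm (h : IsRealSpectralDecomposition A ℓ Q) (i : Fin M) : |ℓ i| ≤ ‖A‖ := by
  obtain ⟨v, hv⟩ : ∃ v, Q i v ≠ 0 := by
    by_contra! hcon
    exact h.ne_zero i (ContinuousLinearMap.ext hcon)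
  have h1 := A.le_opNorm (Q i v)
  rw [h.apply_proj, norm_smul, Complex.norm_real, Real.norm_eq_abs] at h1
  exact le_of_mul_le_mul_right h1 (norm_pos_iff.2 hv)

theorem norm_le_sum (h : IsRealSpectralDecomposition A ℓ Q) (v : E) : ‖v‖ ≤ ∑ i, ‖Q i v‖ := by
  conv_lhs => rw [← h.sum_proj_apply v]
  exact norm_sum_le _ _

/-- Intertwining of the projections of two operators. -/
theorem norm_proj_comp_proj_le {B : E →L[ℂ] E} {ℓ' : Fin M → ℝ} {Q' : Fin M → E →L[ℂ] E}
    (h : IsRealSpectralDecomposition A ℓ Q) (h' : IsRealSpectralDecomposition B ℓ' Q')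
    {i k : Fin M} {γ : ℝ} (hγ : 0 < γ) (hik : γ ≤ |ℓ i - ℓ' k|) :
    ‖(Q i).comp (Q' k)‖ ≤ ‖Q i‖ * ‖Q' k‖ * ‖A - B‖ / γ := by
  -- Sandwiching `A - B` between eigenprojections multiplies `Qᵢ Q'ₖ` by the difference of the
  -- eigenvalues, so separated eigenvalues allow division.
  have key : (Q i).comp ((A - B).comp (Q' k)) =
      ((ℓ i - ℓ' k : ℝ) : ℂ) • (Q i).comp (Q' k) := by
    ext v
    simp only [ContinuousLinearMap.comp_apply, sub_apply,
      smul_apply, map_sub, h.proj_apply, h'.apply_proj, map_smul]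
    push_cast
    rw [sub_smul]
  rw [le_div_iff₀ hγ]
  calc ‖(Q i).comp (Q' k)‖ * γ ≤ ‖(Q i).comp (Q' k)‖ * |ℓ i - ℓ' k| := by gcongr
    _ = ‖(Q i).comp ((A - B).comp (Q' k))‖ := by
      rw [key, norm_smul, Complex.norm_real, Real.norm_eq_abs, mul_comm]
    _ ≤ ‖Q i‖ * (‖A - B‖ * ‖Q' k‖) := by
      refine (ContinuousLinearMap.opNorm_comp_le _ _).trans ?_
      gcongr
      exact ContinuousLinearMap.opNorm_comp_le _ _
    _ = _ := by ring

/-- Inserting both resolutions of the identity gives `Qᵢ - Q'ᵢ = ∑ₖ (Qᵢ Q'ₖ - Qₖ Q'ᵢ)`. The term `k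
= i` cancels and the others pair distinct indices, where the eigenvalues are separated. No contour
integral is needed. -/
theorem norm_proj_sub_proj_le {B : E →L[ℂ] E} {ℓ' : Fin M → ℝ} {Q' : Fin M → E →L[ℂ] E}
    (h : IsRealSpectralDecomposition A ℓ Q) (h' : IsRealSpectralDecomposition B ℓ' Q')
    {γ C C' : ℝ} (hγ : 0 < γ) (hik : ∀ i k, i ≠ k → γ ≤ |ℓ i - ℓ' k|)
    (hC : ∀ i, ‖Q i‖ ≤ C) (hC' : ∀ i, ‖Q' i‖ ≤ C') (i : Fin M) :
    ‖Q i - Q' i‖ ≤ 2 * M * (C * C' * ‖A - B‖ / γ) := by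
  have hC0 : 0 ≤ C := (norm_nonneg _).trans (hC i)
  have hC0' : 0 ≤ C' := (norm_nonneg _).trans (hC' i)
  have bound : ∀ j k, j ≠ k → ‖(Q j).comp (Q' k)‖ ≤ C * C' * ‖A - B‖ / γ := by
    intro j k hjk
    refine (h.norm_proj_comp_proj_le h' hγ (hik j k hjk)).trans ?_
    gcongr
    · exact hC j
    · exact hC' k
  have heq : Q i - Q' i = ∑ k, ((Q i).comp (Q' k) - (Q k).comp (Q' i)) := by
    ext v
    simp only [sub_apply, sum_apply, ContinuousLinearMap.comp_apply,
      Finset.sum_sub_distrib]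
    rw [h.sum_proj_apply, ← map_sum, h'.sum_proj_apply]
  rw [heq]
  refine (norm_sum_le _ _).trans ?_
  have hterm : ∀ k ∈ Finset.univ, ‖(Q i).comp (Q' k) - (Q k).comp (Q' i)‖ ≤
      2 * (C * C' * ‖A - B‖ / γ) := by
    intro k _
    by_cases hk : k = i
    · subst hk
      rw [sub_self, norm_zero]
      positivity
    · refine (norm_sub_le _ _).trans ?_
      have := bound i k (Ne.symm hk)
      have := bound k i hk
      linarith
  refine (Finset.sum_le_sum hterm).trans (le_of_eq ?_)
  simp
  ring

theorem list_prod_comp_proj (h : IsRealSpectralDecomposition A ℓ Q) (l : List ℝ) (i : Fin M)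
    (v : E) :
    (l.map fun c : ℝ => A - (c : ℂ) • (1 : E →L[ℂ] E)).prod (Q i v) =
      (((l.map fun c : ℝ => ℓ i - c).prod : ℝ) : ℂ) • Q i v := by
  induction l with
  | nil => simp
  | cons c l ih =>
    simp only [List.map_cons, List.prod_cons, mul_apply_eq_comp, ih, map_smul]
    simp only [sub_apply, h.apply_proj, smul_apply,
      one_apply_eq_self, ← sub_smul, smul_smul]
    congr 1
    push_cast
    ring

theorem list_prod_eq_zero (h : IsRealSpectralDecomposition A ℓ Q) :
    ((List.ofFn ℓ).map fun c : ℝ => A - (c : ℂ) • (1 : E →L[ℂ] E)).prod = 0 := by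
  ext v
  rw [← h.sum_proj_apply v, map_sum, zero_apply]
  refine Finset.sum_eq_zero fun i _ => ?_
  rw [h.list_prod_comp_proj]
  have : ((List.ofFn ℓ).map fun c : ℝ => ℓ i - c).prod = 0 := by
    rw [List.prod_eq_zero_iff, List.mem_map]
    exact ⟨ℓ i, by simp, sub_self _⟩
  rw [this]
  simp

end IsRealSpectralDecomposition

/-! ### Annihilating products, continuity of eigenvalues and of spectral projections -/

theorem abs_list_prod_sub_le {R : ℝ} {μ : ℝ} (hμ : |μ| ≤ R) (l : List ℝ)
    (hl : ∀ c ∈ l, |c| ≤ R) : |(l.map fun c : ℝ => μ - c).prod| ≤ (2 * R) ^ l.length := by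
  have hR : 0 ≤ R := (abs_nonneg _).trans hμ
  induction l with
  | nil => simp
  | cons c l ih =>
    simp only [List.map_cons, List.prod_cons, List.length_cons, pow_succ', abs_mul]
    have h1 : |μ - c| ≤ 2 * R := by
      have := abs_sub μ c
      have := hl c (by simp)
      linarith
    have h2 := ih fun d hd => hl d (by simp [hd])
    gcongr

/-- On an eigenvector of `B` each factor `A - c` acts as `μ - c` up to an error `A - B`; induction
telescopes these errors. With the annihilating product of `A` the left side is explicit, which
forces `μ` near the spectrum of `A`. -/
theorem norm_list_prod_apply_sub_le {A B : E →L[ℂ] E} {R μ : ℝ} (hR : 1 ≤ R) (hA : ‖A‖ ≤ R)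
    (hμ : |μ| ≤ R) {v : E} (hv : B v = (μ : ℂ) • v) (l : List ℝ) (hl : ∀ c ∈ l, |c| ≤ R) :
    ‖(l.map fun c : ℝ => A - (c : ℂ) • (1 : E →L[ℂ] E)).prod v -
      (((l.map fun c : ℝ => μ - c).prod : ℝ) : ℂ) • v‖ ≤
      l.length * (2 * R) ^ l.length * ‖A - B‖ * ‖v‖ := by
  induction l with
  | nil => simp
  | cons c l ih =>
    have hl' : ∀ d ∈ l, |d| ≤ R := fun d hd => hl d (by simp [hd])
    specialize ih hl'
    set w := (l.map fun c : ℝ => A - (c : ℂ) • (1 : E →L[ℂ] E)).prod v with hw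
    set π := (l.map fun c : ℝ => μ - c).prod with hπ
    have hπb : |π| ≤ (2 * R) ^ l.length := abs_list_prod_sub_le hμ l hl'
    have hc : |c| ≤ R := hl c (by simp)
    have hop : ‖A - (c : ℂ) • (1 : E →L[ℂ] E)‖ ≤ 2 * R := by
      refine (norm_sub_le _ _).trans ?_
      have h1 : ‖(c : ℂ) • (1 : E →L[ℂ] E)‖ ≤ R * 1 := by
        rw [norm_smul, Complex.norm_real, Real.norm_eq_abs]
        exact mul_le_mul hc ContinuousLinearMap.norm_id_le (norm_nonneg _) (by linarith)
      linarith
    have heq : (List.map (fun c : ℝ => A - (c : ℂ) • (1 : E →L[ℂ] E)) (c :: l)).prod v -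
        (((List.map (fun c => μ - c) (c :: l)).prod : ℝ) : ℂ) • v =
        (A - (c : ℂ) • (1 : E →L[ℂ] E)) (w - (π : ℂ) • v) + (π : ℂ) • (A - B) v := by
      simp only [List.map_cons, List.prod_cons, mul_apply_eq_comp, ← hw, ← hπ]
      simp only [sub_apply, smul_apply,
        one_apply_eq_self, map_sub, map_smul, hv]
      push_cast
      module
    rw [heq]
    refine (norm_add_le _ _).trans ?_
    have e1 : ‖(A - (c : ℂ) • (1 : E →L[ℂ] E)) (w - (π : ℂ) • v)‖ ≤
        2 * R * (l.length * (2 * R) ^ l.length * ‖A - B‖ * ‖v‖) :=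
      ((A - (c : ℂ) • (1 : E →L[ℂ] E)).le_opNorm _).trans
        (mul_le_mul hop ih (norm_nonneg _) (by linarith))
    have e2 : ‖(π : ℂ) • (A - B) v‖ ≤ (2 * R) ^ (l.length + 1) * (‖A - B‖ * ‖v‖) := by
      rw [norm_smul, Complex.norm_real, Real.norm_eq_abs]
      refine mul_le_mul (hπb.trans ?_) ((A - B).le_opNorm v) (norm_nonneg _) (by positivity)
      exact pow_le_pow_right₀ (by linarith) (Nat.le_succ _)
    refine (add_le_add e1 e2).trans (le_of_eq ?_)
    rw [List.length_cons]
    push_cast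
    ring

theorem pow_length_le_abs_list_prod {r : ℝ} (hr : 0 ≤ r) (μ : ℝ) (l : List ℝ)
    (h : ∀ c ∈ l, r ≤ |μ - c|) : r ^ l.length ≤ |(l.map fun c : ℝ => μ - c).prod| := by
  induction l with
  | nil => simp
  | cons c l ih =>
    simp only [List.map_cons, List.prod_cons, List.length_cons, pow_succ', abs_mul]
    have h1 := h c (by simp)
    have h2 := ih fun d hd => h d (by simp [hd])
    gcongr

/-- The eigenvalues of semisimple operators with the same number of eigenvalues depend
continuously on the operator. -/
theorem eventually_abs_eigenvalue_sub_lt {F : ℝ → E →L[ℂ] E} {M : ℕ} {ℓ : Fin M → ℝ → ℝ}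
    {Q : Fin M → ℝ → E →L[ℂ] E} {t₀ : ℝ} (hF : ContinuousAt F t₀)
    (hQ : ∀ᶠ t in 𝓝 t₀,
      IsRealSpectralDecomposition (F t) (fun i => ℓ i t) (fun i => Q i t))
    {r : ℝ} (hr : 0 < r) (k : Fin M) : ∀ᶠ t in 𝓝 t₀, ∃ i, |ℓ k t₀ - ℓ i t| < r := by
  have h0 := hQ.self_of_nhds
  obtain ⟨v, hv⟩ : ∃ v, Q k t₀ v ≠ 0 := by
    by_contra! hcon
    exact h0.ne_zero k (ContinuousLinearMap.ext hcon)
  set w := Q k t₀ v with hw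
  set R : ℝ := ‖F t₀‖ + 1 with hRdef
  have hR : 1 ≤ R := by simp [hRdef]
  have hbd : ∀ᶠ t in 𝓝 t₀, ‖F t‖ < R :=
    hF.norm.eventually (gt_mem_nhds (by simp [hRdef]))
  have hsmall : ∀ᶠ t in 𝓝 t₀, M * (2 * R) ^ M * ‖F t - F t₀‖ < r ^ M := by
    have : Tendsto (fun t => M * (2 * R) ^ M * ‖F t - F t₀‖) (𝓝 t₀) (𝓝 0) := by
      have := (((hF.tendsto.sub_const (F t₀)).norm).const_mul (M * (2 * R) ^ M))
      simpa using this
    exact this.eventually (gt_mem_nhds (by positivity))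
  filter_upwards [hQ, hbd, hsmall] with t ht hbt hst
  by_contra! hcon
  have hμ : |ℓ k t₀| ≤ R := (h0.abs_le_norm k).trans (by simp [hRdef])
  -- The product over the eigenvalues of `F t` is zero, so applied to the eigenvector `w` of `F t₀`
  -- it bounds `∏ |ℓₖ(t₀) - ℓᵢ(t)|` by a multiple of `‖F t - F t₀‖`. If every factor were at least
  -- `r`, this would contradict `hsmall`.
  have h1 := norm_list_prod_apply_sub_le (A := F t) (B := F t₀) (R := R) (μ := ℓ k t₀) hR hbt.le hμ
    (h0.apply_proj k v) (List.ofFn fun i => ℓ i t) (by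
      intro c hc
      obtain ⟨i, rfl⟩ := (List.mem_ofFn' _ _).1 hc
      exact (ht.abs_le_norm i).trans hbt.le)
  rw [ht.list_prod_eq_zero, zero_apply, zero_sub, norm_neg, norm_smul,
    Complex.norm_real, Real.norm_eq_abs, List.length_ofFn] at h1
  have h2 := pow_length_le_abs_list_prod hr.le (ℓ k t₀) (List.ofFn fun i => ℓ i t) (by
      intro c hc
      obtain ⟨i, rfl⟩ := (List.mem_ofFn' _ _).1 hc
      exact hcon i)
  rw [List.length_ofFn] at h2
  have h3 := le_of_mul_le_mul_right h1 (norm_pos_iff.2 hv)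
  linarith

theorem exists_gap_of_strictMono {M : ℕ} {a : Fin M → ℝ} (ha : StrictMono a) :
    ∃ γ > 0, ∀ i j, i < j → a i + γ ≤ a j := by
  have : ∀ q : Fin M × Fin M, ∃ γ > 0, q.1 < q.2 → a q.1 + γ ≤ a q.2 := by
    intro q
    by_cases hq : q.1 < q.2
    · exact ⟨a q.2 - a q.1, sub_pos.2 (ha hq), fun _ => by linarith⟩
    · exact ⟨1, one_pos, fun h => absurd h hq⟩
  choose γ hγ hγ' using this
  rcases isEmpty_or_nonempty (Fin M × Fin M) with hE | hE
  · exact ⟨1, one_pos, fun i j _ => (hE.false (i, j)).elim⟩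
  · obtain ⟨q₀, hq₀⟩ := Finite.exists_min γ
    exact ⟨γ q₀, hγ q₀, fun i j hij => by
      have := hγ' (i, j) hij
      have := hq₀ (i, j)
      simp only at *
      linarith⟩

/-- The spectral projections of a continuous family of semisimple operators with a constant number
of eigenvalues are locally bounded and vary at most as fast as the operators. -/
theorem exists_norm_proj_sub_le {F : ℝ → E →L[ℂ] E} {M : ℕ} {ℓ : Fin M → ℝ → ℝ}
    {Q : Fin M → ℝ → E →L[ℂ] E} {t₀ : ℝ} (hF : ContinuousAt F t₀)
    (hQ : ∀ᶠ t in 𝓝 t₀,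
      IsRealSpectralDecomposition (F t) (fun i => ℓ i t) (fun i => Q i t)) :
    ∃ U ∈ 𝓝 t₀, ∃ C : ℝ, 0 ≤ C ∧ ∀ t ∈ U, ∀ i, ‖Q i t‖ ≤ C ∧
      ∀ s ∈ U, ‖Q i t - Q i s‖ ≤ C * ‖F t - F s‖ := by
  have h0 := hQ.self_of_nhds
  obtain ⟨γ, hγ, hgap⟩ := exists_gap_of_strictMono h0.strictMono
  have hclose : ∀ᶠ t in 𝓝 t₀, ∀ k, |ℓ k t₀ - ℓ k t| ≤ γ / 4 := by
    have h1 : ∀ᶠ t in 𝓝 t₀, ∀ k, ∃ i, |ℓ k t₀ - ℓ i t| < γ / 4 :=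
      eventually_all.2 fun k => eventually_abs_eigenvalue_sub_lt hF hQ (by linarith) k
    filter_upwards [h1, hQ] with t ht hQt
    exact abs_sub_le_of_forall_exists hgap hQt.strictMono (by linarith)
      fun i => (ht i).imp fun _ h => h.le
  have hne : ∀ i k, i ≠ k → γ ≤ |ℓ i t₀ - ℓ k t₀| := by
    intro i k hik
    rcases lt_or_gt_of_ne hik with h | h
    · have := hgap _ _ h
      rw [abs_sub_comm]
      exact le_trans (by linarith) (le_abs_self _)
    · have := hgap _ _ h
      exact le_trans (by linarith) (le_abs_self _)
  set C₀ : ℝ := ∑ i, ‖Q i t₀‖ with hC₀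
  have hC₀i : ∀ i, ‖Q i t₀‖ ≤ C₀ := fun i =>
    Finset.single_le_sum (f := fun i => ‖Q i t₀‖) (fun _ _ => norm_nonneg _) (Finset.mem_univ i)
  have hC₀0 : 0 ≤ C₀ := Finset.sum_nonneg fun _ _ => norm_nonneg _
  have hsmall : ∀ᶠ t in 𝓝 t₀, 2 * M * (C₀ * ‖F t - F t₀‖ / (γ / 2)) < 1 / 2 := by
    have : Tendsto (fun t => 2 * M * (C₀ * ‖F t - F t₀‖ / (γ / 2))) (𝓝 t₀) (𝓝 0) := by
      have := ((((hF.tendsto.sub_const (F t₀)).norm).const_mul C₀).div_const (γ / 2)).const_mul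
        (2 * (M : ℝ))
      simpa using this
    exact this.eventually (gt_mem_nhds (by norm_num))
  have hgood := hclose.and (hsmall.and hQ)
  have hbd : ∀ t, ((∀ k, |ℓ k t₀ - ℓ k t| ≤ γ / 4) ∧
      2 * M * (C₀ * ‖F t - F t₀‖ / (γ / 2)) < 1 / 2 ∧
      IsRealSpectralDecomposition (F t) (fun i => ℓ i t) (fun i => Q i t)) →
      ∀ i, ‖Q i t‖ ≤ 2 * C₀ := by
    rintro t ⟨hc, hs, hd⟩ i
    have hiM : Nonempty (Fin M) := ⟨i⟩
    -- No bound on the projections at time `t` is known yet. For the largest one the perturbation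
    -- estimate has the same norm on both sides, and `hsmall` makes its coefficient at most `1 / 2`,
    -- so it can be absorbed.
    obtain ⟨m, hm⟩ := Finite.exists_max fun i => ‖Q i t‖
    have hik : ∀ i k, i ≠ k → γ / 2 ≤ |ℓ i t - ℓ k t₀| := by
      intro i k hik
      have h1 := hne i k hik
      have h2 := hc i
      have h3 := abs_sub_le (ℓ i t₀) (ℓ i t) (ℓ k t₀)
      linarith
    have h1 := hd.norm_proj_sub_proj_le h0 (by linarith : 0 < γ / 2) hik hm hC₀i m
    have h2 : 2 * M * (‖Q m t‖ * C₀ * ‖F t - F t₀‖ / (γ / 2)) =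
        ‖Q m t‖ * (2 * M * (C₀ * ‖F t - F t₀‖ / (γ / 2))) := by ring
    have h3 : ‖Q m t‖ * (2 * M * (C₀ * ‖F t - F t₀‖ / (γ / 2))) ≤ ‖Q m t‖ * (1 / 2) := by
      gcongr
    have h4 : ‖Q m t‖ ≤ ‖Q m t - Q m t₀‖ + ‖Q m t₀‖ := by
      simpa using norm_add_le (Q m t - Q m t₀) (Q m t₀)
    have h5 := hC₀i m
    have h6 : ‖Q i t‖ ≤ ‖Q m t‖ := hm i
    linarith
  refine ⟨_, hgood, max (2 * C₀) (2 * M * (2 * C₀ * (2 * C₀) / (γ / 2))),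
    le_max_of_le_left (by linarith), fun t ht i => ⟨(hbd t ht i).trans (le_max_left _ _), ?_⟩⟩
  intro s hs
  have hik : ∀ i k, i ≠ k → γ / 2 ≤ |ℓ i t - ℓ k s| := by
    intro i k hik
    have h1 := hne i k hik
    have h2 := ht.1 i
    have h2' := hs.1 k
    have h3 := abs_sub_le (ℓ i t₀) (ℓ i t) (ℓ k t₀)
    have h4 := abs_sub_le (ℓ i t) (ℓ k s) (ℓ k t₀)
    rw [abs_sub_comm (ℓ k s)] at h4
    linarith
  have h1 := ht.2.2.norm_proj_sub_proj_le hs.2.2 (by linarith : 0 < γ / 2) hik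
    (hbd t ht) (hbd s hs) i
  refine h1.trans (le_trans (le_of_eq ?_)
    (mul_le_mul_of_nonneg_right (le_max_right _ _) (norm_nonneg _)))
  ring

/-- A-priori estimate for `Y' = i ∑ mᵢ(t) Qᵢ(t) Y + n` with real `mᵢ` and Lipschitz projections. -/
theorem sum_norm_proj_le_of_hasDerivAt {M : ℕ} {Q : Fin M → ℝ → E →L[ℂ] E} {m : Fin M → ℝ → ℝ}
    {τ C L B₀ B₁ : ℝ} {Y n : ℝ → E} {A : ℝ → E →L[ℂ] E} {ℓ : Fin M → ℝ → ℝ}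
    (hL : 0 ≤ L)
    (hQ : ∀ t ∈ Set.Icc 0 τ,
      IsRealSpectralDecomposition (A t) (fun i => ℓ i t) (fun i => Q i t))
    (hQC : ∀ t ∈ Set.Icc 0 τ, ∀ i, ‖Q i t‖ ≤ C)
    (hQL : ∀ t ∈ Set.Icc 0 τ, ∀ s ∈ Set.Icc 0 τ, ∀ i, ‖Q i t - Q i s‖ ≤ L * |t - s|)
    (hY : ∀ t ∈ Set.Icc 0 τ,
      HasDerivAt Y (∑ i, (Complex.I * (m i t : ℂ)) • Q i t (Y t) + n t) t)
    (hinit : ∑ i, ‖Q i 0 (Y 0)‖ ≤ B₀)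
    (hbound : ∀ t ∈ Set.Ico 0 τ, ∑ i, ‖Q i t (Y t)‖ = B₀ + B₁ * t →
      M * L * (B₀ + B₁ * t) + M * C * ‖n t‖ < B₁) :
    ∀ t ∈ Set.Icc 0 τ, ∑ i, ‖Q i t (Y t)‖ ≤ B₀ + B₁ * t := by
  set f : ℝ → ℝ := fun t => ∑ i, ‖Q i t (Y t)‖ with hf
  have hQcont : ∀ i, ContinuousOn (Q i) (Set.Icc 0 τ) := by
    intro i
    have : LipschitzOnWith L.toNNReal (Q i) (Set.Icc 0 τ) := by
      refine LipschitzOnWith.of_dist_le_mul fun t ht s hs => ?_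
      rw [dist_eq_norm, Real.dist_eq, Real.coe_toNNReal _ hL]
      exact hQL t ht s hs i
    exact this.continuousOn
  have hYcont : ContinuousOn Y (Set.Icc 0 τ) :=
    fun t ht => (hY t ht).continuousAt.continuousWithinAt
  have hfcont : ContinuousOn f (Set.Icc 0 τ) :=
    continuousOn_finsetSum _ fun i _ => ((hQcont i).clm_apply hYcont).norm
  -- Norms need not be differentiable and the projections are only Lipschitz, hence a comparison by
  -- right slopes. It tests the strict inequality only at times when the barrier is touched; this is
  -- what later permits a bootstrap inside `hbound`.
  have main := image_le_of_liminf_slope_right_lt_deriv_boundary'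
    (f' := fun t => M * L * ‖Y t‖ + M * C * ‖n t‖) hfcont ?_
    (B := fun t => B₀ + B₁ * t) (B' := fun _ => B₁) ?_ ?_ ?_ ?_
  · exact main
  · intro x hx r hr
    have hx' : x ∈ Set.Icc 0 τ := Set.Ico_subset_Icc_self hx
    -- the rotated components have derivative `Q i x (n x)` at `x`
    set P : Fin M → ℝ → E := fun i z =>
      Complex.exp (-(Complex.I * (m i x : ℂ)) * ((z - x : ℝ) : ℂ)) • Q i x (Y z) with hP
    have hPnorm : ∀ i z, ‖P i z‖ = ‖Q i x (Y z)‖ := by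
      intro i z
      have : -(Complex.I * (m i x : ℂ)) * ((z - x : ℝ) : ℂ) =
          ((-(m i x * (z - x)) : ℝ) : ℂ) * Complex.I := by push_cast; ring
      rw [hP]
      simp only
      rw [norm_smul, this, Complex.norm_exp_ofReal_mul_I, one_mul]
    have hPder : ∀ i, HasDerivAt (P i) (Q i x (n x)) x := by
      intro i
      have h1 : HasDerivAt (fun z : ℝ => -(Complex.I * (m i x : ℂ)) * ((z - x : ℝ) : ℂ))
          (-(Complex.I * (m i x : ℂ)) * 1) x := by
        refine HasDerivAt.const_mul _ ?_
        exact ((hasDerivAt_id x).sub_const x).ofReal_comp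
      have h2 := h1.cexp
      have h3 : HasDerivAt (fun z => Q i x (Y z)) _ x :=
        ((Q i x).restrictScalars ℝ).hasFDerivAt.comp_hasDerivAt x (hY x hx')
      have h4 := h2.smul h3
      convert! h4 using 1
      have h5 : Q i x (∑ j, (Complex.I * (m j x : ℂ)) • Q j x (Y x)) =
          (Complex.I * (m i x : ℂ)) • Q i x (Y x) := by
        rw [map_sum]
        simp [(hQ x hx').apply_apply]
      simp only [ContinuousLinearMap.coe_restrictScalars', map_add, h5]
      simp
    have hslope : Tendsto (fun z => ∑ i, ‖slope (P i) x z‖ + M * L * ‖Y z‖) (𝓝[>] x)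
        (𝓝 (∑ i, ‖Q i x (n x)‖ + M * L * ‖Y x‖)) := by
      refine Tendsto.add (tendsto_finsetSum _ fun i _ => ?_) ?_
      · exact ((hasDerivAt_iff_tendsto_slope.1 (hPder i)).mono_left
          (nhdsWithin_mono _ fun z hz => ne_of_gt hz)).norm
      · exact ((hY x hx').continuousAt.tendsto.mono_left nhdsWithin_le_nhds).norm.const_mul _
    have hlt : ∑ i, ‖Q i x (n x)‖ + M * L * ‖Y x‖ < r := by
      refine lt_of_le_of_lt ?_ hr
      have : ∑ i, ‖Q i x (n x)‖ ≤ ∑ _i : Fin M, C * ‖n x‖ :=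
        Finset.sum_le_sum fun i _ => (Q i x).le_of_opNorm_le (hQC x hx' i) _
      simp at this
      linarith
    have hev := hslope.eventually (gt_mem_nhds hlt)
    have hmem : ∀ᶠ z in 𝓝[>] x, z ∈ Set.Ioc x τ := Ioc_mem_nhdsGT hx.2
    refine (Eventually.frequently ?_)
    filter_upwards [hev, hmem] with z hz hzm
    refine lt_of_le_of_lt ?_ hz
    have hzx : 0 < z - x := sub_pos.2 hzm.1
    have hz' : z ∈ Set.Icc 0 τ := ⟨hx.1.trans hzm.1.le, hzm.2⟩
    rw [slope_def_field, div_le_iff₀ hzx, hf]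
    simp only
    rw [← Finset.sum_sub_distrib]
    -- The increment splits into the motion of the projection, paid for by `L`, and the motion of
    -- `Y` seen through the frozen projection, where the rotation hides the large frequency `m i x`.
    have hterm : ∀ i ∈ Finset.univ, ‖Q i z (Y z)‖ - ‖Q i x (Y x)‖ ≤
        ‖slope (P i) x z‖ * (z - x) + L * (z - x) * ‖Y z‖ := by
      intro i _
      have h1 : ‖Q i z (Y z)‖ ≤ ‖Q i x (Y z)‖ + ‖(Q i z - Q i x) (Y z)‖ := by
        refine le_trans (le_of_eq ?_) (norm_add_le _ _)
        simp
      have h2 : ‖(Q i z - Q i x) (Y z)‖ ≤ L * (z - x) * ‖Y z‖ := by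
        refine ContinuousLinearMap.le_of_opNorm_le _ ?_ _
        have := hQL z hz' x hx' i
        rwa [abs_of_pos hzx] at this
      have h3 : ‖Q i x (Y z)‖ - ‖Q i x (Y x)‖ ≤ ‖slope (P i) x z‖ * (z - x) := by
        rw [← hPnorm, ← hPnorm, slope_def_module]
        generalize P i z = a
        generalize P i x = b
        rw [norm_smul, Real.norm_eq_abs, abs_inv, abs_of_pos hzx]
        have := norm_sub_norm_le a b
        field_simp
        exact this
      linarith
    refine (Finset.sum_le_sum hterm).trans (le_of_eq ?_)
    rw [Finset.sum_add_distrib, ← Finset.sum_mul]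
    simp
    ring
  · simpa using hinit
  · fun_prop
  · intro x _
    have h1 : HasDerivAt (fun t => B₀ + B₁ * t) (B₁ * 1) x :=
      ((hasDerivAt_id x).const_mul B₁).const_add B₀
    rw [mul_one] at h1
    exact h1.hasDerivWithinAt
  · intro x hx hfx
    have h1 := hbound x hx hfx
    have h2 : ‖Y x‖ ≤ B₀ + B₁ * x := by
      rw [← hfx]
      exact (hQ x (Set.Ico_subset_Icc_self hx)).norm_le_sum _
    have h3 : M * L * ‖Y x‖ ≤ M * L * (B₀ + B₁ * x) := by gcongr
    linarith

end Semisimple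

end

section

/-! ### Self-adjoint operators with a spectral gap -/

section SelfAdjoint

variable {𝓗 : Type*} [NormedAddCommGroup 𝓗] [InnerProductSpace ℂ 𝓗]

/-- The function `x / max (x², g²)` is continuous, vanishes at `0`, is bounded by `1 / g` and equals
`1 / x` beyond the gap. The continuous functional calculus turns it into a reduced inverse. -/
theorem div_max_sq_of_le {g x : ℝ} (hg : 0 < g) (hx : g ≤ |x|) :
    x / max (x ^ 2) (g ^ 2) = x⁻¹ := by
  have h1 : g ^ 2 ≤ x ^ 2 := by
    rw [← sq_abs x]
    gcongr
  rw [max_eq_left h1]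
  have : x ≠ 0 := by
    rintro rfl
    simp at hx
    linarith
  field_simp

theorem abs_div_max_sq_le {g : ℝ} (hg : 0 < g) (x : ℝ) :
    |x / max (x ^ 2) (g ^ 2)| ≤ 1 / g := by
  have hpos : 0 < max (x ^ 2) (g ^ 2) := lt_max_of_lt_right (by positivity)
  rw [abs_div, abs_of_pos hpos, div_le_div_iff₀ hpos hg, one_mul]
  rcases le_total g |x| with h | h
  · refine le_max_of_le_left ?_
    rw [← sq_abs x]
    nlinarith
  · refine le_max_of_le_right ?_
    nlinarith

theorem continuous_div_max_sq {g : ℝ} (hg : 0 < g) :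
    Continuous fun x : ℝ => x / max (x ^ 2) (g ^ 2) := by
  refine Continuous.div (by fun_prop) (by fun_prop) fun x => ?_
  exact (lt_max_of_lt_right (by positivity)).ne'

theorem mem_spectrum_real_sub_iff {A : 𝓗 →L[ℂ] 𝓗} {μ x : ℝ} :
    x ∈ spectrum ℝ (A - (μ : ℂ) • (1 : 𝓗 →L[ℂ] 𝓗)) ↔ ((x + μ : ℝ) : ℂ) ∈ spectrum ℂ A := by
  rw [spectrum.mem_iff, spectrum.mem_iff]
  have : algebraMap ℝ (𝓗 →L[ℂ] 𝓗) x - (A - (μ : ℂ) • (1 : 𝓗 →L[ℂ] 𝓗)) =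
      algebraMap ℂ (𝓗 →L[ℂ] 𝓗) ((x + μ : ℝ) : ℂ) - A := by
    ext v
    simp [Algebra.algebraMap_eq_smul_one, add_smul]
    abel
  rw [this]

/-- The rank one projection `|ψ⟩⟨ψ|`. -/
def ketBra (ψ : 𝓗) : 𝓗 →L[ℂ] 𝓗 := (innerSL ℂ ψ).smulRight ψ

theorem ketBra_apply (ψ v : 𝓗) : ketBra ψ v = (inner ℂ ψ v : ℂ) • ψ := rfl

theorem norm_ketBra_le (ψ : 𝓗) (hψ : ‖ψ‖ = 1) : ‖ketBra ψ‖ ≤ 1 := by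
  simp [ketBra, hψ]

theorem eq_zero_or_le_abs_of_mem_spectrum {A : 𝓗 →L[ℂ] 𝓗} {N : ℕ} {α : Fin N → ℝ} {g : ℝ}
    (hα : spectrum ℂ A = Set.range fun j => (α j : ℂ))
    (hgα : ∀ i j, i < j → α i + g ≤ α j) (i : Fin N) :
    ∀ x ∈ spectrum ℝ (A - (α i : ℂ) • (1 : 𝓗 →L[ℂ] 𝓗)), x = 0 ∨ g ≤ |x| := by
  intro x hx
  rw [mem_spectrum_real_sub_iff, hα] at hx
  obtain ⟨k, hk⟩ := hx
  have hk' : α k = x + α i := Complex.ofReal_injective hk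
  rcases lt_trichotomy k i with h | h | h
  · right
    have := hgα _ _ h
    refine le_trans ?_ (neg_le_abs x)
    linarith
  · left
    rw [h] at hk'
    linarith
  · right
    have := hgα _ _ h
    refine le_trans ?_ (le_abs_self x)
    linarith

variable [CompleteSpace 𝓗]

/-- A reduced inverse of a self-adjoint operator whose nonzero spectrum is at distance at least
`g` from `0`. -/
theorem exists_reduced_inverse {K : 𝓗 →L[ℂ] 𝓗} (hK : IsSelfAdjoint K) {g : ℝ} (hg : 0 < g)
    (hs : ∀ x ∈ spectrum ℝ K, x = 0 ∨ g ≤ |x|) :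
    ∃ R : 𝓗 →L[ℂ] 𝓗, K * R * K = K ∧ K * R = R * K ∧ ‖R‖ ≤ 1 / g := by
  set f : ℝ → ℝ := fun x => x / max (x ^ 2) (g ^ 2) with hf
  have hfc : Continuous f := continuous_div_max_sq hg
  refine ⟨cfc f K, ?_, ?_, ?_⟩
  · nth_rewrite 1 [← cfc_id' ℝ K]
    rw [← cfc_mul (fun x : ℝ => x) f K (by fun_prop) hfc.continuousOn]
    nth_rewrite 2 [← cfc_id' ℝ K]
    rw [← cfc_mul _ _ K (by fun_prop) (by fun_prop)]
    conv_rhs => rw [← cfc_id' ℝ K]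
    refine cfc_congr fun x hx => ?_
    rcases hs x hx with h | h
    · simp [h]
    · have : f x = x⁻¹ := div_max_sq_of_le hg h
      simp only [this]
      have hx0 : x ≠ 0 := by
        rintro rfl
        simp at h
        linarith
      field_simp
  · have := (cfc_commute_cfc (fun x : ℝ => x) f K).eq
    rwa [cfc_id' ℝ K] at this
  · exact norm_cfc_le (by positivity) fun x _ => abs_div_max_sq_le hg x

/-- A self-adjoint operator whose spectrum is at distance at least `g` from `0` has an inverse of
norm at most `1 / g`. -/
theorem exists_inverse_norm_le {K : 𝓗 →L[ℂ] 𝓗} (hK : IsSelfAdjoint K) {g : ℝ} (hg : 0 < g)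
    (hs : ∀ x ∈ spectrum ℝ K, g ≤ |x|) :
    ∃ R : 𝓗 →L[ℂ] 𝓗, K * R = 1 ∧ R * K = 1 ∧ ‖R‖ ≤ 1 / g := by
  obtain ⟨R, h1, h2, h3⟩ := exists_reduced_inverse hK hg fun x hx => Or.inr (hs x hx)
  have hu : IsUnit K := by
    have : (0 : ℝ) ∉ spectrum ℝ K := fun h => by
      have := hs 0 h
      simp at this
      linarith
    rwa [spectrum.zero_notMem_iff] at this
  have h4 : K * R = 1 := hu.mul_right_cancel (by rw [h1, one_mul])
  exact ⟨R, h4, h2 ▸ h4, h3⟩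

theorem isUnit_add_of_norm_mul_lt {R : Type*} [NormedRing R] [CompleteSpace R] {a b x : R}
    (h1 : a * b = 1) (h2 : b * a = 1) (h : ‖b‖ * ‖x‖ < 1) : IsUnit (a + x) := by
  have hu : IsUnit a := ⟨⟨a, b, h1, h2⟩, rfl⟩
  have h3 : a + x = a * (1 - -(b * x)) := by
    rw [sub_neg_eq_add, mul_add, mul_one, ← mul_assoc, h1, one_mul]
  rw [h3]
  refine hu.mul (isUnit_one_sub_of_norm_lt_one ?_)
  rw [norm_neg]
  exact (norm_mul_le _ _).trans_lt h

theorem isSelfAdjoint_sub_real_smul {A : 𝓗 →L[ℂ] 𝓗} (hA : IsSelfAdjoint A) (μ : ℝ) :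
    IsSelfAdjoint (A - (μ : ℂ) • (1 : 𝓗 →L[ℂ] 𝓗)) := by
  refine hA.sub ?_
  refine IsSelfAdjoint.smul ?_ (IsSelfAdjoint.one _)
  exact Complex.conj_ofReal μ

/-- Every point of the spectrum of `A` is within `‖A - B‖` of the spectrum of `B`. -/
theorem exists_abs_sub_le_norm_sub {A B : 𝓗 →L[ℂ] 𝓗} (hB : IsSelfAdjoint B)
    {N : ℕ} {β : Fin N → ℝ} (hβ : spectrum ℂ B = Set.range fun j => (β j : ℂ)) {μ : ℝ}
    (hμ : (μ : ℂ) ∈ spectrum ℂ A) : ∃ k, |μ - β k| ≤ ‖A - B‖ := by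
  by_contra! hcon
  -- Finitely many strict inequalities leave a common distance `d`, so the Neumann series around `B
  -- - μ` converges.
  obtain ⟨d, hd, hdk⟩ : ∃ d, ‖A - B‖ < d ∧ ∀ k, d ≤ |μ - β k| := by
    rcases isEmpty_or_nonempty (Fin N) with hE | hE
    · exact ⟨‖A - B‖ + 1, by linarith, fun k => (hE.false k).elim⟩
    · obtain ⟨k₀, hk₀⟩ := Finite.exists_min fun k => |μ - β k|
      exact ⟨_, hcon k₀, hk₀⟩
  have hd0 : 0 < d := (norm_nonneg _).trans_lt hd
  obtain ⟨R, h1, h2, h3⟩ := exists_inverse_norm_le (isSelfAdjoint_sub_real_smul hB μ) hd0 (by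
    intro x hx
    rw [mem_spectrum_real_sub_iff, hβ] at hx
    obtain ⟨k, hk⟩ := hx
    have hk' : β k = x + μ := Complex.ofReal_injective hk
    have := hdk k
    rw [hk', abs_sub_comm] at this
    simpa using this)
  have hu := isUnit_add_of_norm_mul_lt (x := A - B) h1 h2 (by
    calc ‖R‖ * ‖A - B‖ ≤ 1 / d * ‖A - B‖ := by gcongr
      _ < 1 / d * d := by gcongr
      _ = 1 := by field_simp)
  rw [spectrum.mem_iff] at hμ
  apply hμ
  rw [← IsUnit.neg_iff]
  convert! hu using 1
  rw [Algebra.algebraMap_eq_smul_one]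
  abel

/-- The perturbation moves eigenvalues by less than half a gap, so nearest neighbours carry the same
label. -/
theorem abs_eigenvalue_sub_le {A B : 𝓗 →L[ℂ] 𝓗} (hB : IsSelfAdjoint B)
    {N : ℕ} {α β : Fin N → ℝ} {g : ℝ} (hg : 0 < g)
    (hα : spectrum ℂ A = Set.range fun j => (α j : ℂ))
    (hβ : spectrum ℂ B = Set.range fun j => (β j : ℂ)) (hgα : ∀ i j, i < j → α i + g ≤ α j)
    (hgβ : ∀ i j, i < j → β i + g ≤ β j) (h : 2 * ‖A - B‖ < g) (i : Fin N) :
    |α i - β i| ≤ ‖A - B‖ := by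
  refine abs_sub_le_of_forall_exists hgα ?_ h (fun i => ?_) i
  · intro i j hij
    have := hgβ i j hij
    linarith
  · exact exists_abs_sub_le_norm_sub hB hβ (hα ▸ ⟨i, rfl⟩)

/-- Temple-type estimate for the distance of an eigenvalue to a mean value. -/
theorem abs_eigenvalue_sub_mean_le {A : 𝓗 →L[ℂ] 𝓗} (hA : IsSelfAdjoint A) {N : ℕ}
    {α : Fin N → ℝ} {g : ℝ} (hg : 0 < g) (hα : spectrum ℂ A = Set.range fun j => (α j : ℂ))
    (hgα : ∀ i j, i < j → α i + g ≤ α j) (i : Fin N) {ψ : 𝓗} (hψ : ‖ψ‖ = 1) :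
    |α i - (inner ℂ ψ (A ψ) : ℂ).re| ≤ 1 / g * ‖A ψ - (α i : ℂ) • ψ‖ ^ 2 := by
  set K := A - (α i : ℂ) • (1 : 𝓗 →L[ℂ] 𝓗) with hK
  have hKs : IsSelfAdjoint K := isSelfAdjoint_sub_real_smul hA _
  obtain ⟨R, h1, -, h3⟩ := exists_reduced_inverse hKs hg
    (eq_zero_or_le_abs_of_mem_spectrum hα hgα i)
  have hKψ : K ψ = A ψ - (α i : ℂ) • ψ := by simp [hK]
  -- Inserting `K = K R K` and moving one `K` to the left makes the mean value quadratic in the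
  -- residual `K ψ`.
  have hin : (inner ℂ ψ (K ψ) : ℂ) = inner ℂ (K ψ) (R (K ψ)) := by
    have hsym := (ContinuousLinearMap.isSelfAdjoint_iff_isSymmetric.1 hKs) ψ (R (K ψ))
    have h4 : K (R (K ψ)) = K ψ := congrArg (fun B : 𝓗 →L[ℂ] 𝓗 => B ψ) h1
    simp only [ContinuousLinearMap.coe_coe] at hsym
    rw [hsym, h4]
  have hval : (inner ℂ ψ (A ψ) : ℂ).re - α i = (inner ℂ ψ (K ψ) : ℂ).re := by
    rw [hKψ, inner_sub_right, inner_smul_right, inner_self_eq_norm_sq_to_K, hψ]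
    simp
  rw [abs_sub_comm, hval, hin, ← hKψ]
  refine (Complex.abs_re_le_norm _).trans ((norm_inner_le_norm _ _).trans ?_)
  have := R.le_of_opNorm_le h3 (K ψ)
  calc ‖K ψ‖ * ‖R (K ψ)‖ ≤ ‖K ψ‖ * (1 / g * ‖K ψ‖) := by gcongr
    _ = _ := by ring

/-- If `0` is a simple isolated eigenvalue of the self-adjoint operator `K`, with unit eigenvector
`ψ`, then `K + g |ψ⟩⟨ψ|` is invertible, with a bound on the inverse depending on the gap only. -/
theorem exists_inverse_add_ketBra {K : 𝓗 →L[ℂ] 𝓗} (hK : IsSelfAdjoint K) {g : ℝ} (hg : 0 < g)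
    (hs : ∀ x ∈ spectrum ℝ K, x = 0 ∨ g ≤ |x|) {ψ : 𝓗} (hψ : ‖ψ‖ = 1) (hKψ : K ψ = 0)
    (hker : ∀ v, K v = 0 → ∃ c : ℂ, v = c • ψ) :
    ∃ B : 𝓗 →L[ℂ] 𝓗, (K + (g : ℂ) • ketBra ψ) * B = 1 ∧ B * (K + (g : ℂ) • ketBra ψ) = 1 ∧
      ‖B‖ ≤ 3 / g := by
  obtain ⟨R, h1, h2, h3⟩ := exists_reduced_inverse hK hg hs
  set P := ketBra ψ with hP
  have hψψ : (inner ℂ ψ ψ : ℂ) = 1 := by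
    rw [inner_self_eq_norm_sq_to_K, hψ]
    simp
  have hPK : P * K = 0 := by
    ext v
    have hsym := (ContinuousLinearMap.isSelfAdjoint_iff_isSymmetric.1 hK) ψ v
    simp only [ContinuousLinearMap.coe_coe] at hsym
    rw [mul_apply_eq_comp, hP, ketBra_apply, ← hsym, hKψ]
    simp
  have hKP : K * P = 0 := by
    ext v
    rw [mul_apply_eq_comp, hP, ketBra_apply, map_smul, hKψ]
    simp
  have hPP : P * P = P := by
    ext v
    rw [mul_apply_eq_comp, hP, ketBra_apply, ketBra_apply, inner_smul_right, hψψ, mul_one]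
  -- The vector `v - R K v` lies in the kernel, hence is a multiple of `ψ`; the multiple is read off
  -- with `P`, which kills `R K v` because `P R K = P K R = 0`.
  have hRK : R * K = 1 - P := by
    ext v
    obtain ⟨c, hc⟩ := hker (v - R (K v)) (by
      have h4 : K (R (K v)) = K v := congrArg (fun B : 𝓗 →L[ℂ] 𝓗 => B v) h1
      rw [map_sub, h4, sub_self])
    have h5 : P (R (K v)) = 0 := by
      have : P * (R * K) = 0 := by rw [← h2, ← mul_assoc, hPK, zero_mul]
      exact congrArg (fun B : 𝓗 →L[ℂ] 𝓗 => B v) this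
    have h6 : P v = c • ψ := by
      have := congrArg P hc
      rw [map_sub, h5, sub_zero, map_smul] at this
      rw [this, hP, ketBra_apply, hψψ, one_smul]
    rw [mul_apply_eq_comp, sub_apply, one_apply_eq_self, h6, ← hc]
    abel
  have hP1 : ‖P‖ ≤ 1 := norm_ketBra_le ψ hψ
  have hgc : (g : ℂ) ≠ 0 := by exact_mod_cast hg.ne'
  -- Block inverse with respect to `1 - P` and `P`; the norm bound is `2 / g + 1 / g`.
  refine ⟨R * (1 - P) + (g : ℂ)⁻¹ • P, ?_, ?_, ?_⟩
  · have e1 : K * (R * (1 - P)) = 1 - P := by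
      rw [← mul_assoc, h2, hRK, mul_sub, mul_one, sub_mul, one_mul, hPP, sub_self, sub_zero]
    have e2 : P * (R * (1 - P)) = 0 := by
      rw [← hRK, ← h2, h2, ← mul_assoc, ← mul_assoc]
      rw [mul_assoc P R R, mul_assoc P (R * R) K, mul_assoc R R K, ← h2, ← mul_assoc R, ← h2,
        mul_assoc K, ← mul_assoc P, hPK, zero_mul]
    rw [add_mul, mul_add, mul_add, e1, mul_smul_comm, hKP, smul_mul_assoc, e2, smul_mul_smul_comm,
      hPP, mul_inv_cancel₀ hgc]
    simp
  · have e1 : R * (1 - P) * K = 1 - P := by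
      rw [mul_assoc, sub_mul, hPK, one_mul, sub_zero, hRK]
    have e2 : R * (1 - P) * P = 0 := by
      rw [mul_assoc, sub_mul, hPP, one_mul, sub_self, mul_zero]
    rw [add_mul, mul_add, mul_add, e1, mul_smul_comm, e2, smul_mul_assoc, hPK, smul_mul_smul_comm,
      hPP, inv_mul_cancel₀ hgc]
    simp
  · have e1 : ‖(1 : 𝓗 →L[ℂ] 𝓗) - P‖ ≤ 2 := by
      have h1 : ‖(1 : 𝓗 →L[ℂ] 𝓗)‖ ≤ 1 := ContinuousLinearMap.norm_id_le
      refine (norm_sub_le _ _).trans ?_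
      linarith
    have e2 : ‖R * (1 - P)‖ ≤ 1 / g * 2 := (norm_mul_le _ _).trans (by gcongr)
    have e3 : ‖(g : ℂ)⁻¹ • P‖ ≤ 1 / g := by
      rw [norm_smul, norm_inv, Complex.norm_real, Real.norm_eq_abs, abs_of_pos hg, one_div]
      exact mul_le_of_le_one_right (by positivity) hP1
    refine (norm_add_le _ _).trans ((add_le_add e2 e3).trans (le_of_eq ?_))
    ring

end SelfAdjoint

end

section

variable {𝓗 : Type u} [NormedAddCommGroup 𝓗] [InnerProductSpace ℂ 𝓗]
variable {ι : Type w} {p : ℕ}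

/-! ### The complex conjugation -/

section Conjugation

variable (b : HilbertBasis ι ℂ 𝓗)

theorem conjugation_apply (v : 𝓗) :
    conjugation b v = b.repr.symm (star (b.repr v)) := rfl

theorem conjugation_conjugation (v : 𝓗) : conjugation b (conjugation b v) = v := by
  simp [conjugation_apply]

theorem norm_conjugation (v : 𝓗) : ‖conjugation b v‖ = ‖v‖ := by
  simp [conjugation_apply]

theorem inner_basis_conjugation (i : ι) (v : 𝓗) :
    (inner ℂ (b i) (conjugation b v) : ℂ) = starRingEnd ℂ (inner ℂ (b i) v) := by
  rw [← b.repr_apply_apply, ← b.repr_apply_apply, conjugation_apply]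
  simp

/-- Both sides have the same Parseval expansion, term by term. -/
theorem inner_conjugation_conjugation (v w : 𝓗) :
    (inner ℂ (conjugation b v) (conjugation b w) : ℂ) = inner ℂ w v := by
  have h1 := b.hasSum_inner_mul_inner (conjugation b v) (conjugation b w)
  have h2 := b.hasSum_inner_mul_inner w v
  refine h1.unique ?_
  convert! h2 using 1
  ext i
  rw [inner_basis_conjugation, ← inner_conj_symm, inner_basis_conjugation, Complex.conj_conj,
    inner_conj_symm, mul_comm]

theorem inner_conjugation_comm (v w : 𝓗) :
    (inner ℂ v (conjugation b w) : ℂ) = inner ℂ w (conjugation b v) := by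
  have := inner_conjugation_conjugation b (conjugation b v) w
  rwa [conjugation_conjugation] at this

theorem conjugation_real_smul (r : ℝ) (v : 𝓗) :
    conjugation b ((r : ℂ) • v) = (r : ℂ) • conjugation b v := by
  rw [map_smulₛₗ]
  simp

/-- The complex conjugation as a real linear map. -/
def conjReal : 𝓗 →L[ℝ] 𝓗 :=
  LinearMap.mkContinuous
    { toFun := conjugation b
      map_add' := map_add _
      map_smul' := fun r v => by
        have := conjugation_real_smul b r v
        simpa using this } 1 fun v => by
    simp [norm_conjugation]

theorem conjReal_apply (v : 𝓗) : conjReal b v = conjugation b v := rfl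

theorem conjOp_apply (A : 𝓗 →L[ℂ] 𝓗) (v : 𝓗) :
    conjOp b A v = conjugation b (A (conjugation b v)) := rfl

theorem norm_conjOp_sub_le (A B : 𝓗 →L[ℂ] 𝓗) : ‖conjOp b A - conjOp b B‖ ≤ ‖A - B‖ := by
  refine ContinuousLinearMap.opNorm_le_bound _ (norm_nonneg _) fun v => ?_
  rw [sub_apply, conjOp_apply, conjOp_apply, ← map_sub, norm_conjugation, ← sub_apply]
  have := (A - B).le_opNorm (conjugation b v)
  rwa [norm_conjugation] at this

theorem norm_blockF₀_sub_le (A B : 𝓗 →L[ℂ] 𝓗) : ‖blockF₀ b A - blockF₀ b B‖ ≤ ‖A - B‖ := by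
  refine ContinuousLinearMap.opNorm_le_bound _ (norm_nonneg _) fun v => ?_
  have h : (blockF₀ b A - blockF₀ b B) v =
      ((A - B) v.1, -((conjOp b A - conjOp b B) v.2)) := by
    ext
    · simp [blockF₀]
    · simp [blockF₀]
      abel
  rw [h, Prod.norm_mk, norm_neg]
  refine max_le ?_ ?_
  · exact (A - B).le_opNorm_of_le (norm_fst_le v)
  · refine ((conjOp b A - conjOp b B).le_opNorm_of_le (norm_snd_le v)).trans ?_
    gcongr
    exact norm_conjOp_sub_le b A B

end Conjugation

/-! ### Occupations and their derivatives -/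

section Occupations

variable (b : HilbertBasis ι ℂ 𝓗) (idx : Fin p ↪ ι)

/-- Half of the differential of `v ↦ |vⱼ|²` at `ψ`, that is `conj ψⱼ vⱼ`. -/
def bra (ψ : 𝓗) (j : Fin p) : 𝓗 →L[ℂ] ℂ :=
  (starRingEnd ℂ (inner ℂ (b (idx j)) ψ)) • innerSL ℂ (b (idx j))

theorem bra_apply (ψ v : 𝓗) (j : Fin p) :
    bra b idx ψ j v = starRingEnd ℂ (inner ℂ (b (idx j)) ψ) * inner ℂ (b (idx j)) v := rfl

/-- The differential of `v ↦ |vⱼ|²` at `ψ`. -/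
def docc (ψ v : 𝓗) (j : Fin p) : ℝ := 2 * (bra b idx ψ j v).re

theorem norm_inner_basis_le (i : ι) (v : 𝓗) : ‖(inner ℂ (b i) v : ℂ)‖ ≤ ‖v‖ := by
  have := norm_inner_le_norm (𝕜 := ℂ) (b i) v
  rwa [b.orthonormal.1 i, one_mul] at this

theorem norm_bra_apply_le (ψ v : 𝓗) (j : Fin p) : ‖bra b idx ψ j v‖ ≤ ‖ψ‖ * ‖v‖ := by
  rw [bra_apply, norm_mul, RCLike.norm_conj]
  exact mul_le_mul (norm_inner_basis_le b _ _) (norm_inner_basis_le b _ _) (norm_nonneg _)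
    (norm_nonneg _)

theorem abs_docc_le (ψ v : 𝓗) (j : Fin p) : |docc b idx ψ v j| ≤ 2 * (‖ψ‖ * ‖v‖) := by
  rw [docc, abs_mul, abs_two]
  have := (Complex.abs_re_le_norm _).trans (norm_bra_apply_le b idx ψ v j)
  linarith

theorem docc_add (ψ v w : 𝓗) (j : Fin p) :
    docc b idx ψ (v + w) j = docc b idx ψ v j + docc b idx ψ w j := by
  simp [docc, mul_add]

theorem docc_real_smul (ψ v : 𝓗) (r : ℝ) (j : Fin p) :
    docc b idx ψ ((r : ℂ) • v) j = r * docc b idx ψ v j := by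
  simp [docc]
  ring

theorem occ_add (ψ v : 𝓗) (j : Fin p) :
    occ b idx (ψ + v) j = occ b idx ψ j + docc b idx ψ v j + ‖(inner ℂ (b (idx j)) v : ℂ)‖ ^ 2 := by
  simp only [occ, docc, bra_apply, inner_add_right, ← Complex.normSq_eq_norm_sq, Complex.normSq_apply,
    Complex.add_re, Complex.add_im, Complex.mul_re, Complex.conj_re, Complex.conj_im]
  ring

theorem occ_mem_Icc {v : 𝓗} (hv : ‖v‖ = 1) (j : Fin p) : occ b idx v j ∈ Set.Icc (0 : ℝ) 1 := by
  refine ⟨by simp only [occ]; positivity, ?_⟩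
  have := norm_inner_basis_le b (idx j) v
  rw [hv] at this
  simp only [occ]
  exact pow_le_one₀ (norm_nonneg _) this

theorem occ_smul {c : ℂ} (hc : ‖c‖ = 1) (v : 𝓗) : occ b idx (c • v) = occ b idx v := by
  ext j
  simp [occ, hc]

theorem contDiff_occ {n : WithTop ℕ∞} : ContDiff ℝ n (occ b idx) := by
  rw [contDiff_pi]
  intro j
  have h : ContDiff ℝ n fun v : 𝓗 => (innerSL ℂ (b (idx j))).restrictScalars ℝ v :=
    ContinuousLinearMap.contDiff _
  exact (contDiff_norm_sq ℝ).comp h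

/-- The differential of an occupation is only real-linear in `v`. On the pairs `(v, Cv)` it is the
restriction of a complex-linear functional, which is the reason for doubling the space. -/
theorem nuBra_conjugation (ψ v : 𝓗) (j : Fin p) :
    nuBra b idx ψ j (v, conjugation b v) = (docc b idx ψ v j : ℂ) := by
  simp only [nuBra, add_apply, smul_apply, ContinuousLinearMap.comp_apply,
    ContinuousLinearMap.coe_fst', ContinuousLinearMap.coe_snd', innerSL_apply_apply, smul_eq_mul,
    inner_basis_conjugation, docc, bra_apply]
  rw [Complex.ofReal_mul, Complex.re_eq_add_conj]
  simp
  ring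

/-- The minus sign in the second component is what conjugating `iε v' = w` produces, so the doubled
equation for `(v, Cv)` has a single generator. -/
theorem blockF₀_add_blockG_apply (A : 𝓗 →L[ℂ] 𝓗)
    (K : (Fin p → ℝ) → 𝓗 →L[ℂ] 𝓗) (ψ v : 𝓗) :
    (blockF₀ b A + blockG b idx K ψ) (v, conjugation b v) =
      (A v + ∑ j, (docc b idx ψ v j : ℂ) • derivVec b idx K ψ j,
        -conjugation b (A v + ∑ j, (docc b idx ψ v j : ℂ) • derivVec b idx K ψ j)) := by
  have h1 : blockF₀ b A (v, conjugation b v) = (A v, -conjugation b (A v)) := by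
    simp [blockF₀, conjOp_apply, conjugation_conjugation]
  have h2 : blockG b idx K ψ (v, conjugation b v) =
      (∑ j, (docc b idx ψ v j : ℂ) • derivVec b idx K ψ j,
        -conjugation b (∑ j, (docc b idx ψ v j : ℂ) • derivVec b idx K ψ j)) := by
    simp only [blockG, sum_apply, ContinuousLinearMap.smulRight_apply, nuBra_conjugation, map_sum,
      conjugation_real_smul]
    ext
    · simp [Prod.fst_sum]
    · simp [Prod.snd_sum]
  rw [add_apply, h1, h2, map_add, Prod.mk_add_mk, neg_add]

end Occupations

end

section

/-! ### Uniform Taylor estimates -/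

/-- The derivative of a `C²` map is locally Lipschitz; the mean value inequality along segments
turns this into a quadratic remainder. The constant is uniform in the base point, as needed for a
base point moving with time. -/
theorem exists_taylor_bound {V W : Type*} [NormedAddCommGroup V] [NormedSpace ℝ V]
    [NormedAddCommGroup W] [NormedSpace ℝ W] {f : V → W} {q₀ : V} (hf : ContDiffAt ℝ 2 f q₀) :
    ∃ r > 0, ∃ C : ℝ, 0 ≤ C ∧ ∀ q ∈ Metric.ball q₀ r, DifferentiableAt ℝ f q ∧
      ‖fderiv ℝ f q‖ ≤ C ∧ ∀ q' ∈ Metric.ball q₀ r, ‖f q' - f q‖ ≤ C * ‖q' - q‖ ∧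
      ‖f q' - f q - fderiv ℝ f q (q' - q)‖ ≤ C * ‖q' - q‖ ^ 2 := by
  have hf' : ContDiffAt ℝ 1 (fderiv ℝ f) q₀ := hf.fderiv_right (by norm_num)
  obtain ⟨K, U, hU, hK⟩ := hf'.exists_lipschitzOnWith
  have hd : ∀ᶠ q in 𝓝 q₀, DifferentiableAt ℝ f q :=
    (hf.eventually (by simp)).mono fun q hq => hq.differentiableAt (by norm_num)
  have hb : ∀ᶠ q in 𝓝 q₀, ‖fderiv ℝ f q‖ < ‖fderiv ℝ f q₀‖ + 1 :=
    hf'.continuousAt.norm.eventually (gt_mem_nhds (by linarith))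
  obtain ⟨r, hr, hball⟩ := Metric.mem_nhds_iff.1 (hd.and (hb.and hU))
  have hC : (0 : ℝ) ≤ max (K : ℝ) (‖fderiv ℝ f q₀‖ + 1) := le_max_of_le_left K.2
  refine ⟨r, hr, max (K : ℝ) (‖fderiv ℝ f q₀‖ + 1), hC, fun q hq => ?_⟩
  have hbd : ∀ z ∈ Metric.ball q₀ r, ‖fderiv ℝ f z‖ ≤ max (K : ℝ) (‖fderiv ℝ f q₀‖ + 1) :=
    fun z hz => (hball hz).2.1.le.trans (le_max_right _ _)
  refine ⟨(hball hq).1, hbd q hq, fun q' hq' => ⟨?_, ?_⟩⟩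
  · exact (convex_ball q₀ r).norm_image_sub_le_of_norm_fderiv_le (fun z hz => (hball hz).1) hbd
      hq hq'
  · have hseg : segment ℝ q q' ⊆ Metric.ball q₀ r := (convex_ball q₀ r).segment_subset hq hq'
    have := (convex_segment q q').norm_image_sub_le_of_norm_hasFDerivWithin_le' (f := f)
      (f' := fderiv ℝ f) (φ := fderiv ℝ f q) (C := max (K : ℝ) (‖fderiv ℝ f q₀‖ + 1) * ‖q' - q‖)
      (fun z hz => ((hball (hseg hz)).1.hasFDerivAt).hasFDerivWithinAt) (fun z hz => by
        have h1 := hK.dist_le_mul z (hball (hseg hz)).2.2 q (hball hq).2.2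
        rw [dist_eq_norm, dist_eq_norm] at h1
        refine h1.trans (mul_le_mul (le_max_left _ _) ?_ (norm_nonneg _) hC)
        obtain ⟨θ, hθ, rfl⟩ := (segment_eq_image' ℝ q q') ▸ hz
        rw [add_sub_cancel_left, norm_smul, Real.norm_eq_abs, abs_of_nonneg hθ.1]
        exact mul_le_of_le_one_left (norm_nonneg _) hθ.2)
      (left_mem_segment ℝ q q') (right_mem_segment ℝ q q')
    rw [sq, ← mul_assoc]
    exact this

theorem exists_bound_deriv {W : Type*} [NormedAddCommGroup W] [NormedSpace ℝ W] {f : ℝ → W}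
    {t₀ : ℝ} (hf : ContDiffAt ℝ 1 f t₀) : ∃ C : ℝ, 0 ≤ C ∧ ∀ᶠ t in 𝓝 t₀,
      DifferentiableAt ℝ f t ∧ ‖f t‖ ≤ C ∧ ‖deriv f t‖ ≤ C := by
  have hd : ∀ᶠ q in 𝓝 t₀, DifferentiableAt ℝ f q :=
    (hf.eventually (by simp)).mono fun q hq => hq.differentiableAt (by norm_num)
  have hc : ContinuousAt (fderiv ℝ f) t₀ :=
    ContDiffAt.continuousAt (n := 0) (hf.fderiv_right (by norm_num))
  have h1 : ∀ᶠ q in 𝓝 t₀, ‖fderiv ℝ f q‖ < ‖fderiv ℝ f t₀‖ + 1 :=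
    hc.norm.eventually (gt_mem_nhds (by linarith))
  have h2 : ∀ᶠ q in 𝓝 t₀, ‖f q‖ < ‖f t₀‖ + 1 :=
    hf.continuousAt.norm.eventually (gt_mem_nhds (by linarith))
  refine ⟨max (‖f t₀‖ + 1) (‖fderiv ℝ f t₀‖ + 1), by positivity, ?_⟩
  filter_upwards [hd, h1, h2] with t h3 h4 h5
  refine ⟨h3, h5.le.trans (le_max_left _ _), ?_⟩
  rw [norm_deriv_eq_norm_fderiv]
  exact h4.le.trans (le_max_right _ _)

/-! ### First order perturbation of the Hamiltonian and of its eigenvalues -/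

variable {𝓗 : Type u} [NormedAddCommGroup 𝓗] [InnerProductSpace ℂ 𝓗]
variable {ι : Type w} {p : ℕ}

theorem isOpen_cube {X : Set ℝ} (hX : IsOpen X) : IsOpen (cube p X) :=
  isOpen_set_pi Set.finite_univ fun _ _ => hX

/-- The directional derivative of `H` with respect to `x`. -/
def dirDeriv (H : ℝ → (Fin p → ℝ) → 𝓗 →L[ℂ] 𝓗) (t : ℝ) (x h : Fin p → ℝ) : 𝓗 →L[ℂ] 𝓗 :=
  fderiv ℝ (fun q : ℝ × (Fin p → ℝ) => H q.1 q.2) (t, x) (0, h)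

theorem dirDeriv_add (H : ℝ → (Fin p → ℝ) → 𝓗 →L[ℂ] 𝓗) (t : ℝ) (x h k : Fin p → ℝ) :
    dirDeriv H t x (h + k) = dirDeriv H t x h + dirDeriv H t x k := by
  rw [dirDeriv, dirDeriv, dirDeriv, ← map_add]
  simp

theorem dirDeriv_eq_sum (H : ℝ → (Fin p → ℝ) → 𝓗 →L[ℂ] 𝓗) (t : ℝ) (x h : Fin p → ℝ) :
    dirDeriv H t x h = ∑ j, h j • dirDeriv H t x (Pi.single j 1) := by
  have h1 : ((0 : ℝ), h) = ∑ j, h j • ((0 : ℝ), (Pi.single j 1 : Fin p → ℝ)) := by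
    ext k
    · simp [Prod.fst_sum]
    · simp [Prod.snd_sum, Finset.sum_apply, Pi.single_apply]
  simp only [dirDeriv]
  rw [h1, map_sum]
  simp only [map_smul]

/-- The derivative of the eigenvalue (Feynman-Hellmann). -/
def meanDeriv (H : ℝ → (Fin p → ℝ) → 𝓗 →L[ℂ] 𝓗) (t : ℝ) (x : Fin p → ℝ) (ψ : 𝓗)
    (h : Fin p → ℝ) : ℝ :=
  (inner ℂ ψ (dirDeriv H t x h ψ) : ℂ).re

theorem meanDeriv_eq_sum (H : ℝ → (Fin p → ℝ) → 𝓗 →L[ℂ] 𝓗) (t : ℝ) (x : Fin p → ℝ) (ψ : 𝓗)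
    (h : Fin p → ℝ) :
    meanDeriv H t x ψ h = ∑ j, h j * meanDeriv H t x ψ (Pi.single j 1) := by
  simp only [meanDeriv]
  rw [dirDeriv_eq_sum, sum_apply, inner_sum, Complex.re_sum]
  refine Finset.sum_congr rfl fun j _ => ?_
  rw [smul_apply, ← Complex.coe_smul, inner_smul_right, Complex.re_ofReal_mul]

theorem abs_meanDeriv_le (H : ℝ → (Fin p → ℝ) → 𝓗 →L[ℂ] 𝓗) (t : ℝ) (x : Fin p → ℝ) {ψ : 𝓗}
    (hψ : ‖ψ‖ = 1) (h : Fin p → ℝ) : |meanDeriv H t x ψ h| ≤ ‖dirDeriv H t x h‖ := by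
  refine (Complex.abs_re_le_norm _).trans ((norm_inner_le_norm _ _).trans ?_)
  have := (dirDeriv H t x h).le_opNorm ψ
  rw [hψ, mul_one] at this
  rwa [hψ, one_mul]

namespace IsAdmissible

variable [CompleteSpace 𝓗] {b : HilbertBasis ι ℂ 𝓗} {T X : Set ℝ} {g δ : ℝ} {N : ℕ}
  {lam : Fin N → ℝ → (Fin p → ℝ) → ℝ} {j₀ : Fin N} {H : ℝ → (Fin p → ℝ) → 𝓗 →L[ℂ] 𝓗}

theorem isOpen_domain (h : IsAdmissible b T X g δ lam j₀ H) : IsOpen (T ×ˢ cube p X) :=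
  h.isOpen_T.prod (isOpen_cube h.isOpen_X)

theorem contDiffAt (h : IsAdmissible b T X g δ lam j₀ H) {t : ℝ} {x : Fin p → ℝ} (ht : t ∈ T)
    (hx : x ∈ cube p X) :
    ContDiffAt ℝ (⊤ : ℕ∞) (fun q : ℝ × (Fin p → ℝ) => H q.1 q.2) (t, x) :=
  h.smooth.contDiffAt (h.isOpen_domain.mem_nhds ⟨ht, hx⟩)

theorem differentiableAt (h : IsAdmissible b T X g δ lam j₀ H) {t : ℝ} {x : Fin p → ℝ}
    (ht : t ∈ T) (hx : x ∈ cube p X) :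
    DifferentiableAt ℝ (fun q : ℝ × (Fin p → ℝ) => H q.1 q.2) (t, x) :=
  (h.contDiffAt ht hx).differentiableAt (by simp)

theorem hasFDerivAt (h : IsAdmissible b T X g δ lam j₀ H) {t : ℝ} {x : Fin p → ℝ}
    (ht : t ∈ T) (hx : x ∈ cube p X) :
    HasFDerivAt (fun y => H t y)
      ((fderiv ℝ (fun q : ℝ × (Fin p → ℝ) => H q.1 q.2) (t, x)).comp
        (ContinuousLinearMap.inr ℝ ℝ (Fin p → ℝ))) x :=
  HasFDerivAt.comp (g := fun q : ℝ × (Fin p → ℝ) => H q.1 q.2) x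
    (h.differentiableAt ht hx).hasFDerivAt (hasFDerivAt_prodMk_right t x)

theorem norm_dirDeriv_single_le (h : IsAdmissible b T X g δ lam j₀ H) {t : ℝ} {x : Fin p → ℝ}
    (ht : t ∈ T) (hx : x ∈ cube p X) (j : Fin p) :
    ‖dirDeriv H t x (Pi.single j 1)‖ ≤ δ := by
  have := h.partial_le t ht x hx j
  rw [(h.hasFDerivAt ht hx).fderiv] at this
  simpa [dirDeriv] using this

theorem abs_lam_sub_le (h : IsAdmissible b T X g δ lam j₀ H) (hg : 0 < g) {t t' : ℝ}
    {x x' : Fin p → ℝ} (ht : t ∈ T) (hx : x ∈ cube p X) (ht' : t' ∈ T) (hx' : x' ∈ cube p X)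
    (hlt : 2 * ‖H t x - H t' x'‖ < g) (i : Fin N) :
    |lam i t x - lam i t' x'| ≤ ‖H t x - H t' x'‖ :=
  abs_eigenvalue_sub_le (α := fun i => lam i t x) (β := fun i => lam i t' x')
    (h.selfAdjoint t' ht' x' hx') hg (h.spectrum_eq t ht x hx) (h.spectrum_eq t' ht' x' hx')
    (h.gap t ht x hx) (h.gap t' ht' x' hx') hlt i

theorem continuousOn_lam (h : IsAdmissible b T X g δ lam j₀ H) (hg : 0 < g) (i : Fin N) :
    ContinuousOn (fun q : ℝ × (Fin p → ℝ) => lam i q.1 q.2) (T ×ˢ cube p X) := by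
  rintro ⟨t, x⟩ ⟨ht, hx⟩
  have hHc := h.smooth.continuousOn (t, x) ⟨ht, hx⟩
  have h0 : Tendsto (fun q : ℝ × (Fin p → ℝ) => ‖H q.1 q.2 - H t x‖)
      (𝓝[T ×ˢ cube p X] (t, x)) (𝓝 0) := by
    have := (hHc.tendsto.sub_const (H t x)).norm
    simpa using this
  rw [ContinuousWithinAt, tendsto_iff_norm_sub_tendsto_zero]
  refine squeeze_zero' (Eventually.of_forall fun _ => norm_nonneg _) ?_ h0
  have h1 : ∀ᶠ q in 𝓝[T ×ˢ cube p X] (t, x), ‖H q.1 q.2 - H t x‖ < g / 2 :=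
    h0.eventually (gt_mem_nhds (by linarith))
  filter_upwards [h1, self_mem_nhdsWithin] with q hq hqm
  exact h.abs_lam_sub_le hg hqm.1 hqm.2 ht hx (by linarith) i

/-- First order expansion of an eigenvalue with uniform quadratic error. -/
theorem exists_lam_taylor (h : IsAdmissible b T X g δ lam j₀ H) (hg : 0 < g) {t₀ : ℝ}
    {x₀ : Fin p → ℝ} (ht₀ : t₀ ∈ T) (hx₀ : x₀ ∈ cube p X) :
    ∃ r > 0, ∃ C : ℝ, 0 ≤ C ∧ ∀ t x y, (t, x) ∈ Metric.ball (t₀, x₀) r →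
      (t, y) ∈ Metric.ball (t₀, x₀) r → t ∈ T ∧ x ∈ cube p X ∧ y ∈ cube p X ∧
      (∀ k, ‖dirDeriv H t x k‖ ≤ C * ‖k‖) ∧
      ‖H t y - H t x‖ ≤ C * ‖y - x‖ ∧
      ‖H t y - H t x - dirDeriv H t x (y - x)‖ ≤ C * ‖y - x‖ ^ 2 ∧
      |lam j₀ t y - lam j₀ t x| ≤ C * ‖y - x‖ ∧
      ∀ ψ : 𝓗, ‖ψ‖ = 1 → H t x ψ = (lam j₀ t x : ℂ) • ψ →
        |lam j₀ t y - lam j₀ t x - meanDeriv H t x ψ (y - x)| ≤ C * ‖y - x‖ ^ 2 := by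
  obtain ⟨r₁, hr₁, C, hC, hT⟩ := exists_taylor_bound
    ((h.contDiffAt ht₀ hx₀).of_le (by norm_cast) : ContDiffAt ℝ 2 _ _)
  obtain ⟨r₂, hr₂, hdom⟩ := Metric.isOpen_iff.1 h.isOpen_domain (t₀, x₀) ⟨ht₀, hx₀⟩
  -- Two points of the ball are less than `2r` apart, so the last entry keeps `2 ‖H t y - H t x‖`
  -- below the gap and the labels match.
  set r := min (min r₁ r₂) (g / (4 * (C + 1))) with hr
  have hrpos : 0 < r := by positivity
  refine ⟨r, hrpos, C + 1 / g * (2 * C) ^ 2, by positivity, fun t x y hx hy => ?_⟩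
  have hsub1 : Metric.ball (t₀, x₀) r ⊆ Metric.ball (t₀, x₀) r₁ :=
    Metric.ball_subset_ball ((min_le_left _ _).trans (min_le_left _ _))
  have hsub2 : Metric.ball (t₀, x₀) r ⊆ Metric.ball (t₀, x₀) r₂ :=
    Metric.ball_subset_ball ((min_le_left _ _).trans (min_le_right _ _))
  have hx1 := hdom (hsub2 hx)
  have hy1 := hdom (hsub2 hy)
  have hnorm : ‖((t, y) : ℝ × (Fin p → ℝ)) - (t, x)‖ = ‖y - x‖ := by simp [Prod.norm_def]
  obtain ⟨-, hdb, hq⟩ := hT _ (hsub1 hx)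
  obtain ⟨h1, h2⟩ := hq _ (hsub1 hy)
  rw [hnorm] at h1 h2
  have hsubeq : ((t, y) : ℝ × (Fin p → ℝ)) - (t, x) = (0, y - x) := by simp
  rw [hsubeq] at h2
  have hCle : C ≤ C + 1 / g * (2 * C) ^ 2 := by
    have : 0 ≤ 1 / g * (2 * C) ^ 2 := by positivity
    linarith
  have hyx : ‖y - x‖ < 2 * r := by
    rw [← hnorm, ← dist_eq_norm]
    have := dist_triangle_right (t, y) (t, x) (t₀, x₀)
    rw [Metric.mem_ball] at hx hy
    linarith
  have hsmall : 2 * ‖H t y - H t x‖ < g := by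
    have h3 : r ≤ g / (4 * (C + 1)) := min_le_right _ _
    rw [le_div_iff₀ (by positivity)] at h3
    have h4 : C * ‖y - x‖ ≤ C * (2 * r) := by gcongr
    simp only at h1
    nlinarith
  have hlam : |lam j₀ t y - lam j₀ t x| ≤ C * ‖y - x‖ :=
    (h.abs_lam_sub_le hg hy1.1 hy1.2 hx1.1 hx1.2 hsmall j₀).trans h1
  refine ⟨hx1.1, hx1.2, hy1.2, fun k => ?_, h1.trans (by gcongr), h2.trans (by gcongr),
    hlam.trans (by gcongr), fun ψ hψ heig => ?_⟩
  · refine ((fderiv ℝ _ (t, x)).le_of_opNorm_le (hdb.trans hCle) (0, k)).trans (le_of_eq ?_)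
    simp [Prod.norm_def]
  -- The eigenvector at `x` serves as trial vector for the operator at `y`: its residual is `O(‖y -
  -- x‖)`, so the eigenvalue at `y` equals the mean value of `H t y` up to a quadratic error.
  · have e1 := abs_eigenvalue_sub_mean_le (α := fun i => lam i t y)
      (h.selfAdjoint t hy1.1 y hy1.2) hg (h.spectrum_eq t hy1.1 y hy1.2)
      (h.gap t hy1.1 y hy1.2) j₀ hψ
    have e2 : ‖H t y ψ - (lam j₀ t y : ℂ) • ψ‖ ≤ 2 * C * ‖y - x‖ := by
      have : H t y ψ - (lam j₀ t y : ℂ) • ψ =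
          (H t y - H t x) ψ - ((lam j₀ t y - lam j₀ t x : ℝ) : ℂ) • ψ := by
        rw [sub_apply, heig]
        push_cast
        module
      rw [this]
      refine (norm_sub_le _ _).trans ?_
      have h3 := (H t y - H t x).le_of_opNorm_le h1 ψ
      rw [norm_smul, Complex.norm_real, Real.norm_eq_abs, hψ]
      rw [hψ] at h3
      linarith
    have e3 : |(inner ℂ ψ (H t y ψ) : ℂ).re - lam j₀ t x - meanDeriv H t x ψ (y - x)| ≤
        C * ‖y - x‖ ^ 2 := by
      have : (inner ℂ ψ (H t y ψ) : ℂ).re - lam j₀ t x - meanDeriv H t x ψ (y - x) =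
          (inner ℂ ψ ((H t y - H t x - dirDeriv H t x (y - x)) ψ) : ℂ).re := by
        rw [sub_apply, sub_apply, inner_sub_right, inner_sub_right, heig, inner_smul_right,
          inner_self_eq_norm_sq_to_K, hψ]
        simp [meanDeriv]
      rw [this]
      refine (Complex.abs_re_le_norm _).trans ((norm_inner_le_norm _ _).trans ?_)
      have h3 := (H t y - H t x - dirDeriv H t x (y - x)).le_of_opNorm_le h2 ψ
      rw [hψ, mul_one] at h3
      rwa [hψ, one_mul]
    have e4 : 1 / g * ‖H t y ψ - (lam j₀ t y : ℂ) • ψ‖ ^ 2 ≤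
        1 / g * (2 * C * ‖y - x‖) ^ 2 := by gcongr
    have e5 := abs_add_le (lam j₀ t y - (inner ℂ ψ (H t y ψ) : ℂ).re)
      ((inner ℂ ψ (H t y ψ) : ℂ).re - lam j₀ t x - meanDeriv H t x ψ (y - x))
    rw [show lam j₀ t y - (inner ℂ ψ (H t y ψ) : ℂ).re +
      ((inner ℂ ψ (H t y ψ) : ℂ).re - lam j₀ t x - meanDeriv H t x ψ (y - x)) =
      lam j₀ t y - lam j₀ t x - meanDeriv H t x ψ (y - x) by ring] at e5
    nlinarith

/-- Differentiability of the eigenvalue is not a hypothesis; it comes from its Taylor estimate, with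
the Feynman-Hellmann mean value as derivative. -/
theorem fderiv_shifted (h : IsAdmissible b T X g δ lam j₀ H) (hg : 0 < g) {t : ℝ}
    {x : Fin p → ℝ} (ht : t ∈ T) (hx : x ∈ cube p X) {ψ : 𝓗} (hψ : ‖ψ‖ = 1)
    (heig : H t x ψ = (lam j₀ t x : ℂ) • ψ) (k : Fin p → ℝ) :
    fderiv ℝ (shifted H (lam j₀) t) x k =
      dirDeriv H t x k - (meanDeriv H t x ψ k : ℂ) • ContinuousLinearMap.id ℂ 𝓗 := by
  obtain ⟨r, hr, C, hC, hT⟩ := h.exists_lam_taylor hg ht hx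
  set ml : (Fin p → ℝ) →L[ℝ] ℝ :=
    ∑ j, (meanDeriv H t x ψ (Pi.single j 1)) • ContinuousLinearMap.proj j with hml
  have hmlk : ∀ k, ml k = meanDeriv H t x ψ k := by
    intro k
    rw [meanDeriv_eq_sum, hml]
    simp [sum_apply, mul_comm]
  have hlam : HasFDerivAt (lam j₀ t) ml x := by
    rw [hasFDerivAt_iff_isLittleO]
    have hO : (fun y => lam j₀ t y - lam j₀ t x - ml (y - x)) =O[𝓝 x] fun y => ‖y - x‖ ^ 2 := by
      refine Asymptotics.IsBigO.of_bound C ?_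
      filter_upwards [Metric.ball_mem_nhds x hr] with y hy
      have := (hT t x y (Metric.mem_ball_self hr) (by
        simpa [Prod.dist_eq, hr] using hy)).2.2.2.2.2.2.2 ψ hψ heig
      rw [Real.norm_eq_abs, Real.norm_eq_abs, abs_of_nonneg (by positivity : 0 ≤ ‖y - x‖ ^ 2), hmlk]
      exact this
    refine hO.trans_isLittleO ?_
    refine Asymptotics.isLittleO_iff.2 fun c hc => ?_
    filter_upwards [Metric.ball_mem_nhds x hc] with y hy
    rw [norm_pow, norm_norm, sq]
    gcongr
    rw [← dist_eq_norm]
    exact hy.le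
  have h2 : HasFDerivAt (fun y => (lam j₀ t y : ℝ) • ContinuousLinearMap.id ℂ 𝓗)
      (ml.smulRight (ContinuousLinearMap.id ℂ 𝓗)) x := hlam.smul_const _
  have h3 := (h.hasFDerivAt ht hx).sub h2
  have h4 : shifted H (lam j₀) t =
      (fun y => H t y) - fun y => (lam j₀ t y : ℝ) • ContinuousLinearMap.id ℂ 𝓗 := by
    ext y v
    simp [shifted]
  rw [h4, h3.fderiv]
  ext v
  simp [dirDeriv, hmlk]

end IsAdmissible

end

section

/-! ### Smoothness over `ℝ` of complex bilinear operations -/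

section Smooth

variable {V : Type*} [NormedAddCommGroup V] [NormedSpace ℝ V]
variable {E F : Type*} [NormedAddCommGroup E] [NormedSpace ℂ E] [NormedAddCommGroup F]
  [NormedSpace ℂ F] {n : WithTop ℕ∞} {q : V}

/-- The operators are complex-linear but the parameters are real, so the smoothness of the complex
bilinear operation is restricted to real scalars before composing. -/
theorem _root_.ContDiffAt.clm_apply_complex {A : V → E →L[ℂ] F} {v : V → E}
    (hA : ContDiffAt ℝ n A q) (hv : ContDiffAt ℝ n v q) :
    ContDiffAt ℝ n (fun y => A y (v y)) q :=
  ((isBoundedBilinearMap_apply (𝕜 := ℂ) (E := E) (F := F)).contDiff.restrict_scalars ℝ).contDiffAt.comp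
    q (hA.prodMk hv)

theorem _root_.ContDiffAt.smulRight_complex {A : V → E →L[ℂ] ℂ} {v : V → F}
    (hA : ContDiffAt ℝ n A q) (hv : ContDiffAt ℝ n v q) :
    ContDiffAt ℝ n (fun y => (A y).smulRight (v y)) q :=
  ((isBoundedBilinearMap_smulRight (𝕜 := ℂ) (E := E) (F := F)).contDiff.restrict_scalars
    ℝ).contDiffAt.comp q (hA.prodMk hv)

theorem _root_.ContDiffAt.smul_complex {a : V → ℂ} {v : V → F}
    (ha : ContDiffAt ℝ n a q) (hv : ContDiffAt ℝ n v q) :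
    ContDiffAt ℝ n (fun y => a y • v y) q :=
  ((isBoundedBilinearMap_smul (𝕜 := ℂ) (A := ℂ) (E := F)).contDiff.restrict_scalars
    ℝ).contDiffAt.comp q (ha.prodMk hv)

theorem _root_.ContDiffAt.comp_complex {G : Type*} [NormedAddCommGroup G] [NormedSpace ℂ G]
    {A : V → F →L[ℂ] G} {B : V → E →L[ℂ] F}
    (hA : ContDiffAt ℝ n A q) (hB : ContDiffAt ℝ n B q) :
    ContDiffAt ℝ n (fun y => (A y).comp (B y)) q :=
  ((isBoundedBilinearMap_comp (𝕜 := ℂ) (E := E) (F := F) (G := G)).contDiff.restrict_scalars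
    ℝ).contDiffAt.comp q (hA.prodMk hB)

theorem _root_.ContDiffAt.inverse_complex [CompleteSpace E] {A : V → E →L[ℂ] E}
    (hA : ContDiffAt ℝ n A q) (hu : IsUnit (A q)) :
    ContDiffAt ℝ n (fun y => Ring.inverse (A y)) q := by
  obtain ⟨a, ha⟩ := hu
  have h := contDiffAt_ringInverse ℝ (n := n) a
  rw [ha] at h
  exact h.comp q hA

end Smooth

/-! ### The linearisation along a nonlinear eigenvector: invertibility and regularity in time -/

variable {𝓗 : Type u} [NormedAddCommGroup 𝓗] [InnerProductSpace ℂ 𝓗]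
variable {ι : Type w} {p : ℕ}

theorem contDiff_innerSL {n : WithTop ℕ∞} :
    ContDiff ℝ n (fun ψ : 𝓗 => (innerSL ℂ ψ : 𝓗 →L[ℂ] ℂ)) := by
  have h : IsBoundedLinearMap ℝ (fun ψ : 𝓗 => (innerSL ℂ ψ : 𝓗 →L[ℂ] ℂ)) :=
    IsLinearMap.with_bound ⟨fun x y => by simp, fun c x => by
      ext v
      simp [← Complex.coe_smul]⟩ 1 fun x => by simp
  exact h.contDiff

theorem contDiff_ketBra {n : WithTop ℕ∞} : ContDiff ℝ n (fun ψ : 𝓗 => ketBra ψ) :=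
  contDiff_iff_contDiffAt.2 fun _ =>
    contDiff_innerSL.contDiffAt.smulRight_complex contDiffAt_id

theorem contDiff_inner_right {n : WithTop ℕ∞} (e : 𝓗) :
    ContDiff ℝ n (fun ψ : 𝓗 => (inner ℂ e ψ : ℂ)) :=
  ((innerSL ℂ e).restrictScalars ℝ).contDiff

theorem contDiff_conj_inner_right {n : WithTop ℕ∞} (e : 𝓗) :
    ContDiff ℝ n (fun ψ : 𝓗 => starRingEnd ℂ (inner ℂ e ψ : ℂ)) :=
  (Complex.conjCLE : ℂ →L[ℝ] ℂ).contDiff.comp (contDiff_inner_right e)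

theorem contDiff_bra (b : HilbertBasis ι ℂ 𝓗) (idx : Fin p ↪ ι) {n : WithTop ℕ∞} (j : Fin p) :
    ContDiff ℝ n (fun ψ : 𝓗 => bra b idx ψ j) :=
  contDiff_iff_contDiffAt.2 fun _ =>
    (contDiff_conj_inner_right _).contDiffAt.smul_complex contDiffAt_const

theorem contDiff_nuBra (b : HilbertBasis ι ℂ 𝓗) (idx : Fin p ↪ ι) {n : WithTop ℕ∞} (j : Fin p) :
    ContDiff ℝ n (fun ψ : 𝓗 => nuBra b idx ψ j) := by
  unfold nuBra
  generalize (innerSL ℂ (b (idx j))).comp (ContinuousLinearMap.fst ℂ 𝓗 𝓗) = A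
  generalize (innerSL ℂ (b (idx j))).comp (ContinuousLinearMap.snd ℂ 𝓗 𝓗) = B
  refine contDiff_iff_contDiffAt.2 fun ψ => ContDiffAt.add ?_ ?_
  · exact ContDiffAt.smul_complex (F := 𝓗 × 𝓗 →L[ℂ] ℂ) (v := fun _ => A)
      (contDiff_conj_inner_right (b (idx j))).contDiffAt contDiffAt_const
  · exact ContDiffAt.smul_complex (F := 𝓗 × 𝓗 →L[ℂ] ℂ) (v := fun _ => B)
      (contDiff_inner_right (b (idx j))).contDiffAt contDiffAt_const

theorem shifted_eq (H : ℝ → (Fin p → ℝ) → 𝓗 →L[ℂ] 𝓗) (mu : ℝ → (Fin p → ℝ) → ℝ) (s : ℝ) (x : Fin p → ℝ) :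
   
    shifted H mu s x = H s x - (mu s x : ℂ) • (1 : 𝓗 →L[ℂ] 𝓗) := rfl

/-- An admissible Hamiltonian together with an instantaneous nonlinear eigenvector. -/
structure EigenSetup (b : HilbertBasis ι ℂ 𝓗) (idx : Fin p ↪ ι) (T X : Set ℝ) (g δ : ℝ) {N : ℕ}
    (lam : Fin N → ℝ → (Fin p → ℝ) → ℝ) (j₀ : Fin N) (H : ℝ → (Fin p → ℝ) → 𝓗 →L[ℂ] 𝓗)
    (T₁ : Set ℝ) (ω : ℝ → 𝓗) [CompleteSpace 𝓗] : Prop where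
  adm : IsAdmissible b T X g δ lam j₀ H
  eig : IsNonlinearEigenvector b idx H (lam j₀) T₁ ω
  gap_pos : 0 < g
  isOpen : IsOpen T₁
  ordConnected : T₁.OrdConnected
  subset : T₁ ⊆ T

theorem IsAdmissible.occ_mem_cube [CompleteSpace 𝓗] {b : HilbertBasis ι ℂ 𝓗} {T X : Set ℝ} {g δ : ℝ} {N : ℕ}
    {lam : Fin N → ℝ → (Fin p → ℝ) → ℝ} {j₀ : Fin N} {H : ℝ → (Fin p → ℝ) → 𝓗 →L[ℂ] 𝓗}
    (h : IsAdmissible b T X g δ lam j₀ H) (idx : Fin p ↪ ι) {v : 𝓗} (hv : ‖v‖ = 1) :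
    occ b idx v ∈ cube p X :=
  fun j _ => h.unit_subset_X (occ_mem_Icc b idx hv j)

theorem norm_add_sub_add_le {E : Type*} [SeminormedAddCommGroup E] {A B C D : E} {r s : ℝ}
    (h : ‖A - B‖ ≤ r) (h' : ‖C - D‖ ≤ s) : ‖(A + C) - (B + D)‖ ≤ r + s := by
  rw [add_sub_add_comm]
  exact (norm_add_le _ _).trans (add_le_add h h')

namespace EigenSetup

variable [CompleteSpace 𝓗] {b : HilbertBasis ι ℂ 𝓗} {idx : Fin p ↪ ι} {T X : Set ℝ} {g δ : ℝ}
  {N : ℕ} {lam : Fin N → ℝ → (Fin p → ℝ) → ℝ} {j₀ : Fin N}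
  {H : ℝ → (Fin p → ℝ) → 𝓗 →L[ℂ] 𝓗} {T₁ : Set ℝ} {ω : ℝ → 𝓗} {t : ℝ}

theorem mem_T (S : EigenSetup b idx T X g δ lam j₀ H T₁ ω)
    (ht : t ∈ T₁) : t ∈ T := S.subset ht

theorem norm_eq (S : EigenSetup b idx T X g δ lam j₀ H T₁ ω)
    (ht : t ∈ T₁) : ‖ω t‖ = 1 := S.eig.norm_eq t ht

theorem inner_self (S : EigenSetup b idx T X g δ lam j₀ H T₁ ω)
    (ht : t ∈ T₁) : (inner ℂ (ω t) (ω t) : ℂ) = 1 := by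
  rw [inner_self_eq_norm_sq_to_K, S.norm_eq ht]
  simp

theorem occ_mem (S : EigenSetup b idx T X g δ lam j₀ H T₁ ω)
    (ht : t ∈ T₁) : occ b idx (ω t) ∈ cube p X :=
  S.adm.occ_mem_cube idx (S.norm_eq ht)

theorem derivVec_eq (S : EigenSetup b idx T X g δ lam j₀ H T₁ ω)
    (ht : t ∈ T₁) (j : Fin p) :
    derivVec b idx (shifted H (lam j₀) t) (ω t) j =
      dirDeriv H t (occ b idx (ω t)) (Pi.single j 1) (ω t) -
        (meanDeriv H t (occ b idx (ω t)) (ω t) (Pi.single j 1) : ℂ) • ω t := by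
  rw [derivVec, S.adm.fderiv_shifted S.gap_pos (S.mem_T ht) (S.occ_mem ht) (S.norm_eq ht)
    (S.eig.eigen t ht)]
  rfl

/-- One `δ` comes from the derivative of `H`, the other from that of the eigenvalue, which is a mean
value of the former. -/
theorem norm_derivVec_le (S : EigenSetup b idx T X g δ lam j₀ H T₁ ω)
    (ht : t ∈ T₁) (j : Fin p) :
    ‖derivVec b idx (shifted H (lam j₀) t) (ω t) j‖ ≤ 2 * δ := by
  have h1 := S.adm.norm_dirDeriv_single_le (S.mem_T ht) (S.occ_mem ht) j
  rw [S.derivVec_eq ht]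
  refine (norm_sub_le _ _).trans ?_
  have h2 := (dirDeriv H t (occ b idx (ω t)) (Pi.single j 1)).le_of_opNorm_le h1 (ω t)
  have h3 := (abs_meanDeriv_le H t (occ b idx (ω t)) (S.norm_eq ht) (Pi.single j 1)).trans h1
  rw [norm_smul, Complex.norm_real, Real.norm_eq_abs, S.norm_eq ht]
  rw [S.norm_eq ht] at h2
  linarith

/-! #### The shifted Hamiltonian along the eigenvector -/

theorem isSelfAdjoint_shifted (S : EigenSetup b idx T X g δ lam j₀ H T₁ ω)
    (ht : t ∈ T₁) :
    IsSelfAdjoint (shifted H (lam j₀) t (occ b idx (ω t))) :=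
  isSelfAdjoint_sub_real_smul (S.adm.selfAdjoint t (S.mem_T ht) _ (S.occ_mem ht)) _

theorem shifted_apply_self (S : EigenSetup b idx T X g δ lam j₀ H T₁ ω)
    (ht : t ∈ T₁) :
    shifted H (lam j₀) t (occ b idx (ω t)) (ω t) = 0 := by
  rw [shifted_eq, sub_apply, S.eig.eigen t ht]
  simp

theorem inner_shifted (S : EigenSetup b idx T X g δ lam j₀ H T₁ ω)
    (ht : t ∈ T₁) (v : 𝓗) :
    (inner ℂ (ω t) (shifted H (lam j₀) t (occ b idx (ω t)) v) : ℂ) = 0 := by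
  have hsym := (ContinuousLinearMap.isSelfAdjoint_iff_isSymmetric.1
    (S.isSelfAdjoint_shifted ht)) (ω t) v
  simp only [ContinuousLinearMap.coe_coe] at hsym
  rw [← hsym, S.shifted_apply_self ht, inner_zero_left]

theorem eq_smul_of_shifted_eq_zero (S : EigenSetup b idx T X g δ lam j₀ H T₁ ω)
    (ht : t ∈ T₁) {v : 𝓗}
    (hv : shifted H (lam j₀) t (occ b idx (ω t)) v = 0) : ∃ c : ℂ, v = c • ω t := by
  have hmem : ∀ u : 𝓗, H t (occ b idx (ω t)) u = (lam j₀ t (occ b idx (ω t)) : ℂ) • u →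
      u ∈ Module.End.eigenspace (H t (occ b idx (ω t)) : 𝓗 →ₗ[ℂ] 𝓗)
        (lam j₀ t (occ b idx (ω t)) : ℂ) := fun u hu =>
    Module.End.mem_eigenspace_iff.2 hu
  have hω0 : ω t ≠ 0 := by
    intro h0
    have := S.norm_eq ht
    rw [h0, norm_zero] at this
    exact zero_ne_one this
  have hv' : H t (occ b idx (ω t)) v = (lam j₀ t (occ b idx (ω t)) : ℂ) • v := by
    rw [shifted_eq, sub_apply, sub_eq_zero] at hv
    exact hv
  obtain ⟨c, hc⟩ := (finrank_eq_one_iff_of_nonzero' (⟨ω t, hmem _ (S.eig.eigen t ht)⟩ :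
    Module.End.eigenspace (H t (occ b idx (ω t)) : 𝓗 →ₗ[ℂ] 𝓗)
      (lam j₀ t (occ b idx (ω t)) : ℂ)) (by simpa using hω0)).1
    (S.adm.simple t (S.mem_T ht) _ (S.occ_mem ht)) ⟨v, hmem v hv'⟩
  exact ⟨c, (congrArg Subtype.val hc).symm⟩

/-- The shifted Hamiltonian made invertible by a rank one term. -/
def regular (_S : EigenSetup b idx T X g δ lam j₀ H T₁ ω) (t : ℝ) : 𝓗 →L[ℂ] 𝓗 :=
  shifted H (lam j₀) t (occ b idx (ω t)) + (g : ℂ) • ketBra (ω t)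

/-- The complex linear extension of `v ↦ ∑ⱼ (∂|vⱼ|²) ∂ⱼK ω`. -/
def coupling (_S : EigenSetup b idx T X g δ lam j₀ H T₁ ω) (t : ℝ) : 𝓗 →L[ℂ] 𝓗 :=
  ∑ j : Fin p, (2 : ℂ) • (bra b idx (ω t) j).smulRight
    (derivVec b idx (shifted H (lam j₀) t) (ω t) j)

theorem exists_inverse_regular (S : EigenSetup b idx T X g δ lam j₀ H T₁ ω)
    (ht : t ∈ T₁) :
    ∃ B : 𝓗 →L[ℂ] 𝓗, S.regular t * B = 1 ∧ B * S.regular t = 1 ∧ ‖B‖ ≤ 3 / g :=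
  exists_inverse_add_ketBra (S.isSelfAdjoint_shifted ht) S.gap_pos
    (eq_zero_or_le_abs_of_mem_spectrum (S.adm.spectrum_eq t (S.mem_T ht) _ (S.occ_mem ht))
      (S.adm.gap t (S.mem_T ht) _ (S.occ_mem ht)) j₀) (S.norm_eq ht) (S.shifted_apply_self ht)
    fun _ hv => S.eq_smul_of_shifted_eq_zero ht hv

theorem isUnit_regular (S : EigenSetup b idx T X g δ lam j₀ H T₁ ω)
    (ht : t ∈ T₁) : IsUnit (S.regular t) := by
  obtain ⟨B, h1, h2, -⟩ := S.exists_inverse_regular ht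
  exact ⟨⟨_, B, h1, h2⟩, rfl⟩

theorem norm_coupling_le (S : EigenSetup b idx T X g δ lam j₀ H T₁ ω)
    (ht : t ∈ T₁) : ‖S.coupling t‖ ≤ 4 * p * δ := by
  refine (norm_sum_le _ _).trans ?_
  have : ∀ j ∈ Finset.univ, ‖(2 : ℂ) • (bra b idx (ω t) j).smulRight
      (derivVec b idx (shifted H (lam j₀) t) (ω t) j)‖ ≤ 4 * δ := by
    intro j _
    have h1 : ‖bra b idx (ω t) j‖ ≤ 1 := by
      refine ContinuousLinearMap.opNorm_le_bound _ zero_le_one fun v => ?_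
      have := norm_bra_apply_le b idx (ω t) v j
      rwa [S.norm_eq ht] at this
    have h2 := S.norm_derivVec_le ht j
    rw [norm_smul, ContinuousLinearMap.norm_smulRight_apply, Complex.norm_two]
    have := mul_le_mul h1 h2 (norm_nonneg _) zero_le_one
    linarith
  refine (Finset.sum_le_sum this).trans (le_of_eq ?_)
  simp
  ring

/-- Neumann series around `regular`: the bounds `3 / g` and `4pδ` multiply to less than one. This is
where smallness of `δ` enters, and it serves only the phase estimate. -/
theorem isUnit_regular_add_coupling (S : EigenSetup b idx T X g δ lam j₀ H T₁ ω)
    (ht : t ∈ T₁) (hδ : 12 * p * δ < g) :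
    IsUnit (S.regular t + S.coupling t) := by
  obtain ⟨B, h1, h2, h3⟩ := S.exists_inverse_regular ht
  refine isUnit_add_of_norm_mul_lt h1 h2 ?_
  have hg := S.gap_pos
  calc ‖B‖ * ‖S.coupling t‖ ≤ 3 / g * (4 * p * δ) :=
        mul_le_mul h3 (S.norm_coupling_le ht) (norm_nonneg _) (by positivity)
    _ = 12 * p * δ / g := by ring
    _ < 1 := by rwa [div_lt_one hg]

/-! #### Smoothness in time -/

theorem contDiffAt (S : EigenSetup b idx T X g δ lam j₀ H T₁ ω)
    (ht : t ∈ T₁) : ContDiffAt ℝ (⊤ : ℕ∞) ω t :=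
  S.eig.smooth.contDiffAt (S.isOpen.mem_nhds ht)

theorem contDiffAt_deriv (S : EigenSetup b idx T X g δ lam j₀ H T₁ ω)
    (ht : t ∈ T₁) : ContDiffAt ℝ 1 (deriv ω) t := by
  have h1 : ContDiffAt ℝ 1 (fderiv ℝ ω) t :=
    ContDiffAt.fderiv_right (S.contDiffAt ht) (by norm_cast)
  exact h1.clm_apply contDiffAt_const

theorem contDiffAt_occ (S : EigenSetup b idx T X g δ lam j₀ H T₁ ω)
    (ht : t ∈ T₁) : ContDiffAt ℝ (⊤ : ℕ∞) (fun s => occ b idx (ω s)) t :=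
  (contDiff_occ b idx).contDiffAt.comp t (S.contDiffAt ht)

theorem contDiffAt_hamiltonian (S : EigenSetup b idx T X g δ lam j₀ H T₁ ω)
    (ht : t ∈ T₁) :
    ContDiffAt ℝ 1 (fun s => H s (occ b idx (ω s))) t :=
  ContDiffAt.comp (g := fun q : ℝ × (Fin p → ℝ) => H q.1 q.2) t
    ((S.adm.contDiffAt (S.mem_T ht) (S.occ_mem ht)).of_le (by norm_cast))
    (contDiffAt_id.prodMk ((S.contDiffAt_occ ht).of_le (by norm_cast)))

theorem contDiffAt_dirDeriv (S : EigenSetup b idx T X g δ lam j₀ H T₁ ω)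
    (ht : t ∈ T₁) (k : Fin p → ℝ) :
    ContDiffAt ℝ 1 (fun s => dirDeriv H s (occ b idx (ω s)) k) t := by
  have h1 : ContDiffAt ℝ 1 (fderiv ℝ fun q : ℝ × (Fin p → ℝ) => H q.1 q.2)
      (t, occ b idx (ω t)) :=
    ContDiffAt.fderiv_right (S.adm.contDiffAt (S.mem_T ht) (S.occ_mem ht)) (by norm_cast)
  have h2 : ContDiffAt ℝ 1 (fun s => ((s, occ b idx (ω s)) : ℝ × (Fin p → ℝ))) t :=
    contDiffAt_id.prodMk ((S.contDiffAt_occ ht).of_le (by norm_cast))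
  exact (h1.comp t h2).clm_apply contDiffAt_const

theorem contDiffAt_meanDeriv (S : EigenSetup b idx T X g δ lam j₀ H T₁ ω)
    (ht : t ∈ T₁) (k : Fin p → ℝ) :
    ContDiffAt ℝ 1 (fun s => meanDeriv H s (occ b idx (ω s)) (ω s) k) t := by
  have hω := (S.contDiffAt ht).of_le (by norm_cast : ((1 : ℕ∞) : WithTop ℕ∞) ≤ (⊤ : ℕ∞))
  exact Complex.reCLM.contDiff.contDiffAt.comp t
    (hω.inner ℂ ((S.contDiffAt_dirDeriv ht k).clm_apply_complex hω))

/-- As a mean value, the eigenvalue along `ω` inherits its time regularity from `H` and `ω`. -/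
theorem eigenvalue_eq (S : EigenSetup b idx T X g δ lam j₀ H T₁ ω)
    (ht : t ∈ T₁) : lam j₀ t (occ b idx (ω t)) =
    (inner ℂ (ω t) (H t (occ b idx (ω t)) (ω t)) : ℂ).re := by
  rw [S.eig.eigen t ht, inner_smul_right, S.inner_self ht]
  simp

theorem contDiffAt_eigenvalue (S : EigenSetup b idx T X g δ lam j₀ H T₁ ω)
    (ht : t ∈ T₁) :
    ContDiffAt ℝ 1 (fun s => lam j₀ s (occ b idx (ω s))) t := by
  have hω := (S.contDiffAt ht).of_le (by norm_cast : ((1 : ℕ∞) : WithTop ℕ∞) ≤ (⊤ : ℕ∞))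
  have h1 : ContDiffAt ℝ 1
      (fun s => (inner ℂ (ω s) (H s (occ b idx (ω s)) (ω s)) : ℂ).re) t :=
    Complex.reCLM.contDiff.contDiffAt.comp t
      (hω.inner ℂ ((S.contDiffAt_hamiltonian ht).clm_apply_complex hω))
  refine h1.congr_of_eventuallyEq ?_
  filter_upwards [S.isOpen.mem_nhds ht] with s hs
  exact S.eigenvalue_eq hs

theorem contDiffAt_shifted (S : EigenSetup b idx T X g δ lam j₀ H T₁ ω)
    (ht : t ∈ T₁) :
    ContDiffAt ℝ 1 (fun s => shifted H (lam j₀) s (occ b idx (ω s))) t :=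
  (S.contDiffAt_hamiltonian ht).sub
    ((Complex.ofRealCLM.contDiff.contDiffAt.comp t
      (S.contDiffAt_eigenvalue ht)).smul_complex contDiffAt_const)

theorem contDiffAt_derivVec (S : EigenSetup b idx T X g δ lam j₀ H T₁ ω)
    (ht : t ∈ T₁) (j : Fin p) :
    ContDiffAt ℝ 1 (fun s => derivVec b idx (shifted H (lam j₀) s) (ω s) j) t := by
  have hω := (S.contDiffAt ht).of_le (by norm_cast : ((1 : ℕ∞) : WithTop ℕ∞) ≤ (⊤ : ℕ∞))
  have h1 : ContDiffAt ℝ 1 (fun s => dirDeriv H s (occ b idx (ω s)) (Pi.single j 1) (ω s) -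
        (meanDeriv H s (occ b idx (ω s)) (ω s) (Pi.single j 1) : ℂ) • ω s) t :=
    ((S.contDiffAt_dirDeriv ht _).clm_apply_complex hω).sub
      ((Complex.ofRealCLM.contDiff.contDiffAt.comp t
        (S.contDiffAt_meanDeriv ht _)).smul_complex hω)
  refine h1.congr_of_eventuallyEq ?_
  filter_upwards [S.isOpen.mem_nhds ht] with s hs
  exact S.derivVec_eq hs j

theorem contDiffAt_regular (S : EigenSetup b idx T X g δ lam j₀ H T₁ ω)
    (ht : t ∈ T₁) : ContDiffAt ℝ 1 S.regular t := by
  have hω := (S.contDiffAt ht).of_le (by norm_cast : ((1 : ℕ∞) : WithTop ℕ∞) ≤ (⊤ : ℕ∞))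
  have h1 : ContDiffAt ℝ 1 (fun s => (g : ℂ) • ketBra (ω s)) t :=
    contDiffAt_const.smul_complex (contDiff_ketBra.contDiffAt.comp t hω)
  exact (S.contDiffAt_shifted ht).add h1

theorem contDiffAt_bra (S : EigenSetup b idx T X g δ lam j₀ H T₁ ω)
    (ht : t ∈ T₁) (j : Fin p) :
    ContDiffAt ℝ 1 (fun s => bra b idx (ω s) j) t :=
  (contDiff_bra b idx j).contDiffAt.comp t ((S.contDiffAt ht).of_le (by norm_cast))

theorem contDiffAt_coupling (S : EigenSetup b idx T X g δ lam j₀ H T₁ ω)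
    (ht : t ∈ T₁) : ContDiffAt ℝ 1 S.coupling t := by
  refine ContDiffAt.sum fun j _ => ?_
  exact contDiffAt_const.smul_complex
    ((S.contDiffAt_bra ht j).smulRight_complex (S.contDiffAt_derivVec ht j))

theorem contDiffAt_blockG (S : EigenSetup b idx T X g δ lam j₀ H T₁ ω)
    (ht : t ∈ T₁) :
    ContDiffAt ℝ 1 (fun s => blockG b idx (shifted H (lam j₀) s) (ω s)) t := by
  unfold blockG
  refine ContDiffAt.sum fun j _ => ?_
  refine ContDiffAt.smulRight_complex ?_ ?_
  · exact (contDiff_nuBra b idx j).contDiffAt.comp t ((S.contDiffAt ht).of_le (by norm_cast))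
  · refine (S.contDiffAt_derivVec ht j).prodMk ?_
    exact ((conjReal b).contDiff.contDiffAt.comp t (S.contDiffAt_derivVec ht j)).neg

/-- The linearised operator is locally Lipschitz in time. -/
theorem exists_lipschitz_linF (S : EigenSetup b idx T X g δ lam j₀ H T₁ ω)
    (ht : t ∈ T₁) : ∃ U ∈ 𝓝 t, ∃ L : ℝ, 0 ≤ L ∧ ∀ r ∈ U, ∀ s ∈ U,
    ‖linF b idx H (lam j₀) ω r - linF b idx H (lam j₀) ω s‖ ≤ L * |r - s| := by
  obtain ⟨L₁, U₁, hU₁, hL₁⟩ := (S.contDiffAt_shifted ht).exists_lipschitzOnWith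
  obtain ⟨L₂, U₂, hU₂, hL₂⟩ := (S.contDiffAt_blockG ht).exists_lipschitzOnWith
  refine ⟨U₁ ∩ U₂, inter_mem hU₁ hU₂, L₁ + L₂, by positivity, fun r hr s hs => ?_⟩
  have h1 := hL₁.dist_le_mul r hr.1 s hs.1
  have h2 := hL₂.dist_le_mul r hr.2 s hs.2
  rw [dist_eq_norm, Real.dist_eq] at h1 h2
  have h3 := (norm_blockF₀_sub_le b _ _).trans h1
  rw [add_mul]
  exact norm_add_sub_add_le h3 h2

end EigenSetup

end

section

variable {𝓗 : Type u} [NormedAddCommGroup 𝓗] [InnerProductSpace ℂ 𝓗]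
variable {ι : Type w} {p : ℕ}
variable {b : HilbertBasis ι ℂ 𝓗} {idx : Fin p ↪ ι} {T X : Set ℝ} {g δ : ℝ}
  {N : ℕ} {lam : Fin N → ℝ → (Fin p → ℝ) → ℝ} {j₀ : Fin N}
  {H : ℝ → (Fin p → ℝ) → 𝓗 →L[ℂ] 𝓗} {T₁ : Set ℝ} {ω : ℝ → 𝓗} {t : ℝ}

/-! ### Reality -/

theorem hasDerivAt_conj {u : ℝ → 𝓗} {u' : 𝓗} (b : HilbertBasis ι ℂ 𝓗) (hu : HasDerivAt u u' t) :
    HasDerivAt (fun s => conjugation b (u s)) (conjugation b u') t :=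
  (conjReal b).hasFDerivAt.comp_hasDerivAt t hu

variable [CompleteSpace 𝓗]

theorem IsAdmissible.conj_apply (h : IsAdmissible b T X g δ lam j₀ H) (ht : t ∈ T)
    {x : Fin p → ℝ} (hx : x ∈ cube p X) (v : 𝓗) :
    conjugation b (H t x v) = H t x (conjugation b v) := by
  have := congrArg (fun A : 𝓗 →L[ℂ] 𝓗 => A (conjugation b v)) (h.real t ht x hx)
  simpa [conjOp_apply, conjugation_conjugation] using this

/-- Differentiate the commutation of `H` with the conjugation, applied to a fixed vector, and use
uniqueness of the derivative. -/
theorem IsAdmissible.conj_dirDeriv_apply (h : IsAdmissible b T X g δ lam j₀ H) (ht : t ∈ T)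
    {x : Fin p → ℝ} (hx : x ∈ cube p X) (k : Fin p → ℝ) (v : 𝓗) :
    conjugation b (dirDeriv H t x k v) = dirDeriv H t x k (conjugation b v) := by
  have h1 := h.hasFDerivAt ht hx
  have h2 : ∀ u : 𝓗, HasFDerivAt (fun y => H t y u) _ x := fun u =>
    (((ContinuousLinearMap.apply ℂ 𝓗 u).restrictScalars ℝ).hasFDerivAt.comp x h1)
  have h3 : HasFDerivAt (fun y => conjReal b (H t y v)) _ x :=
    (conjReal b).hasFDerivAt.comp x (h2 v)
  have h4 : (fun y => conjReal b (H t y v)) =ᶠ[𝓝 x] fun y => H t y (conjugation b v) := by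
    filter_upwards [(isOpen_cube h.isOpen_X).mem_nhds hx] with y hy
    exact h.conj_apply ht hy v
  have h5 := (h3.congr_of_eventuallyEq h4.symm).unique (h2 (conjugation b v))
  have h6 := congrArg (fun A : (Fin p → ℝ) →L[ℝ] 𝓗 => A k) h5
  simpa [dirDeriv, conjReal_apply] using h6

namespace EigenSetup

theorem conj_shifted_apply (S : EigenSetup b idx T X g δ lam j₀ H T₁ ω) (ht : t ∈ T₁) (v : 𝓗) :
    conjugation b (shifted H (lam j₀) t (occ b idx (ω t)) v) =
      shifted H (lam j₀) t (occ b idx (ω t)) (conjugation b v) := by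
  rw [shifted_eq, sub_apply, sub_apply, map_sub, S.adm.conj_apply (S.mem_T ht) (S.occ_mem ht),
    smul_apply, smul_apply, one_apply_eq_self, one_apply_eq_self, conjugation_real_smul]

theorem inner_deriv_self (S : EigenSetup b idx T X g δ lam j₀ H T₁ ω) (ht : t ∈ T₁) :
    (inner ℂ (deriv ω t) (ω t) : ℂ) = 0 := by
  rw [← inner_conj_symm, S.eig.parallel t ht, map_zero]

theorem hasDerivAt (S : EigenSetup b idx T X g δ lam j₀ H T₁ ω) (ht : t ∈ T₁) :
    HasDerivAt ω (deriv ω t) t :=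
  ((S.contDiffAt ht).differentiableAt (by simp)).hasDerivAt

/-- The eigenvector is real up to a constant phase. -/
theorem exists_phase (S : EigenSetup b idx T X g δ lam j₀ H T₁ ω) :
    ∃ c : ℂ, ∀ t ∈ T₁, conjugation b (ω t) = c • ω t := by
  set c : ℝ → ℂ := fun t => inner ℂ (ω t) (conjugation b (ω t)) with hc
  have h1 : ∀ t ∈ T₁, conjugation b (ω t) = c t • ω t := by
    intro t ht
    obtain ⟨d, hd⟩ := S.eq_smul_of_shifted_eq_zero ht (v := conjugation b (ω t)) (by
      rw [← S.conj_shifted_apply ht, S.shifted_apply_self ht, map_zero])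
    have : c t = d := by
      rw [hc]
      simp only
      rw [hd, inner_smul_right, S.inner_self ht, mul_one]
    rw [this, hd]
  -- Both terms of the product rule reduce, by antiunitarity and `h1`, to multiples of `⟨ω', ω⟩`,
  -- which vanishes by parallel transport.
  have h2 : ∀ t ∈ T₁, HasDerivAt c 0 t := by
    intro t ht
    have hd := S.hasDerivAt ht
    convert! hd.inner ℂ (hasDerivAt_conj b hd) using 1
    rw [inner_conjugation_comm b (ω t), h1 t ht, inner_smul_right, S.inner_deriv_self ht]
    simp
  rcases T₁.eq_empty_or_nonempty with hE | ⟨t₀, ht₀⟩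
  · exact ⟨0, fun t ht => by simp [hE] at ht⟩
  · refine ⟨c t₀, fun t ht => ?_⟩
    have h3 := S.isOpen.is_const_of_deriv_eq_zero S.ordConnected.isPreconnected
      (fun s hs => (h2 s hs).differentiableAt.differentiableWithinAt)
      (fun s hs => (h2 s hs).deriv) ht ht₀
    rw [← h3]
    exact h1 t ht

/-- The phase `c` with `C ω = c ω`. -/
def phase (S : EigenSetup b idx T X g δ lam j₀ H T₁ ω) : ℂ := S.exists_phase.choose

theorem conj_eq (S : EigenSetup b idx T X g δ lam j₀ H T₁ ω) (ht : t ∈ T₁) :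
    conjugation b (ω t) = S.phase • ω t :=
  S.exists_phase.choose_spec t ht

theorem norm_phase (S : EigenSetup b idx T X g δ lam j₀ H T₁ ω) (ht : t ∈ T₁) :
    ‖S.phase‖ = 1 := by
  have := congrArg norm (S.conj_eq ht)
  rwa [norm_conjugation, norm_smul, S.norm_eq ht, mul_one, eq_comm] at this

theorem conj_phase_mul (S : EigenSetup b idx T X g δ lam j₀ H T₁ ω) (ht : t ∈ T₁) :
    starRingEnd ℂ S.phase * S.phase = 1 := by
  rw [← Complex.normSq_eq_conj_mul_self, Complex.normSq_eq_norm_sq, S.norm_phase ht]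
  simp

theorem conj_deriv_eq (S : EigenSetup b idx T X g δ lam j₀ H T₁ ω) (ht : t ∈ T₁) :
    conjugation b (deriv ω t) = S.phase • deriv ω t := by
  have h1 := hasDerivAt_conj b (S.hasDerivAt ht)
  have h2 : HasDerivAt (fun s => S.phase • ω s) (S.phase • deriv ω t) t :=
    (S.hasDerivAt ht).const_smul S.phase
  refine h1.unique (h2.congr_of_eventuallyEq ?_)
  filter_upwards [S.isOpen.mem_nhds ht] with s hs
  exact S.conj_eq hs

theorem conj_derivVec (S : EigenSetup b idx T X g δ lam j₀ H T₁ ω) (ht : t ∈ T₁) (j : Fin p) :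
    conjugation b (derivVec b idx (shifted H (lam j₀) t) (ω t) j) =
      S.phase • derivVec b idx (shifted H (lam j₀) t) (ω t) j := by
  rw [S.derivVec_eq ht, map_sub, S.adm.conj_dirDeriv_apply (S.mem_T ht) (S.occ_mem ht),
    conjugation_real_smul, S.conj_eq ht, map_smul]
  module

theorem conj_regular_apply (S : EigenSetup b idx T X g δ lam j₀ H T₁ ω) (ht : t ∈ T₁) (v : 𝓗) :
    conjugation b (S.regular t v) = S.regular t (conjugation b v) := by
  rw [regular, add_apply, add_apply, map_add, S.conj_shifted_apply ht, smul_apply, smul_apply,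
    conjugation_real_smul, ketBra_apply, ketBra_apply, map_smulₛₗ, S.conj_eq ht,
    inner_conjugation_comm, S.conj_eq ht, inner_smul_right, inner_conj_symm]
  module

/-! ### The first order corrector -/

theorem inverse_regular_apply (S : EigenSetup b idx T X g δ lam j₀ H T₁ ω) (ht : t ∈ T₁)
    (v : 𝓗) : Ring.inverse (S.regular t) (S.regular t v) = v := by
  have := Ring.inverse_mul_cancel _ (S.isUnit_regular ht)
  exact congrArg (fun A : 𝓗 →L[ℂ] 𝓗 => A v) this

/-- The vector `β` orthogonal to `ω` with `K β = ∂ₜω`. -/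
def corrector (S : EigenSetup b idx T X g δ lam j₀ H T₁ ω) (t : ℝ) : 𝓗 :=
  Ring.inverse (S.regular t) (deriv ω t)

theorem contDiffAt_corrector (S : EigenSetup b idx T X g δ lam j₀ H T₁ ω) (ht : t ∈ T₁) :
    ContDiffAt ℝ 1 S.corrector t :=
  ((S.contDiffAt_regular ht).inverse_complex (S.isUnit_regular ht)).clm_apply_complex
    (S.contDiffAt_deriv ht)

theorem regular_corrector (S : EigenSetup b idx T X g δ lam j₀ H T₁ ω) (ht : t ∈ T₁) :
    S.regular t (S.corrector t) = deriv ω t := by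
  have := Ring.mul_inverse_cancel _ (S.isUnit_regular ht)
  exact congrArg (fun A : 𝓗 →L[ℂ] 𝓗 => A (deriv ω t)) this

/-- Pairing the equation of the corrector with `ω` gives `g ⟨ω, β⟩ = ⟨ω, ω'⟩ = 0`, so the rank one
term drops out. -/
theorem shifted_corrector (S : EigenSetup b idx T X g δ lam j₀ H T₁ ω) (ht : t ∈ T₁) :
    shifted H (lam j₀) t (occ b idx (ω t)) (S.corrector t) = deriv ω t := by
  have h1 := S.regular_corrector ht
  rw [regular, add_apply, smul_apply, ketBra_apply] at h1
  have h2 := congrArg (fun u : 𝓗 => (inner ℂ (ω t) u : ℂ)) h1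
  simp only [inner_add_right, inner_smul_right, S.inner_shifted ht, S.eig.parallel t ht,
    S.inner_self ht, zero_add, mul_one] at h2
  have hgc : (g : ℂ) ≠ 0 := by exact_mod_cast S.gap_pos.ne'
  rw [(mul_eq_zero.1 h2).resolve_left hgc] at h1
  simpa using h1

/-- The regularised operator commutes with the conjugation and is injective, so the phase of `ω'`
passes to its preimage. -/
theorem conj_corrector (S : EigenSetup b idx T X g δ lam j₀ H T₁ ω) (ht : t ∈ T₁) :
    conjugation b (S.corrector t) = S.phase • S.corrector t := by
  have h1 : S.regular t (conjugation b (S.corrector t)) =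
      S.regular t (S.phase • S.corrector t) := by
    rw [← S.conj_regular_apply ht, S.regular_corrector ht, map_smul, S.regular_corrector ht,
      S.conj_deriv_eq ht]
  have h2 := congrArg (fun u => (Ring.inverse (S.regular t) : 𝓗 →L[ℂ] 𝓗) u) h1
  rwa [S.inverse_regular_apply ht, S.inverse_regular_apply ht] at h2

theorem conj_inner_basis_eq (S : EigenSetup b idx T X g δ lam j₀ H T₁ ω) (ht : t ∈ T₁) (i : ι) :
    starRingEnd ℂ (inner ℂ (b i) (ω t)) = S.phase * inner ℂ (b i) (ω t) := by
  rw [← inner_basis_conjugation, S.conj_eq ht, inner_smul_right]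

/-- If `v` has the phase of `ω`, then `conj ωⱼ vⱼ` is real, and multiplication by `i` kills its real
part. Hence the corrector `iεβ` does not feed the coupling. -/
theorem docc_I_smul_eq_zero (S : EigenSetup b idx T X g δ lam j₀ H T₁ ω) (ht : t ∈ T₁)
    {v : 𝓗} (hv : conjugation b v = S.phase • v) (j : Fin p) :
    docc b idx (ω t) (Complex.I • v) j = 0 := by
  have h1 : starRingEnd ℂ (inner ℂ (b (idx j)) v) = S.phase * inner ℂ (b (idx j)) v := by
    rw [← inner_basis_conjugation, hv, inner_smul_right]
  have h2 : starRingEnd ℂ (bra b idx (ω t) j v) = bra b idx (ω t) j v := by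
    rw [bra_apply, map_mul, Complex.conj_conj, h1, S.conj_inner_basis_eq ht]
    ring
  rw [docc, map_smul, smul_eq_mul, Complex.I_mul_re, Complex.conj_eq_iff_im.1 h2]
  simp

/-! ### Expansion of the nonlinearity -/

theorem sum_smul_derivVec (S : EigenSetup b idx T X g δ lam j₀ H T₁ ω) (ht : t ∈ T₁)
    (k : Fin p → ℝ) :
    ∑ j, (k j : ℂ) • derivVec b idx (shifted H (lam j₀) t) (ω t) j =
      dirDeriv H t (occ b idx (ω t)) k (ω t) -
        (meanDeriv H t (occ b idx (ω t)) (ω t) k : ℂ) • ω t := by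
  rw [meanDeriv_eq_sum, dirDeriv_eq_sum]
  simp only [S.derivVec_eq ht, smul_sub, Finset.sum_sub_distrib, sum_apply, smul_apply,
    Complex.coe_smul, smul_smul, Finset.sum_smul]

theorem norm_smul_self (S : EigenSetup b idx T X g δ lam j₀ H T₁ ω) (ht : t ∈ T₁) (r : ℝ) :
    ‖(r : ℂ) • ω t‖ = |r| := by
  rw [norm_smul, S.norm_eq ht, Complex.norm_real, Real.norm_eq_abs, mul_one]

/-- Second order accuracy of the linearisation at the eigenvector. -/
theorem exists_linearization_bound (S : EigenSetup b idx T X g δ lam j₀ H T₁ ω)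
    (ht₀ : (0 : ℝ) ∈ T₁) : ∃ τ > 0, ∃ r > 0, ∃ C : ℝ, 0 ≤ C ∧ ∀ t, |t| < τ → t ∈ T₁ ∧
      ∀ v : 𝓗, ‖v‖ ≤ r →
      |lam j₀ t (occ b idx (ω t + v)) - lam j₀ t (occ b idx (ω t)) -
        meanDeriv H t (occ b idx (ω t)) (ω t) (docc b idx (ω t) v)| ≤ C * ‖v‖ ^ 2 ∧
      ‖shifted H (lam j₀) t (occ b idx (ω t + v)) (ω t + v) -
        (shifted H (lam j₀) t (occ b idx (ω t)) v +
          ∑ j, (docc b idx (ω t) v j : ℂ) •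
            derivVec b idx (shifted H (lam j₀) t) (ω t) j)‖ ≤ C * ‖v‖ ^ 2 := by
  obtain ⟨R, hR, C, hC, hT⟩ := S.adm.exists_lam_taylor S.gap_pos (S.mem_T ht₀) (S.occ_mem ht₀)
  have hcont : ∀ᶠ t in 𝓝 (0 : ℝ), dist (occ b idx (ω t)) (occ b idx (ω 0)) < R / 2 :=
    (S.contDiffAt_occ ht₀).continuousAt.eventually (Metric.ball_mem_nhds _ (by linarith))
  obtain ⟨τ, hτ, hball⟩ := Metric.mem_nhds_iff.1
    ((hcont.and (S.isOpen.mem_nhds ht₀)).and (Metric.ball_mem_nhds (0 : ℝ) hR))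
  -- Occupations move by at most `3 ‖v‖`, so `R / 8` keeps them within the remaining `R / 2`. The
  -- six error terms below total `26 C ‖v‖²`; `50` is generous.
  refine ⟨τ, hτ, min 1 (R / 8), by positivity, 50 * (C + 1), by positivity, fun t ht => ?_⟩
  obtain ⟨⟨hxt, htT⟩, htR⟩ := hball (show t ∈ Metric.ball (0 : ℝ) τ by simpa using ht)
  refine ⟨htT, fun v hv => ?_⟩
  have hv1 : ‖v‖ ≤ 1 := hv.trans (min_le_left _ _)
  have hvR : ‖v‖ ≤ R / 8 := hv.trans (min_le_right _ _)
  set x := occ b idx (ω t) with hx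
  set y := occ b idx (ω t + v) with hy
  set ρ : Fin p → ℝ := docc b idx (ω t) v with hρ
  set σ : Fin p → ℝ := fun j => ‖(inner ℂ (b (idx j)) v : ℂ)‖ ^ 2 with hσ
  have hyx : y - x = ρ + σ := by
    ext j
    simp only [hy, hx, hρ, hσ, Pi.sub_apply, Pi.add_apply, occ_add]
    ring
  have hσn : ‖σ‖ ≤ ‖v‖ ^ 2 := by
    refine (pi_norm_le_iff_of_nonneg (by positivity)).2 fun j => ?_
    have := norm_inner_basis_le b (idx j) v
    simp only [hσ, norm_pow, norm_norm]
    gcongr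
  have hρn : ‖ρ‖ ≤ 2 * ‖v‖ := by
    refine (pi_norm_le_iff_of_nonneg (by positivity)).2 fun j => ?_
    have := abs_docc_le b idx (ω t) v j
    rwa [S.norm_eq htT, one_mul] at this
  have hkn : ‖y - x‖ ≤ 3 * ‖v‖ := by
    rw [hyx]
    refine (norm_add_le _ _).trans ?_
    nlinarith [norm_nonneg v]
  have hxm : ((t, x) : ℝ × (Fin p → ℝ)) ∈ Metric.ball ((0 : ℝ), occ b idx (ω 0)) R := by
    rw [Metric.mem_ball, Prod.dist_eq]
    exact max_lt htR (by linarith)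
  have hym : ((t, y) : ℝ × (Fin p → ℝ)) ∈ Metric.ball ((0 : ℝ), occ b idx (ω 0)) R := by
    rw [Metric.mem_ball, Prod.dist_eq]
    refine max_lt htR ?_
    have h1 := dist_triangle y x (occ b idx (ω 0))
    rw [dist_eq_norm y x] at h1
    simp only
    linarith
  obtain ⟨-, -, -, hD, h1, h2, h3, h4⟩ := hT t x y hxm hym
  have heig : H t x (ω t) = (lam j₀ t x : ℂ) • ω t := S.eig.eigen t htT
  have h4 := h4 (ω t) (S.norm_eq htT) heig
  have hk2 : ‖y - x‖ ^ 2 ≤ 9 * ‖v‖ ^ 2 := by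
    have : ‖y - x‖ ^ 2 ≤ (3 * ‖v‖) ^ 2 := by gcongr
    linarith
  have hDσ : ‖dirDeriv H t x σ‖ ≤ C * ‖v‖ ^ 2 := (hD σ).trans (by gcongr)
  have hmσ : |meanDeriv H t x (ω t) σ| ≤ C * ‖v‖ ^ 2 :=
    (abs_meanDeriv_le H t x (S.norm_eq htT) σ).trans hDσ
  have hmadd : meanDeriv H t x (ω t) (y - x) =
      meanDeriv H t x (ω t) ρ + meanDeriv H t x (ω t) σ := by
    rw [hyx, meanDeriv, dirDeriv_add, add_apply, inner_add_right, Complex.add_re]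
    rfl
  have hv2 : 0 ≤ ‖v‖ ^ 2 := by positivity
  have hCk2 : C * ‖y - x‖ ^ 2 ≤ C * (9 * ‖v‖ ^ 2) := by gcongr
  have hCv2 : 0 ≤ C * ‖v‖ ^ 2 := by positivity
  constructor
  · rw [hmadd] at h4
    rw [abs_le] at h4 hmσ ⊢
    constructor <;> nlinarith
  · rw [S.sum_smul_derivVec htT, ← hx]
    have hdadd : dirDeriv H t x (y - x) = dirDeriv H t x ρ + dirDeriv H t x σ := by
      rw [hyx, dirDeriv_add]
    -- Three sources of error, each appearing for `H` and for the eigenvalue: the Taylor remainder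
    -- on `ω`, the quadratic part `σ` of the occupations, and the variation of the operator acting
    -- on `v`.
    have heq : shifted H (lam j₀) t y (ω t + v) -
        (shifted H (lam j₀) t x v + (dirDeriv H t x ρ (ω t) -
          (meanDeriv H t x (ω t) ρ : ℂ) • ω t)) =
        (H t y - H t x - dirDeriv H t x (y - x)) (ω t)
        - ((lam j₀ t y - lam j₀ t x - meanDeriv H t x (ω t) (y - x) : ℝ) : ℂ) • ω t
        + dirDeriv H t x σ (ω t) - (meanDeriv H t x (ω t) σ : ℂ) • ω t
        + (H t y - H t x) v - ((lam j₀ t y - lam j₀ t x : ℝ) : ℂ) • v := by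
      rw [hmadd, hdadd]
      simp only [shifted_eq, sub_apply, add_apply, smul_apply, one_apply_eq_self, map_add, heig]
      push_cast
      module
    rw [heq]
    have n1 : ‖(H t y - H t x - dirDeriv H t x (y - x)) (ω t)‖ ≤ C * (9 * ‖v‖ ^ 2) := by
      have := ContinuousLinearMap.le_of_opNorm_le _ h2 (ω t)
      rw [S.norm_eq htT, mul_one] at this
      exact this.trans hCk2
    have n2 : ‖((lam j₀ t y - lam j₀ t x - meanDeriv H t x (ω t) (y - x) : ℝ) : ℂ) • ω t‖ ≤
        C * (9 * ‖v‖ ^ 2) := by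
      rw [S.norm_smul_self htT]
      exact h4.trans hCk2
    have n3 : ‖dirDeriv H t x σ (ω t)‖ ≤ C * ‖v‖ ^ 2 := by
      have := ContinuousLinearMap.le_of_opNorm_le _ hDσ (ω t)
      rwa [S.norm_eq htT, mul_one] at this
    have n4 : ‖(meanDeriv H t x (ω t) σ : ℂ) • ω t‖ ≤ C * ‖v‖ ^ 2 := by
      rwa [S.norm_smul_self htT]
    have hCk : C * ‖y - x‖ ≤ C * (3 * ‖v‖) := by gcongr
    have n5 : ‖(H t y - H t x) v‖ ≤ 3 * (C * ‖v‖ ^ 2) := by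
      refine (ContinuousLinearMap.le_of_opNorm_le _ (h1.trans hCk) v).trans (le_of_eq ?_)
      ring
    have n6 : ‖((lam j₀ t y - lam j₀ t x : ℝ) : ℂ) • v‖ ≤ 3 * (C * ‖v‖ ^ 2) := by
      rw [norm_smul, Complex.norm_real, Real.norm_eq_abs]
      have := mul_le_mul_of_nonneg_right (h3.trans hCk) (norm_nonneg v)
      linarith
    refine (norm_sub_le _ _).trans ?_
    refine (add_le_add_left (norm_add_le _ _) _).trans ?_
    refine (add_le_add_left (add_le_add_left (norm_sub_le _ _) _) _).trans ?_
    refine (add_le_add_left (add_le_add_left (add_le_add_left (norm_add_le _ _) _) _) _).trans ?_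
    refine (add_le_add_left (add_le_add_left (add_le_add_left
      (add_le_add_left (norm_sub_le _ _) _) _) _) _).trans ?_
    linarith

end EigenSetup

end

section

variable {𝓗 : Type u} [NormedAddCommGroup 𝓗] [InnerProductSpace ℂ 𝓗]
variable {ι : Type w} {p : ℕ}
variable {b : HilbertBasis ι ℂ 𝓗} {idx : Fin p ↪ ι} {T X : Set ℝ} {g δ : ℝ}
  {N : ℕ} {lam : Fin N → ℝ → (Fin p → ℝ) → ℝ} {j₀ : Fin N}
  {H : ℝ → (Fin p → ℝ) → 𝓗 →L[ℂ] 𝓗} {T₁ : Set ℝ} {ω : ℝ → 𝓗} {t : ℝ}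

/-! ### Solutions of the nonlinear equation -/

theorem IsSolution.hasDerivAt {T₀ : Set ℝ} {ε : ℝ} {v₀ : 𝓗} {v : ℝ → 𝓗}
    (hv : IsSolution b idx H T₀ ε v₀ v) (hε : 0 < ε) (ht : t ∈ T₀) :
    HasDerivAt v ((-(Complex.I / (ε : ℂ))) • H t (occ b idx (v t)) (v t)) t := by
  have hεc : (ε : ℂ) ≠ 0 := by exact_mod_cast hε.ne'
  have h := (hv.differentiable t ht).hasDerivAt
  have h2 : deriv v t = (-(Complex.I / (ε : ℂ))) • H t (occ b idx (v t)) (v t) := by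
    rw [← hv.equation t ht, smul_smul]
    have : -(Complex.I / (ε : ℂ)) * (Complex.I * ε) = 1 := by
      field_simp
      rw [Complex.I_sq]
      norm_num
    rw [this, one_smul]
  rwa [h2] at h

variable [CompleteSpace 𝓗]

theorem inner_add_inner_eq_zero {A : 𝓗 →L[ℂ] 𝓗} (hA : IsSelfAdjoint A) (r : ℝ) (v : 𝓗) :
    (inner ℂ v ((-(Complex.I / (r : ℂ))) • A v) : ℂ) +
      inner ℂ ((-(Complex.I / (r : ℂ))) • A v) v = 0 := by
  have hsym := (ContinuousLinearMap.isSelfAdjoint_iff_isSymmetric.1 hA) v v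
  simp only [ContinuousLinearMap.coe_coe] at hsym
  rw [inner_smul_right, inner_smul_left, hsym]
  simp
  ring

/-- The norm is conserved. -/
theorem IsSolution.norm_eq_one {ε τ : ℝ} {v₀ : 𝓗} {v : ℝ → 𝓗}
    (h : IsAdmissible b T X g δ lam j₀ H) (hv : IsSolution b idx H (Set.Ioo (-τ) τ) ε v₀ v)
    (hε : 0 < ε) (hsub : Set.Ioo (-τ) τ ⊆ T) (hτ : 0 < τ) (hv₀ : ‖v₀‖ = 1) :
    ∀ t ∈ Set.Ioo (-τ) τ, ‖v t‖ = 1 := by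
  have hcont : ∀ t ∈ Set.Ioo (-τ) τ, ContinuousAt v t :=
    fun t ht => (hv.differentiable t ht).continuousAt
  -- Self-adjointness is available only while the occupations stay in the cube, and unit norm is
  -- what ensures that. The circularity is broken by showing that `D` is open and relatively closed.
  set D : Set ℝ := {t | t ∈ Set.Ioo (-τ) τ ∧ ‖v t‖ = 1} with hD
  have hopen : IsOpen D := by
    rw [Metric.isOpen_iff]
    rintro t ⟨ht, hvt⟩
    have h1 : ∀ᶠ s in 𝓝 t, occ b idx (v s) ∈ cube p X :=
      ((contDiff_occ b idx (n := 0)).continuous.continuousAt.comp (hcont t ht)).eventually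
        ((isOpen_cube h.isOpen_X).mem_nhds (h.occ_mem_cube idx hvt))
    obtain ⟨r, hr, hball⟩ := Metric.mem_nhds_iff.1 (h1.and (isOpen_Ioo.mem_nhds ht))
    refine ⟨r, hr, fun s hs => ⟨(hball hs).2, ?_⟩⟩
    have hder : ∀ y ∈ Metric.ball t r, HasDerivAt (fun y => (inner ℂ (v y) (v y) : ℂ)) 0 y := by
      intro y hy
      have hd := hv.hasDerivAt hε (hball hy).2
      convert! hd.inner ℂ hd using 1
      exact (inner_add_inner_eq_zero (h.selfAdjoint y (hsub (hball hy).2) _ (hball hy).1) _ _).symm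
    have hconst := Metric.isOpen_ball.is_const_of_deriv_eq_zero
      (convex_ball t r).isPreconnected
      (fun y hy => (hder y hy).differentiableAt.differentiableWithinAt)
      (fun y hy => (hder y hy).deriv) hs (Metric.mem_ball_self hr)
    simp only [inner_self_eq_norm_sq_to_K, hvt] at hconst
    have h2 : ‖v s‖ ^ 2 = 1 := by
      have : ((‖v s‖ ^ 2 : ℝ) : ℂ) = ((1 : ℝ) : ℂ) := by
        push_cast
        simpa using hconst
      exact Complex.ofReal_injective this
    exact (pow_eq_one_iff_of_nonneg (norm_nonneg _) two_ne_zero).1 h2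
  have h0 : (0 : ℝ) ∈ Set.Ioo (-τ) τ := ⟨by linarith, hτ⟩
  have hsubD : Set.Ioo (-τ) τ ⊆ D := by
    refine (isPreconnected_Ioo).subset_of_closure_inter_subset hopen
      ⟨0, h0, h0, by rw [hv.init, hv₀]⟩ ?_
    rintro t ⟨htc, ht⟩
    refine ⟨ht, ?_⟩
    have h1 : t ∈ closure D := htc
    have h2 : (𝓝[D] t).NeBot := mem_closure_iff_nhdsWithin_neBot.1 h1
    have h3 : Tendsto (fun s => ‖v s‖) (𝓝[D] t) (𝓝 ‖v t‖) :=
      (hcont t ht).norm.tendsto.mono_left nhdsWithin_le_nhds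
    have h4 : Tendsto (fun s => ‖v s‖) (𝓝[D] t) (𝓝 1) := by
      refine tendsto_const_nhds.congr' ?_
      filter_upwards [self_mem_nhdsWithin] with s hs
      exact hs.2.symm
    exact tendsto_nhds_unique h3 h4
  exact fun t ht => (hsubD ht).2

theorem hasDerivAt_integral_of_continuousOn {f : ℝ → ℝ} {τ : ℝ}
    (hf : ContinuousOn f (Set.Ioo (-τ) τ)) (ht : t ∈ Set.Ioo (-τ) τ) :
    HasDerivAt (fun t => ∫ s in (0 : ℝ)..t, f s) (f t) t := by
  have h0 : (0 : ℝ) ∈ Set.Ioo (-τ) τ := by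
    have h1 := ht.1
    have h2 := ht.2
    constructor <;> linarith
  refine intervalIntegral.integral_hasDerivAt_right ?_
    (hf.stronglyMeasurableAtFilter isOpen_Ioo t ht) (hf.continuousAt (isOpen_Ioo.mem_nhds ht))
  refine (hf.mono ?_).intervalIntegrable
  exact (Set.ordConnected_Ioo).uIcc_subset h0 ht

/-- A solution in the gauge in which the linearised operator governs its evolution. -/
structure IsGaugedSolution (b : HilbertBasis ι ℂ 𝓗) (idx : Fin p ↪ ι)
    (H : ℝ → (Fin p → ℝ) → 𝓗 →L[ℂ] 𝓗) (mu : ℝ → (Fin p → ℝ) → ℝ) (ε τ : ℝ) (v₀ : 𝓗)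
    (u : ℝ → 𝓗) : Prop where
  init : u 0 = v₀
  norm_eq : ∀ t ∈ Set.Ioo (-τ) τ, ‖u t‖ = 1
  hasDerivAt : ∀ t ∈ Set.Ioo (-τ) τ,
    HasDerivAt u ((-(Complex.I / (ε : ℂ))) • shifted H mu t (occ b idx (u t)) (u t)) t

theorem norm_exp_neg_I_div_mul (ε r : ℝ) :
    ‖Complex.exp (-(Complex.I / (ε : ℂ)) * (r : ℂ))‖ = 1 := by
  have : -(Complex.I / (ε : ℂ)) * (r : ℂ) = ((-(r / ε) : ℝ) : ℂ) * Complex.I := by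
    push_cast
    ring
  rw [this, Complex.norm_exp_ofReal_mul_I]

/-- The division by `ε` is why the phase must be known to order `ε²`. -/
theorem norm_exp_sub_exp_le {ε : ℝ} (hε : 0 < ε) (r s : ℝ) :
    ‖Complex.exp (-(Complex.I / (ε : ℂ)) * (r : ℂ)) -
      Complex.exp (-(Complex.I / (ε : ℂ)) * (s : ℂ))‖ ≤ |r - s| / ε := by
  have h1 : Complex.exp (-(Complex.I / (ε : ℂ)) * (r : ℂ)) =
      Complex.exp (-(Complex.I / (ε : ℂ)) * (s : ℂ)) *
        Complex.exp (Complex.I * (((s - r) / ε : ℝ) : ℂ)) := by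
    rw [← Complex.exp_add]
    congr 1
    push_cast
    ring
  rw [h1, ← mul_sub_one, norm_mul, norm_exp_neg_I_div_mul, one_mul]
  refine (Real.norm_exp_I_mul_ofReal_sub_one_le).trans (le_of_eq ?_)
  rw [Real.norm_eq_abs, abs_div, abs_of_pos hε, abs_sub_comm]

/-- Removal of the dynamical phase. -/
theorem IsSolution.exists_gauge {ε τ : ℝ} {v₀ : 𝓗} {v : ℝ → 𝓗}
    (h : IsAdmissible b T X g δ lam j₀ H) (hg : 0 < g)
    (hv : IsSolution b idx H (Set.Ioo (-τ) τ) ε v₀ v)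
    (hε : 0 < ε) (hsub : Set.Ioo (-τ) τ ⊆ T) (hτ : 0 < τ) (hv₀ : ‖v₀‖ = 1) :
    ∃ (φ : ℝ → ℝ) (u : ℝ → 𝓗), IsGaugedSolution b idx H (lam j₀) ε τ v₀ u ∧ φ 0 = 0 ∧
      (∀ t ∈ Set.Ioo (-τ) τ, HasDerivAt φ (lam j₀ t (occ b idx (u t))) t) ∧
      ∀ t, v t = Complex.exp (-(Complex.I / (ε : ℂ)) * (φ t : ℂ)) • u t := by
  have hnorm := hv.norm_eq_one h hε hsub hτ hv₀
  -- The occupations are those of the solution, not of `ω`: this gauge makes `K(t,[u]) u` the exact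
  -- right-hand side, occupations being insensitive to phases.
  set φ : ℝ → ℝ := fun t => ∫ s in (0 : ℝ)..t, lam j₀ s (occ b idx (v s)) with hφ
  have hcont : ContinuousOn (fun s => lam j₀ s (occ b idx (v s))) (Set.Ioo (-τ) τ) := by
    have h1 : ContinuousOn (fun s => ((s, occ b idx (v s)) : ℝ × (Fin p → ℝ)))
        (Set.Ioo (-τ) τ) := by
      refine continuousOn_id.prodMk ?_
      exact (contDiff_occ b idx (n := 0)).continuous.comp_continuousOn
        fun s hs => (hv.differentiable s hs).continuousAt.continuousWithinAt
    exact (h.continuousOn_lam hg j₀).comp h1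
      fun s hs => ⟨hsub hs, h.occ_mem_cube idx (hnorm s hs)⟩
  have hφd : ∀ t ∈ Set.Ioo (-τ) τ, HasDerivAt φ (lam j₀ t (occ b idx (v t))) t :=
    fun t ht => hasDerivAt_integral_of_continuousOn hcont ht
  have hexp : ∀ t, Complex.exp (-(Complex.I / (ε : ℂ)) * (φ t : ℂ)) *
      Complex.exp (Complex.I / (ε : ℂ) * (φ t : ℂ)) = 1 := by
    intro t
    rw [← Complex.exp_add]
    simp
  have hexpn : ∀ t, ‖Complex.exp (Complex.I / (ε : ℂ) * (φ t : ℂ))‖ = 1 := by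
    intro t
    have := congrArg norm (hexp t)
    rwa [norm_mul, norm_exp_neg_I_div_mul, one_mul, norm_one] at this
  set u : ℝ → 𝓗 := fun t => Complex.exp (Complex.I / (ε : ℂ) * (φ t : ℂ)) • v t with hu
  have hocc : ∀ t, occ b idx (u t) = occ b idx (v t) := fun t => occ_smul b idx (hexpn t) _
  refine ⟨φ, u, ⟨?_, ?_, ?_⟩, by simp [hφ], ?_, ?_⟩
  · simp [hu, hφ, hv.init]
  · intro t ht
    rw [hu]
    simp only
    rw [norm_smul, hexpn, hnorm t ht, one_mul]
  · intro t ht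
    have h1 : HasDerivAt (fun s => Complex.I / (ε : ℂ) * (φ s : ℂ)) _ t :=
      (hφd t ht).ofReal_comp.const_mul _
    have h2 := h1.cexp.smul (hv.hasDerivAt hε ht)
    convert! h2 using 1
    rw [hocc, shifted_eq, sub_apply, smul_apply, one_apply_eq_self, hu]
    simp only
    rw [map_smul]
    module
  · intro t ht
    rw [hocc]
    exact hφd t ht
  · intro t
    rw [hu]
    simp only
    rw [smul_smul, hexp, one_smul]

theorem _root_.HasDerivAt.clm_apply_complex {E F : Type*} [NormedAddCommGroup E] [NormedSpace ℂ E]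
    [NormedAddCommGroup F] [NormedSpace ℂ F] {A : ℝ → E →L[ℂ] F} {A' : E →L[ℂ] F} {v : ℝ → E}
    {v' : E} (hA : HasDerivAt A A' t) (hv : HasDerivAt v v' t) :
    HasDerivAt (fun s => A s (v s)) (A t v' + A' (v t)) t := by
  have h := ((isBoundedBilinearMap_apply (𝕜 := ℂ) (E := E) (F := F)).hasFDerivAt
    (A t, v t)).restrictScalars ℝ
  exact h.comp_hasDerivAt (f := fun s => (A s, v s)) t (hA.prodMk hv)

/-! ### The bootstrap estimate for the amplitude -/

namespace EigenSetup

/-- Uniform closeness of gauged solutions to the instantaneous eigenvector. -/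
theorem exists_error_bound (S : EigenSetup b idx T X g δ lam j₀ H T₁ ω) (h0 : (0 : ℝ) ∈ T₁)
    (hF : IsRealSemisimpleOn (linF b idx H (lam j₀) ω) T₁) :
    ∃ τ > 0, ∃ ε₀ > 0, ∃ D : ℝ, 0 ≤ D ∧ ∀ τ', 0 < τ' → τ' ≤ τ → ∀ ε, 0 < ε → ε < ε₀ →
      ∀ u : ℝ → 𝓗, IsGaugedSolution b idx H (lam j₀) ε τ' (ω 0) u →
        ∀ t ∈ Set.Ioo (-τ') τ', ‖u t - ω t‖ ≤ D * ε := by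
  obtain ⟨M, ℓ, Q, hQ, -⟩ := hF
  obtain ⟨τ₁, hτ₁, r, hr, C₁, hC₁, hlin⟩ := S.exists_linearization_bound h0
  obtain ⟨Cβ, hCβ, hβ⟩ := exists_bound_deriv (S.contDiffAt_corrector h0)
  obtain ⟨U₁, hU₁, L, hL, hFL⟩ := S.exists_lipschitz_linF h0
  have hFc : ContinuousAt (linF b idx H (lam j₀) ω) 0 := by
    have : LipschitzOnWith L.toNNReal (linF b idx H (lam j₀) ω) U₁ := by
      refine LipschitzOnWith.of_dist_le_mul fun t ht s hs => ?_
      rw [dist_eq_norm, Real.dist_eq, Real.coe_toNNReal _ hL]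
      exact hFL t ht s hs
    exact this.continuousOn.continuousAt hU₁
  obtain ⟨U₂, hU₂, C₂, hC₂, hQC⟩ := exists_norm_proj_sub_le hFc
    (by filter_upwards [S.isOpen.mem_nhds h0] with t ht using hQ t ht)
  obtain ⟨τ₂, hτ₂, hball⟩ := Metric.mem_nhds_iff.1 ((inter_mem hU₁ hU₂) |> inter_mem hβ)
  set b₀ : ℝ := M * C₂ * Cβ with hb₀
  have hb₀0 : 0 ≤ b₀ := by positivity
  -- In units of `ε`, `b₀` bounds the initial projected remainder, `D` bounds `u - ω` while the
  -- bootstrap holds, and `b₁` exceeds the resulting growth rate; its final `+ 1` gives strictness.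
  -- There is no circularity, since times of length at most `1 / b₁` let the remainder gain at most
  -- one unit.
  set D : ℝ := b₀ + 1 + Cβ with hD
  have hDpos : 0 < D := by positivity
  set b₁ : ℝ := M * (C₂ * L) * (b₀ + 1) + M * C₂ * (C₁ * D ^ 2 + Cβ) + 1 with hb₁
  have hb₁pos : 0 < b₁ := by positivity
  refine ⟨min (min τ₁ τ₂) (1 / b₁), by positivity, r / D, by positivity, D, hDpos.le, ?_⟩
  intro τ' hτ' hτ'le ε hε hεlt u hu
  have hεc : (ε : ℂ) ≠ 0 := by exact_mod_cast hε.ne'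
  have hDr : ε * D ≤ r := by
    rw [lt_div_iff₀ hDpos] at hεlt
    exact hεlt.le
  have hin : ∀ s ∈ Set.Ioo (-τ') τ', |s| < τ₁ ∧ |s| < τ₂ ∧ b₁ * |s| ≤ 1 := by
    intro s hs
    have h1 : |s| < τ' := abs_lt.2 hs
    refine ⟨h1.trans_le (hτ'le.trans ((min_le_left _ _).trans (min_le_left _ _))),
      h1.trans_le (hτ'le.trans ((min_le_left _ _).trans (min_le_right _ _))), ?_⟩
    have h2 : |s| ≤ 1 / b₁ := (h1.trans_le (hτ'le.trans (min_le_right _ _))).le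
    rw [le_div_iff₀ hb₁pos] at h2
    linarith
  have hT : ∀ s ∈ Set.Ioo (-τ') τ', s ∈ T₁ := fun s hs => (hlin s (hin s hs).1).1
  have hnb : ∀ s ∈ Set.Ioo (-τ') τ', (DifferentiableAt ℝ S.corrector s ∧ ‖S.corrector s‖ ≤ Cβ ∧
      ‖deriv S.corrector s‖ ≤ Cβ) ∧ s ∈ U₁ ∧ s ∈ U₂ := fun s hs =>
    hball (by simpa using (hin s hs).2.1)
  -- the remainder after subtraction of the corrector
  set z : ℝ → 𝓗 := fun s => u s - ω s - (ε * Complex.I : ℂ) • S.corrector s with hz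
  set Wf : ℝ → 𝓗 → 𝓗 := fun s v => shifted H (lam j₀) s (occ b idx (ω s)) v +
    ∑ j, (docc b idx (ω s) v j : ℂ) • derivVec b idx (shifted H (lam j₀) s) (ω s) j with hWf
  set q : ℝ → 𝓗 := fun s =>
    shifted H (lam j₀) s (occ b idx (u s)) (u s) - Wf s (u s - ω s) with hq
  set m : ℝ → 𝓗 := fun s => (-(Complex.I / (ε : ℂ))) • q s -
    (ε * Complex.I : ℂ) • deriv S.corrector s with hm
  have hzder : ∀ s ∈ Set.Ioo (-τ') τ',
      HasDerivAt z ((-(Complex.I / (ε : ℂ))) • Wf s (z s) + m s) s := by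
    intro s hs
    have hsT := hT s hs
    have h1 := ((hu.hasDerivAt s hs).sub (S.hasDerivAt hsT)).sub
      ((hnb s hs).1.1.hasDerivAt.const_smul (ε * Complex.I : ℂ))
    convert! h1 using 1
    have h2 : Wf s (u s - ω s) = Wf s (z s) + (ε * Complex.I : ℂ) • deriv ω s := by
      have h3 : u s - ω s = z s + (ε * Complex.I : ℂ) • S.corrector s := by
        rw [hz]
        simp
      -- With no contribution to the occupations, the corrector enters the linearised operator only
      -- through `K β = ω'`, which cancels the source term exactly.
      have h4 : ∀ j, docc b idx (ω s) ((ε * Complex.I : ℂ) • S.corrector s) j = 0 := by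
        intro j
        rw [mul_smul, docc_real_smul, S.docc_I_smul_eq_zero hsT (S.conj_corrector hsT), mul_zero]
      rw [h3, hWf]
      simp only [map_add, docc_add, h4, add_zero, map_smul, S.shifted_corrector hsT]
      abel
    have h5 : shifted H (lam j₀) s (occ b idx (u s)) (u s) =
        Wf s (z s) + (ε * Complex.I : ℂ) • deriv ω s + q s := by
      rw [← h2, hq]
      simp
    rw [h5, hm]
    simp only [smul_add, smul_smul]
    have h6 : -(Complex.I / (ε : ℂ)) * (ε * Complex.I) = 1 := by
      field_simp
      rw [Complex.I_sq]
      norm_num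
    rw [h6]
    module
  set Y : ℝ → 𝓗 × 𝓗 := fun s => (z s, conjugation b (z s)) with hY
  have hYnorm : ∀ s, ‖Y s‖ = ‖z s‖ := by
    intro s
    rw [hY, Prod.norm_mk, norm_conjugation, max_self]
  have hYder : ∀ s ∈ Set.Ioo (-τ') τ',
      HasDerivAt Y ((-(Complex.I / (ε : ℂ))) • linF b idx H (lam j₀) ω s (Y s) +
        (m s, conjugation b (m s))) s := by
    intro s hs
    have h1 := (hzder s hs).prodMk (hasDerivAt_conj b (hzder s hs))
    convert! h1 using 1
    have h2 : linF b idx H (lam j₀) ω s (Y s) =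
        (Wf s (z s), -conjugation b (Wf s (z s))) :=
      blockF₀_add_blockG_apply b idx _ _ _ _
    rw [h2]
    generalize Wf s (z s) = x
    ext
    · simp
    · simp [map_smulₛₗ, neg_div]
  -- The bootstrap implication: the quadratic error `O(ε²)`, divided by `ε`, and the derivative of
  -- the corrector are both `O(ε)`.
  have hbound : ∀ s ∈ Set.Ioo (-τ') τ', ‖z s‖ ≤ ε * (b₀ + 1) →
      ‖u s - ω s‖ ≤ D * ε ∧ ‖m s‖ ≤ ε * (C₁ * D ^ 2 + Cβ) := by
    intro s hs hzs
    have h1 : ‖(ε * Complex.I : ℂ) • S.corrector s‖ ≤ ε * Cβ := by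
      rw [norm_smul, norm_mul, Complex.norm_I, Complex.norm_real, Real.norm_eq_abs,
        abs_of_pos hε, mul_one]
      exact mul_le_mul_of_nonneg_left (hnb s hs).1.2.1 hε.le
    have h2 : ‖u s - ω s‖ ≤ D * ε := by
      have h3 : u s - ω s = z s + (ε * Complex.I : ℂ) • S.corrector s := by
        rw [hz]
        simp
      rw [h3, hD]
      refine (norm_add_le _ _).trans ?_
      linarith
    refine ⟨h2, ?_⟩
    have h4 := ((hlin s (hin s hs).1).2 (u s - ω s) (h2.trans (by linarith))).2
    rw [add_sub_cancel] at h4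
    have h5 : ‖q s‖ ≤ C₁ * (D * ε) ^ 2 := by
      refine h4.trans ?_
      gcongr
    rw [hm]
    refine (norm_sub_le _ _).trans ?_
    rw [norm_smul, norm_smul, norm_neg, norm_div, norm_mul, Complex.norm_I, Complex.norm_real,
      Real.norm_eq_abs, abs_of_pos hε, mul_one]
    have h6 := mul_le_mul_of_nonneg_left (hnb s hs).1.2.2 hε.le
    have h7 : 1 / ε * ‖q s‖ ≤ 1 / ε * (C₁ * (D * ε) ^ 2) := by gcongr
    have h8 : 1 / ε * (C₁ * (D * ε) ^ 2) = ε * (C₁ * D ^ 2) := by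
      field_simp
    linarith
  have h0' : (0 : ℝ) ∈ Set.Ioo (-τ') τ' := ⟨by linarith, hτ'⟩
  have hz0 : ‖z 0‖ ≤ ε * Cβ := by
    rw [hz]
    simp only
    rw [hu.init, sub_self, zero_sub, norm_neg, norm_smul, norm_mul, Complex.norm_I,
      Complex.norm_real, Real.norm_eq_abs, abs_of_pos hε, mul_one]
    exact mul_le_mul_of_nonneg_left (hnb 0 h0').1.2.1 hε.le
  -- The comparison lemma runs forward from `0`; the sign `σ` treats both time directions, keeping
  -- the frequencies real.
  have hdir : ∀ σ : ℝ, |σ| = 1 → ∀ t₁, 0 ≤ t₁ → t₁ < τ' → ‖z (σ * t₁)‖ ≤ ε * (b₀ + 1) := by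
    intro σ hσ t₁ ht₁ ht₁τ
    have habs : ∀ s, |σ * s| = |s| := fun s => by rw [abs_mul, hσ, one_mul]
    have hmem : ∀ s ∈ Set.Icc 0 t₁, σ * s ∈ Set.Ioo (-τ') τ' := by
      intro s hs
      have : |σ * s| < τ' := by
        rw [habs, abs_of_nonneg hs.1]
        exact hs.2.trans_lt ht₁τ
      exact abs_lt.1 this
    have hb₁s : ∀ s ∈ Set.Icc 0 t₁, b₁ * s ≤ 1 := by
      intro s hs
      have := (hin _ (hmem s hs)).2.2
      rwa [habs, abs_of_nonneg hs.1] at this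
    have hQd : ∀ s ∈ Set.Icc 0 t₁, IsRealSpectralDecomposition
        (linF b idx H (lam j₀) ω (σ * s)) (fun i => ℓ i (σ * s)) (fun i => Q i (σ * s)) :=
      fun s hs => hQ _ (hT _ (hmem s hs))
    have main := sum_norm_proj_le_of_hasDerivAt (Q := fun i s => Q i (σ * s))
      (m := fun i s => -(σ * ℓ i (σ * s) / ε)) (τ := t₁) (C := C₂) (L := C₂ * L)
      (B₀ := ε * b₀) (B₁ := ε * b₁) (Y := fun s => Y (σ * s))
      (n := fun s => (σ : ℂ) • (m (σ * s), conjugation b (m (σ * s))))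
      (by positivity) hQd (fun s hs i => (hQC _ (hnb _ (hmem s hs)).2.2 i).1)
      (fun s hs s' hs' i => by
        refine ((hQC _ (hnb _ (hmem s hs)).2.2 i).2 _ (hnb _ (hmem s' hs')).2.2).trans ?_
        have h1 := hFL _ (hnb _ (hmem s hs)).2.1 _ (hnb _ (hmem s' hs')).2.1
        rw [← mul_sub, habs] at h1
        rw [mul_assoc]
        exact mul_le_mul_of_nonneg_left h1 hC₂)
      (fun s hs => by
        have h1 : HasDerivAt (fun s => σ * s) (σ * 1) s := (hasDerivAt_id s).const_mul σ
        have h2 := (hYder _ (hmem s hs)).scomp s h1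
        convert! h2 using 1
        rw [mul_one, (hQd s hs).apply_eq, smul_add, ← Complex.coe_smul, ← Complex.coe_smul,
          Finset.smul_sum, Finset.smul_sum]
        congr 1
        refine Finset.sum_congr rfl fun i _ => ?_
        rw [smul_smul, smul_smul]
        congr 1
        push_cast
        ring)
      (by
        have h1 : ∀ i ∈ Finset.univ, ‖Q i (σ * 0) (Y (σ * 0))‖ ≤ C₂ * (ε * Cβ) := by
          intro i _
          have h00 := hmem 0 ⟨le_rfl, ht₁⟩
          have h2 := (Q i (σ * 0)).le_of_opNorm_le (hQC _ (hnb _ h00).2.2 i).1 (Y (σ * 0))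
          refine h2.trans (mul_le_mul_of_nonneg_left ?_ hC₂)
          rw [hYnorm, mul_zero]
          exact hz0
        refine (Finset.sum_le_sum h1).trans (le_of_eq ?_)
        simp [hb₀]
        ring)
      (fun s hs hse => by
        have hs' : s ∈ Set.Icc 0 t₁ := Set.Ico_subset_Icc_self hs
        have h1 : ε * b₀ + ε * b₁ * s ≤ ε * (b₀ + 1) := by
          have := mul_le_mul_of_nonneg_left (hb₁s s hs') hε.le
          linarith
        have h2 : ‖z (σ * s)‖ ≤ ε * (b₀ + 1) := by
          rw [← hYnorm]
          exact ((hQd s hs').norm_le_sum _).trans (hse.le.trans h1)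
        have h3 := (hbound _ (hmem s hs') h2).2
        have h4 : ‖(σ : ℂ) • (m (σ * s), conjugation b (m (σ * s)))‖ ≤
            ε * (C₁ * D ^ 2 + Cβ) := by
          rw [norm_smul, Complex.norm_real, Real.norm_eq_abs, hσ, one_mul, Prod.norm_mk,
            norm_conjugation, max_self]
          exact h3
        have h5 : M * (C₂ * L) * (ε * b₀ + ε * b₁ * s) ≤ M * (C₂ * L) * (ε * (b₀ + 1)) := by
          gcongr
        have h6 : M * C₂ * ‖(σ : ℂ) • (m (σ * s), conjugation b (m (σ * s)))‖ ≤
            M * C₂ * (ε * (C₁ * D ^ 2 + Cβ)) := by gcongr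
        have h7 : ε * b₁ = M * (C₂ * L) * (ε * (b₀ + 1)) +
            M * C₂ * (ε * (C₁ * D ^ 2 + Cβ)) + ε := by
          rw [hb₁]
          ring
        linarith) t₁ ⟨ht₁, le_rfl⟩
    rw [← hYnorm]
    refine ((hQd t₁ ⟨ht₁, le_rfl⟩).norm_le_sum _).trans (main.trans ?_)
    have := mul_le_mul_of_nonneg_left (hb₁s t₁ ⟨ht₁, le_rfl⟩) hε.le
    linarith
  intro t ht
  refine (hbound t ht ?_).1
  rcases le_total 0 t with h | h
  · have := hdir 1 (by simp) t h ht.2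
    rwa [one_mul] at this
  · have := hdir (-1) (by simp) (-t) (by linarith) (by linarith [ht.1])
    rwa [neg_mul_neg, one_mul] at this

end EigenSetup

end

section

variable {𝓗 : Type u} [NormedAddCommGroup 𝓗] [InnerProductSpace ℂ 𝓗] [CompleteSpace 𝓗]
variable {ι : Type w} {p : ℕ}
variable {b : HilbertBasis ι ℂ 𝓗} {idx : Fin p ↪ ι} {T X : Set ℝ} {g δ : ℝ}
  {N : ℕ} {lam : Fin N → ℝ → (Fin p → ℝ) → ℝ} {j₀ : Fin N}
  {H : ℝ → (Fin p → ℝ) → 𝓗 →L[ℂ] 𝓗} {T₁ : Set ℝ} {ω : ℝ → 𝓗} {t : ℝ}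

namespace EigenSetup

/-! ### Real and imaginary parts with respect to the phase of the eigenvector -/

/-- The real part `(v + c̄ C v) / 2` of a vector, where `C ω = c ω`. -/
def realPart (S : EigenSetup b idx T X g δ lam j₀ H T₁ ω) (v : 𝓗) : 𝓗 :=
  (2⁻¹ : ℂ) • (v + starRingEnd ℂ S.phase • conjugation b v)

/-- `i` times the imaginary part, `(v - c̄ C v) / 2`. -/
def imagPart (S : EigenSetup b idx T X g δ lam j₀ H T₁ ω) (v : 𝓗) : 𝓗 :=
  (2⁻¹ : ℂ) • (v - starRingEnd ℂ S.phase • conjugation b v)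

theorem realPart_add (S : EigenSetup b idx T X g δ lam j₀ H T₁ ω) (v w : 𝓗) :
    S.realPart (v + w) = S.realPart v + S.realPart w := by
  simp only [realPart, map_add]
  module

theorem realPart_sub (S : EigenSetup b idx T X g δ lam j₀ H T₁ ω) (v w : 𝓗) :
    S.realPart (v - w) = S.realPart v - S.realPart w := by
  simp only [realPart, map_sub]
  module

theorem realPart_imaginary_smul (S : EigenSetup b idx T X g δ lam j₀ H T₁ ω) (r : ℝ) (v : 𝓗) :
    S.realPart ((Complex.I * r : ℂ) • v) = (Complex.I * r : ℂ) • S.imagPart v := by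
  simp only [realPart, imagPart, map_smulₛₗ, map_mul, Complex.conj_I, Complex.conj_ofReal]
  module

theorem norm_realPart_le (S : EigenSetup b idx T X g δ lam j₀ H T₁ ω) (ht : t ∈ T₁) (v : 𝓗) :
    ‖S.realPart v‖ ≤ ‖v‖ := by
  rw [realPart, norm_smul]
  have h1 : ‖v + starRingEnd ℂ S.phase • conjugation b v‖ ≤ ‖v‖ + ‖v‖ := by
    refine (norm_add_le _ _).trans ?_
    rw [norm_smul, RCLike.norm_conj, S.norm_phase ht, norm_conjugation, one_mul]
  have h2 : ‖(2⁻¹ : ℂ)‖ = 1 / 2 := by simp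
  rw [h2]
  linarith

theorem norm_imagPart_le (S : EigenSetup b idx T X g δ lam j₀ H T₁ ω) (ht : t ∈ T₁) (v : 𝓗) :
    ‖S.imagPart v‖ ≤ ‖v‖ := by
  rw [imagPart, norm_smul]
  have h1 : ‖v - starRingEnd ℂ S.phase • conjugation b v‖ ≤ ‖v‖ + ‖v‖ := by
    refine (norm_sub_le _ _).trans ?_
    rw [norm_smul, RCLike.norm_conj, S.norm_phase ht, norm_conjugation, one_mul]
  have h2 : ‖(2⁻¹ : ℂ)‖ = 1 / 2 := by simp
  rw [h2]
  linarith

theorem hasDerivAt_imagPart (S : EigenSetup b idx T X g δ lam j₀ H T₁ ω) {v : ℝ → 𝓗} {v' : 𝓗}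
    (hv : HasDerivAt v v' t) : HasDerivAt (fun s => S.imagPart (v s)) (S.imagPart v') t :=
  (hv.sub ((hasDerivAt_conj b hv).const_smul (starRingEnd ℂ S.phase))).const_smul (2⁻¹ : ℂ)

theorem realPart_eq_self (S : EigenSetup b idx T X g δ lam j₀ H T₁ ω) (ht : t ∈ T₁) {v : 𝓗}
    (hv : conjugation b v = S.phase • v) : S.realPart v = v := by
  rw [realPart, hv, smul_smul, S.conj_phase_mul ht]
  module

theorem imagPart_eq_zero (S : EigenSetup b idx T X g δ lam j₀ H T₁ ω) (ht : t ∈ T₁) {v : 𝓗}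
    (hv : conjugation b v = S.phase • v) : S.imagPart v = 0 := by
  rw [imagPart, hv, smul_smul, S.conj_phase_mul ht]
  module

theorem shifted_realPart (S : EigenSetup b idx T X g δ lam j₀ H T₁ ω) (ht : t ∈ T₁) (v : 𝓗) :
    shifted H (lam j₀) t (occ b idx (ω t)) (S.realPart v) =
      S.realPart (shifted H (lam j₀) t (occ b idx (ω t)) v) := by
  simp only [realPart, map_smul, map_add, S.conj_shifted_apply ht]

theorem realPart_sum_derivVec (S : EigenSetup b idx T X g δ lam j₀ H T₁ ω) (ht : t ∈ T₁)
    (k : Fin p → ℝ) :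
    S.realPart (∑ j, (k j : ℂ) • derivVec b idx (shifted H (lam j₀) t) (ω t) j) =
      ∑ j, (k j : ℂ) • derivVec b idx (shifted H (lam j₀) t) (ω t) j := by
  refine S.realPart_eq_self ht ?_
  rw [map_sum, Finset.smul_sum]
  refine Finset.sum_congr rfl fun j _ => ?_
  rw [conjugation_real_smul, S.conj_derivVec ht, smul_comm]

/-- The coordinates of `ω` are real up to the common phase, so only the real part of `v` changes the
occupations, and on it the change is a complex-linear form. -/
theorem two_mul_bra_realPart (S : EigenSetup b idx T X g δ lam j₀ H T₁ ω) (ht : t ∈ T₁) (v : 𝓗)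
    (j : Fin p) : 2 * bra b idx (ω t) j (S.realPart v) = (docc b idx (ω t) v j : ℂ) := by
  have h1 : starRingEnd ℂ S.phase * starRingEnd ℂ (inner ℂ (b (idx j)) (ω t)) =
      inner ℂ (b (idx j)) (ω t) := by
    rw [S.conj_inner_basis_eq ht, ← mul_assoc, S.conj_phase_mul ht, one_mul]
  rw [docc, Complex.ofReal_mul, Complex.re_eq_add_conj]
  simp only [realPart, map_smul, map_add, smul_eq_mul, bra_apply, inner_basis_conjugation, map_mul,
    Complex.conj_conj]
  rw [mul_left_comm (starRingEnd ℂ S.phase), ← mul_assoc (starRingEnd ℂ _) (starRingEnd ℂ S.phase),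
    mul_comm (starRingEnd ℂ (inner ℂ (b (idx j)) (ω t))) (starRingEnd ℂ S.phase), h1]
  push_cast
  ring

theorem coupling_realPart (S : EigenSetup b idx T X g δ lam j₀ H T₁ ω) (ht : t ∈ T₁) (v : 𝓗) :
    S.coupling t (S.realPart v) = ∑ j, (docc b idx (ω t) v j : ℂ) •
      derivVec b idx (shifted H (lam j₀) t) (ω t) j := by
  rw [coupling, sum_apply]
  refine Finset.sum_congr rfl fun j _ => ?_
  rw [smul_apply, ContinuousLinearMap.smulRight_apply, smul_smul, S.two_mul_bra_realPart ht]

/-! ### The phase estimate by integration by parts in time -/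

theorem inner_realPart (S : EigenSetup b idx T X g δ lam j₀ H T₁ ω) (ht : t ∈ T₁) (v : 𝓗) :
    (inner ℂ (ω t) (S.realPart v) : ℂ) = ((inner ℂ (ω t) v : ℂ).re : ℂ) := by
  rw [realPart, inner_smul_right, inner_add_right, inner_smul_right, inner_conjugation_comm,
    S.conj_eq ht, inner_smul_right, ← mul_assoc, S.conj_phase_mul ht, one_mul,
    Complex.re_eq_add_conj, inner_conj_symm]
  ring

/-- Two unit vectors differ to first order only orthogonally, in the real sense. Adding the rank one
term to `K` therefore costs only a quadratic error. -/
theorem re_inner_eq (S : EigenSetup b idx T X g δ lam j₀ H T₁ ω) (ht : t ∈ T₁) {v : 𝓗}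
    (hv : ‖ω t + v‖ = 1) : (inner ℂ (ω t) v : ℂ).re = -(‖v‖ ^ 2 / 2) := by
  have h := norm_add_sq (𝕜 := ℂ) (ω t) v
  rw [hv, S.norm_eq ht] at h
  simp only [RCLike.re_eq_complex_re] at h
  linarith

/-- The differential of the eigenvalue along the eigenvector, as a complex linear form. -/
def eigenvalueForm (_S : EigenSetup b idx T X g δ lam j₀ H T₁ ω) (t : ℝ) : 𝓗 →L[ℂ] ℂ :=
  ∑ j, ((2 * meanDeriv H t (occ b idx (ω t)) (ω t) (Pi.single j 1) : ℝ) : ℂ) • bra b idx (ω t) j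

theorem eigenvalueForm_realPart (S : EigenSetup b idx T X g δ lam j₀ H T₁ ω) (ht : t ∈ T₁)
    (v : 𝓗) : S.eigenvalueForm t (S.realPart v) =
      (meanDeriv H t (occ b idx (ω t)) (ω t) (docc b idx (ω t) v) : ℂ) := by
  rw [meanDeriv_eq_sum, eigenvalueForm, sum_apply, Complex.ofReal_sum]
  refine Finset.sum_congr rfl fun j _ => ?_
  rw [smul_apply, smul_eq_mul, Complex.ofReal_mul, Complex.ofReal_mul, ← S.two_mul_bra_realPart ht]
  push_cast
  ring

/-- The form `Ψ` with `Ψ (A a) = dλ(a)`, where `A` is the linearisation on real vectors. -/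
def phaseForm (S : EigenSetup b idx T X g δ lam j₀ H T₁ ω) (t : ℝ) : 𝓗 →L[ℂ] ℂ :=
  (S.eigenvalueForm t).comp (Ring.inverse (S.regular t + S.coupling t))

theorem phaseForm_apply (S : EigenSetup b idx T X g δ lam j₀ H T₁ ω) (ht : t ∈ T₁)
    (hδ : 12 * p * δ < g) (v : 𝓗) :
    S.phaseForm t ((S.regular t + S.coupling t) v) = S.eigenvalueForm t v := by
  have h := Ring.inverse_mul_cancel _ (S.isUnit_regular_add_coupling ht hδ)
  have h2 := congrArg (fun A : 𝓗 →L[ℂ] 𝓗 => A v) h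
  exact congrArg (S.eigenvalueForm t) h2

theorem contDiffAt_phaseForm (S : EigenSetup b idx T X g δ lam j₀ H T₁ ω) (ht : t ∈ T₁)
    (hδ : 12 * p * δ < g) : ContDiffAt ℝ 1 S.phaseForm t := by
  refine ContDiffAt.comp_complex ?_ ?_
  · refine ContDiffAt.sum fun j _ => ?_
    refine ContDiffAt.smul_complex ?_ (S.contDiffAt_bra ht j)
    exact Complex.ofRealCLM.contDiff.contDiffAt.comp t
      (contDiffAt_const.mul (S.contDiffAt_meanDeriv ht _))
  · exact ((S.contDiffAt_regular ht).add (S.contDiffAt_coupling ht)).inverse_complex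
      (S.isUnit_regular_add_coupling ht hδ)

/-- The real part of the equation for the deviation from the eigenvector. -/
theorem regular_add_coupling_realPart (S : EigenSetup b idx T X g δ lam j₀ H T₁ ω) (ht : t ∈ T₁)
    {v v' q : 𝓗} {ε : ℝ} (hv : ‖ω t + v‖ = 1)
    (heq : (Complex.I * ε : ℂ) • v' = shifted H (lam j₀) t (occ b idx (ω t)) v +
      ∑ j, (docc b idx (ω t) v j : ℂ) • derivVec b idx (shifted H (lam j₀) t) (ω t) j + q -
      (Complex.I * ε : ℂ) • deriv ω t) :
    (S.regular t + S.coupling t) (S.realPart v) =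
      (Complex.I * ε : ℂ) • S.imagPart v' -
        (S.realPart q + ((g * (‖v‖ ^ 2 / 2) : ℝ) : ℂ) • ω t) := by
  have h1 := congrArg S.realPart heq
  rw [S.realPart_imaginary_smul, S.realPart_sub, S.realPart_add, S.realPart_add,
    S.realPart_sum_derivVec ht, S.realPart_imaginary_smul,
    S.imagPart_eq_zero ht (S.conj_deriv_eq ht), ← S.shifted_realPart ht] at h1
  rw [h1, add_apply, S.coupling_realPart ht, regular, add_apply, smul_apply, ketBra_apply,
    S.inner_realPart ht, S.re_inner_eq ht hv]
  push_cast
  module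

/-- The phase of a solution is determined by the instantaneous eigenvalue up to `O(ε²)`. -/
theorem exists_phase_bound (S : EigenSetup b idx T X g δ lam j₀ H T₁ ω) (h0 : (0 : ℝ) ∈ T₁)
    (hδ : 12 * p * δ < g) {D : ℝ} (hD : 0 ≤ D) :
    ∃ τ > 0, ∃ ε₀ > 0, ∃ C : ℝ, 0 ≤ C ∧ ∀ τ', 0 < τ' → τ' ≤ τ → ∀ ε, 0 < ε → ε < ε₀ →
      ∀ (u : ℝ → 𝓗) (φ θ : ℝ → ℝ), IsGaugedSolution b idx H (lam j₀) ε τ' (ω 0) u →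
        (∀ t ∈ Set.Ioo (-τ') τ', ‖u t - ω t‖ ≤ D * ε) → φ 0 = θ 0 →
        (∀ t ∈ Set.Ioo (-τ') τ', HasDerivAt φ (lam j₀ t (occ b idx (u t))) t) →
        (∀ t ∈ Set.Ioo (-τ') τ', HasDerivAt θ (lam j₀ t (occ b idx (ω t))) t) →
        ∀ t ∈ Set.Ioo (-τ') τ', |φ t - θ t| ≤ C * ε ^ 2 := by
  have hg := S.gap_pos
  obtain ⟨τ₁, hτ₁, r, hr, C₁, hC₁, hlin⟩ := S.exists_linearization_bound h0
  obtain ⟨CΨ, hCΨ, hΨ⟩ := exists_bound_deriv (S.contDiffAt_phaseForm h0 hδ)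
  obtain ⟨τ₂, hτ₂, hball⟩ := Metric.mem_nhds_iff.1 hΨ
  set C₂ : ℝ := C₁ * D ^ 2 + CΨ * D + CΨ * (C₁ * D ^ 2 + g * D ^ 2) with hC₂
  have hC₂0 : 0 ≤ C₂ := by positivity
  refine ⟨min (min τ₁ τ₂) 1, by positivity, r / (D + 1), by positivity, C₂ + CΨ * D,
    by positivity, ?_⟩
  intro τ' hτ' hτ'le ε hε hεlt u φ θ hu hclose hφθ hφ hθ t ht
  have hεc : (ε : ℂ) ≠ 0 := by exact_mod_cast hε.ne'
  have hDr : D * ε ≤ r := by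
    rw [lt_div_iff₀ (by positivity)] at hεlt
    linarith
  have hin : ∀ s ∈ Set.Ioo (-τ') τ', |s| < τ₁ ∧ |s| < τ₂ ∧ |s| ≤ 1 := by
    intro s hs
    have h1 : |s| < τ' := abs_lt.2 hs
    exact ⟨h1.trans_le (hτ'le.trans ((min_le_left _ _).trans (min_le_left _ _))),
      h1.trans_le (hτ'le.trans ((min_le_left _ _).trans (min_le_right _ _))),
      (h1.trans_le (hτ'le.trans (min_le_right _ _))).le⟩
  set W : ℝ → 𝓗 := fun s => (Complex.I * ε : ℂ) • S.imagPart (u s - ω s) with hW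
  have hWn : ∀ s ∈ Set.Ioo (-τ') τ', ‖W s‖ ≤ D * ε ^ 2 := by
    intro s hs
    rw [hW]
    simp only
    rw [norm_smul, norm_mul, Complex.norm_I, Complex.norm_real, Real.norm_eq_abs, abs_of_pos hε,
      one_mul]
    have h1 := (S.norm_imagPart_le (hlin s (hin s hs).1).1 (u s - ω s)).trans (hclose s hs)
    calc ε * ‖S.imagPart (u s - ω s)‖ ≤ ε * (D * ε) := by gcongr
      _ = D * ε ^ 2 := by ring
  have hΨs : ∀ s ∈ Set.Ioo (-τ') τ', DifferentiableAt ℝ S.phaseForm s ∧ ‖S.phaseForm s‖ ≤ CΨ ∧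
      ‖deriv S.phaseForm s‖ ≤ CΨ := fun s hs => hball (by simpa using (hin s hs).2.1)
  -- Integration by parts: `Ψ(W')` equals the dangerous term `dλ(v)` up to `O(ε²)`, and subtracting
  -- `Ψ(W)`, itself `O(ε²)`, leaves a function whose derivative is `O(ε²)`.
  set R : ℝ → ℝ := fun s => φ s - θ s - (S.phaseForm s (W s)).re with hR
  have hRder : ∀ s ∈ Set.Ioo (-τ') τ', ∃ R', HasDerivAt R R' s ∧ ‖R'‖ ≤ C₂ * ε ^ 2 := by
    intro s hs
    have hsT : s ∈ T₁ := (hlin s (hin s hs).1).1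
    set v := u s - ω s with hv
    have hωv : ω s + v = u s := by rw [hv]; abel
    have hvn : ‖v‖ ≤ D * ε := hclose s hs
    have hv2 : ‖v‖ ^ 2 ≤ D ^ 2 * ε ^ 2 := by
      rw [← mul_pow]
      gcongr
    obtain ⟨hl1, hl2⟩ := (hlin s (hin s hs).1).2 v (hvn.trans hDr)
    rw [hωv] at hl1 hl2
    set q := shifted H (lam j₀) s (occ b idx (u s)) (u s) -
      (shifted H (lam j₀) s (occ b idx (ω s)) v +
        ∑ j, (docc b idx (ω s) v j : ℂ) •
          derivVec b idx (shifted H (lam j₀) s) (ω s) j) with hq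
    have hvder := (hu.hasDerivAt s hs).sub (S.hasDerivAt hsT)
    set v' := (-(Complex.I / (ε : ℂ))) • shifted H (lam j₀) s (occ b idx (u s)) (u s) -
      deriv ω s with hv'
    have hWder : HasDerivAt W ((Complex.I * ε : ℂ) • S.imagPart v') s :=
      (S.hasDerivAt_imagPart hvder).const_smul _
    have heq : (Complex.I * ε : ℂ) • v' = shifted H (lam j₀) s (occ b idx (ω s)) v +
        ∑ j, (docc b idx (ω s) v j : ℂ) • derivVec b idx (shifted H (lam j₀) s) (ω s) j + q -
        (Complex.I * ε : ℂ) • deriv ω s := by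
      rw [hq, add_sub_cancel, hv', smul_sub, smul_smul]
      have : Complex.I * ε * -(Complex.I / (ε : ℂ)) = 1 := by
        field_simp
        rw [Complex.I_sq]
        norm_num
      rw [this, one_smul]
    -- Applying `Ψ` to this identity expresses `dλ(v)` through `W'` and the quadratic error `e`.
    have hmain := S.regular_add_coupling_realPart hsT (by rw [hωv]; exact hu.norm_eq s hs) heq
    have h1 := S.phaseForm_apply hsT hδ (S.realPart v)
    set e := S.realPart q + ((g * (‖v‖ ^ 2 / 2) : ℝ) : ℂ) • ω s with he
    rw [hmain, map_sub, S.eigenvalueForm_realPart hsT] at h1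
    have hen : ‖e‖ ≤ (C₁ * D ^ 2 + g * D ^ 2) * ε ^ 2 := by
      rw [he]
      refine (norm_add_le _ _).trans ?_
      rw [S.norm_smul_self hsT, abs_of_nonneg (by positivity)]
      have h2 := (S.norm_realPart_le hsT q).trans hl2
      have h3 : C₁ * ‖v‖ ^ 2 ≤ C₁ * (D ^ 2 * ε ^ 2) := by gcongr
      have h4 : g * (‖v‖ ^ 2 / 2) ≤ g * (D ^ 2 * ε ^ 2) := by
        refine mul_le_mul_of_nonneg_left ?_ hg.le
        have : 0 ≤ ‖v‖ ^ 2 := by positivity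
        linarith
      linarith
    obtain ⟨hΨd, hΨn, hΨ'n⟩ := hΨs s hs
    have hder : HasDerivAt R _ s := ((hφ s hs).sub (hθ s hs)).sub
      (Complex.reCLM.hasFDerivAt.comp_hasDerivAt s (hΨd.hasDerivAt.clm_apply_complex hWder))
    refine ⟨_, hder, ?_⟩
    have h5 : S.phaseForm s ((Complex.I * ε : ℂ) • S.imagPart v') =
        (meanDeriv H s (occ b idx (ω s)) (ω s) (docc b idx (ω s) v) : ℂ) + S.phaseForm s e := by
      rw [← h1]
      abel
    rw [Complex.reCLM_apply, Complex.add_re, h5, Complex.add_re, Complex.ofReal_re]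
    have n1 : |(S.phaseForm s e).re| ≤ CΨ * ((C₁ * D ^ 2 + g * D ^ 2) * ε ^ 2) := by
      refine (Complex.abs_re_le_norm _).trans (((S.phaseForm s).le_of_opNorm_le hΨn e).trans ?_)
      gcongr
    have n2 : |(deriv S.phaseForm s (W s)).re| ≤ CΨ * (D * ε ^ 2) := by
      refine (Complex.abs_re_le_norm _).trans
        (((deriv S.phaseForm s).le_of_opNorm_le hΨ'n (W s)).trans ?_)
      exact mul_le_mul_of_nonneg_left (hWn s hs) hCΨ
    have n3 : C₁ * ‖v‖ ^ 2 ≤ C₁ * (D ^ 2 * ε ^ 2) := by gcongr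
    rw [Real.norm_eq_abs]
    rw [abs_le] at n1 n2 hl1 ⊢
    have hC₂e : C₂ * ε ^ 2 = C₁ * (D ^ 2 * ε ^ 2) + CΨ * (D * ε ^ 2) +
        CΨ * ((C₁ * D ^ 2 + g * D ^ 2) * ε ^ 2) := by
      rw [hC₂]
      ring
    constructor <;> linarith
  have h0' : (0 : ℝ) ∈ Set.Ioo (-τ') τ' := ⟨by linarith, hτ'⟩
  choose! R' hR' hR'n using hRder
  have hmv := (convex_Ioo (-τ') τ').norm_image_sub_le_of_norm_hasDerivWithin_le
    (fun s hs => (hR' s hs).hasDerivWithinAt) hR'n h0' ht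
  have hR0 : R 0 = 0 := by
    simp [hR, hW, hφθ, hu.init, imagPart]
  rw [hR0, sub_zero, sub_zero, Real.norm_eq_abs, Real.norm_eq_abs] at hmv
  have h6 : |R t| ≤ C₂ * ε ^ 2 := by
    refine hmv.trans ?_
    exact mul_le_of_le_one_right (by positivity) (hin t ht).2.2
  have h7 : |(S.phaseForm t (W t)).re| ≤ CΨ * (D * ε ^ 2) := by
    refine (Complex.abs_re_le_norm _).trans
      (((S.phaseForm t).le_of_opNorm_le (hΨs t ht).2.1 (W t)).trans ?_)
    exact mul_le_mul_of_nonneg_left (hWn t ht) hCΨ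
  have h8 : φ t - θ t = R t + (S.phaseForm t (W t)).re := by
    rw [hR]
    ring
  rw [h8]
  refine (abs_add_le _ _).trans ?_
  linarith

/-- The adiabatic approximation, with the dynamical phase of the instantaneous eigenvector. -/
theorem exists_adiabatic_bound (S : EigenSetup b idx T X g δ lam j₀ H T₁ ω) (h0 : (0 : ℝ) ∈ T₁)
    (hδ : 12 * p * δ < g) (hF : IsRealSemisimpleOn (linF b idx H (lam j₀) ω) T₁) :
    ∃ T₀ : Set ℝ, IsOpen T₀ ∧ T₀.OrdConnected ∧ (0 : ℝ) ∈ T₀ ∧ T₀ ⊆ T₁ ∧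
      ∃ c : ℝ, ∀ ε : ℝ, 0 < ε → ∀ v : ℝ → 𝓗, IsSolution b idx H T₀ ε (ω 0) v →
        ∀ t ∈ T₀,
          ‖v t - Complex.exp (-(Complex.I / (ε : ℂ)) *
              ((∫ s in (0 : ℝ)..t, lam j₀ s (occ b idx (ω s)) : ℝ) : ℂ)) • ω t‖
            ≤ c * ε := by
  obtain ⟨τ₁, hτ₁, ε₁, hε₁, D, hD, herr⟩ := S.exists_error_bound h0 hF
  obtain ⟨τ₂, hτ₂, ε₂, hε₂, C, hC, hph⟩ := S.exists_phase_bound h0 hδ hD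
  obtain ⟨τ₃, hτ₃, hball⟩ := Metric.isOpen_iff.1 S.isOpen 0 h0
  set τ := min (min τ₁ τ₂) τ₃ with hτdef
  have hτ : 0 < τ := by positivity
  have hsub : Set.Ioo (-τ) τ ⊆ T₁ := by
    intro s hs
    refine hball ?_
    have : |s| < τ := abs_lt.2 hs
    simpa using this.trans_le (min_le_right _ _)
  refine ⟨Set.Ioo (-τ) τ, isOpen_Ioo, Set.ordConnected_Ioo, ⟨by linarith, hτ⟩, hsub,
    D + C + 2 / min ε₁ ε₂, ?_⟩
  intro ε hε v hv t ht
  have hε₀ : 0 < min ε₁ ε₂ := by positivity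
  have hsubT := hsub.trans S.subset
  have hω0 := S.norm_eq h0
  set θ : ℝ → ℝ := fun t => ∫ s in (0 : ℝ)..t, lam j₀ s (occ b idx (ω s)) with hθ
  change ‖v t - Complex.exp (-(Complex.I / (ε : ℂ)) * (θ t : ℂ)) • ω t‖ ≤ _
  -- For `ε` bounded below, two unit vectors are at distance at most `2`, which the last summand of
  -- the constant absorbs.
  rcases lt_or_ge ε (min ε₁ ε₂) with hlt | hge
  · obtain ⟨φ, u, hu, hφ0, hφ, hvu⟩ := hv.exists_gauge S.adm S.gap_pos hε hsubT hτ hω0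
    have hclose := herr τ hτ ((min_le_left _ _).trans (min_le_left _ _)) ε hε
      (hlt.trans_le (min_le_left _ _)) u hu
    have hθd : ∀ t ∈ Set.Ioo (-τ) τ, HasDerivAt θ (lam j₀ t (occ b idx (ω t))) t := by
      intro s hs
      refine hasDerivAt_integral_of_continuousOn (fun y hy => ?_) hs
      exact (S.contDiffAt_eigenvalue (hsub hy)).continuousAt.continuousWithinAt
    have hphase := hph τ hτ ((min_le_left _ _).trans (min_le_right _ _)) ε hε
      (hlt.trans_le (min_le_right _ _)) u φ θ hu hclose (by simp [hφ0, hθ]) hφ hθd t ht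
    have heq : v t - Complex.exp (-(Complex.I / (ε : ℂ)) * (θ t : ℂ)) • ω t =
        Complex.exp (-(Complex.I / (ε : ℂ)) * (φ t : ℂ)) • (u t - ω t) +
        (Complex.exp (-(Complex.I / (ε : ℂ)) * (φ t : ℂ)) -
          Complex.exp (-(Complex.I / (ε : ℂ)) * (θ t : ℂ))) • ω t := by
      rw [hvu t]
      module
    rw [heq]
    refine (norm_add_le _ _).trans ?_
    rw [norm_smul, norm_smul, norm_exp_neg_I_div_mul, one_mul, S.norm_eq (hsub ht), mul_one]
    have h1 := hclose t ht
    have h2 := norm_exp_sub_exp_le hε (φ t) (θ t)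
    have h3 : |φ t - θ t| / ε ≤ C * ε := by
      rw [div_le_iff₀ hε]
      linarith
    have h4 : 0 ≤ 2 / min ε₁ ε₂ * ε := by positivity
    linarith
  · have h1 := hv.norm_eq_one S.adm hε hsubT hτ hω0 t ht
    refine (norm_sub_le _ _).trans ?_
    rw [norm_smul, norm_exp_neg_I_div_mul, one_mul, S.norm_eq (hsub ht), h1]
    have h2 : 2 ≤ 2 / min ε₁ ε₂ * ε := by
      rw [div_mul_eq_mul_div, le_div_iff₀ hε₀]
      linarith
    have h3 : 0 ≤ (D + C) * ε := by positivity
    linarith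

end EigenSetup

end

end NonlinearAdiabatic

end

open NonlinearAdiabatic in
theorem theorem2 (p : ℕ) (g : ℝ) (hg : 0 < g) :
    ∃ δ₀ : ℝ, 0 < δ₀ ∧
      ∀ (𝓗 : Type*) [NormedAddCommGroup 𝓗] [InnerProductSpace ℂ 𝓗] [CompleteSpace 𝓗]
        [TopologicalSpace.SeparableSpace 𝓗]
        (ι : Type*) (b : HilbertBasis ι ℂ 𝓗) (idx : Fin p ↪ ι)
        (T X : Set ℝ) (δ : ℝ) (N : ℕ) (lam : Fin N → ℝ → (Fin p → ℝ) → ℝ) (j₀ : Fin N)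
        (H : ℝ → (Fin p → ℝ) → 𝓗 →L[ℂ] 𝓗),
        0 < δ → δ < δ₀ → IsAdmissible b T X g δ lam j₀ H →
        ∀ (T₁ : Set ℝ) (ω : ℝ → 𝓗),
          IsOpen T₁ → T₁.OrdConnected → (0 : ℝ) ∈ T₁ → T₁ ⊆ T →
          IsNonlinearEigenvector b idx H (lam j₀) T₁ ω →
          IsRealSemisimpleOn (linF b idx H (lam j₀) ω) T₁ →
          ∃ T₀ : Set ℝ, IsOpen T₀ ∧ T₀.OrdConnected ∧ (0 : ℝ) ∈ T₀ ∧ T₀ ⊆ T₁ ∧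
            ∃ c : ℝ, ∀ ε : ℝ, 0 < ε → ∀ v : ℝ → 𝓗, IsSolution b idx H T₀ ε (ω 0) v →
              ∀ t ∈ T₀,
                ‖v t - Complex.exp (-(Complex.I / (ε : ℂ)) *
                    ((∫ s in (0 : ℝ)..t, lam j₀ s (occ b idx (ω s)) : ℝ) : ℂ)) • ω t‖
                  ≤ c * ε := by
  -- The `+ 1` keeps the threshold meaningful for `p = 0`; since `δ > 0`, it still implies `12pδ <
  -- g`.
  refine ⟨g / (12 * p + 1), by positivity, ?_⟩
  intro 𝓗 _ _ _ _ ι b idx T X δ N lam j₀ H hδ hδlt h T₁ ω hT₁ hord h0 hsub hω hF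
  have hsmall : 12 * p * δ < g := by
    rw [lt_div_iff₀ (by positivity)] at hδlt
    linarith
  exact EigenSetup.exists_adiabatic_bound ⟨h, hω, hg, hT₁, hord, hsub⟩ h0 hsmall hF
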